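/- Let $\lambda_1>0$, $Z>0$, $\omega<0$, and suppose that either (i) $\lambda_2>0$ and $\frac{Z^2}{4}<-\omega$, or (ii) $\lambda_2<0$ and $\frac{Z^2}{4}<-\omega<-\frac{3\lambda_1^2}{16\lambda_2}$. Put $\alpha=\lambda_1/4$, $\beta=\lambda_2/3$, $$R(s)=\frac{\sqrt{\alpha^2-\beta\omega}\,\sinh(2\sqrt{-\omega}\,s)}{\alpha+\sqrt{\alpha^2-\beta\omega}\,\cosh(2\sqrt{-\omega}\,s)},$$ $$\phi(x)=\Big[\tfrac{\alpha}{-\omega}+\tfrac{\sqrt{\alpha^2-\beta\omega}}{-\omega}\cosh\Big(2\sqrt{-\omega}\big(|x|+R^{-1}\big(\tfrac{Z}{2\sqrt{-\omega}}\big)\big)\Big)\Big]^{-1/2}.$$ On the complex Hilbert space $L^2(\mathbb R)$ let $\mathcal L_{1,Z}$ and $\mathcal L_{\min}$ both act as $-\frac{d^2}{dx^2}-\omega-3\lambda_1\phi^2-5\lambda_2\phi^4$, with domains $$D(\mathcal L_{1,Z})=\{g\in H^1(\mathbb R)\cap H^2(\mathbb R\setminus\{0\}): g'(0+)-g'(0-)=-Zg(0)\},\qquad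 D(\mathcal L_{\min})=\{f\in H^2(\mathbb R): f(0)=0\}.$$ For an operator $T$ let $n(T)$ be the number of its negative eigenvalues counted with multiplicity, and for densely defined $T$ let $n_\pm(T)=\dim\ker(T^*\mp i)$. Then: (a) $\mathcal L_{\min}$ is densely defined, symmetric and nonnegative, and $n_+(\mathcal L_{\min})=n_-(\mathcal L_{\min})=1$; the operator $\mathcal L_{1,Z}$ is a self-adjoint extension of $\mathcal L_{\min}$, and $n(\mathcal L_{1,Z})\le 1$. (b) If $\lambda_2>0$, or if $\lambda_2<0$, $Z<\frac{\sqrt3\,\lambda_1}{2\sqrt{-\lambda_2}}$ and $$-\omega<\min\Big\{-\frac{3\lambda_1^2}{16\lambda_2},\,-\frac16\frac{\lambda_1^2}{\lambda_2}+\frac{Z^2}{4}\Big\},$$ then $\phi\in D(\mathcal L_{1,Z})$, $\langle\mathcal L_{1,Z}\phi,\phi\rangle<0$ and $n(\mathcal L_{1,Z})=1$. -/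

import Mathlib

open MeasureTheory Set Topology
open scoped ENNReal InnerProductSpace LinearPMap

noncomputable section

namespace NLSCQ

/-- The complex Hilbert space `L²(ℝ)`. -/
abbrev L2 : Type := Lp ℂ 2 (volume : Measure ℝ)

/-! ### Weak derivatives and the Sobolev spaces `H¹(U)`, `H²(U)`

Functions on an open set `U ⊆ ℝ` of full measure (only `U = ℝ` and `U = ℝ \ {0}` are used) are
regarded as elements of `L²(ℝ)`. -/

/-- `v ∈ L²` is the weak derivative of `u ∈ L²` on the open set `U`:
`∫ u ψ' = - ∫ v ψ` for all test functions `ψ ∈ C_c^∞(U)`. -/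
def IsWeakDeriv (U : Set ℝ) (u v : L2) : Prop :=
  ∀ ψ : ℝ → ℝ, ContDiff ℝ ((⊤ : ℕ∞) : WithTop ℕ∞) ψ → HasCompactSupport ψ → tsupport ψ ⊆ U →
    ∫ x, deriv ψ x • u x = -∫ x, ψ x • v x

lemma integrable_smul_test {ψ : ℝ → ℝ} (h : Continuous ψ) (hc : HasCompactSupport ψ) (u : L2) :
    Integrable (fun x => ψ x • u x) :=
  ((Lp.memLp u).locallyIntegrable (by norm_num)).integrable_smul_left_of_hasCompactSupport h hc

lemma IsWeakDeriv.zero (U : Set ℝ) : IsWeakDeriv U 0 0 := by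
  intro ψ _ _ _
  have h1 : ∫ x, deriv ψ x • (0 : L2) x = 0 := by
    rw [integral_eq_zero_of_ae]
    filter_upwards [Lp.coeFn_zero ℂ 2 (volume : Measure ℝ)] with x _
    simp
  have h2 : ∫ x, ψ x • (0 : L2) x = 0 := by
    rw [integral_eq_zero_of_ae]
    filter_upwards [Lp.coeFn_zero ℂ 2 (volume : Measure ℝ)] with x _
    simp
  rw [h1, h2, neg_zero]

lemma integral_smul_add {ψ : ℝ → ℝ} (h : Continuous ψ) (hc : HasCompactSupport ψ) (u v : L2) :
    ∫ x, ψ x • (u + v : L2) x = (∫ x, ψ x • u x) + ∫ x, ψ x • v x := by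
  rw [← integral_add (integrable_smul_test h hc u) (integrable_smul_test h hc v)]
  refine integral_congr_ae ?_
  filter_upwards [Lp.coeFn_add u v] with x hx
  rw [hx, Pi.add_apply, smul_add]

lemma integral_smul_smul (ψ : ℝ → ℝ) (c : ℂ) (u : L2) :
    ∫ x, ψ x • (c • u : L2) x = c • ∫ x, ψ x • u x := by
  rw [← integral_smul]
  refine integral_congr_ae ?_
  filter_upwards [Lp.coeFn_smul c u] with x hx
  rw [hx, Pi.smul_apply, smul_comm]

lemma IsWeakDeriv.add {U : Set ℝ} {u v u' v' : L2} (h : IsWeakDeriv U u v)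
    (h' : IsWeakDeriv U u' v') : IsWeakDeriv U (u + u') (v + v') := by
  intro ψ hψ hc hs
  have hd : Continuous (deriv ψ) := hψ.continuous_deriv (by simp)
  rw [integral_smul_add hd hc.deriv, integral_smul_add hψ.continuous hc, h ψ hψ hc hs,
    h' ψ hψ hc hs]
  ring

lemma IsWeakDeriv.smul {U : Set ℝ} {u v : L2} (c : ℂ) (h : IsWeakDeriv U u v) :
    IsWeakDeriv U (c • u) (c • v) := by
  intro ψ hψ hc hs
  rw [integral_smul_smul, integral_smul_smul, h ψ hψ hc hs, smul_neg]

/-- A weak derivative on an open set of full measure is unique. -/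
lemma IsWeakDeriv.eq_zero {U : Set ℝ} (hU : IsOpen U) (hU0 : volume Uᶜ = 0) {v : L2}
    (h : IsWeakDeriv U 0 v) : v = 0 := by
  have hloc : LocallyIntegrableOn (fun x => v x) U :=
    ((Lp.memLp v).locallyIntegrable (by norm_num)).locallyIntegrableOn U
  have key := hU.ae_eq_zero_of_integral_contDiff_smul_eq_zero hloc (by
    intro ψ hψ hc hs
    have h0 : ∫ x, deriv ψ x • (0 : L2) x = 0 := by
      rw [integral_eq_zero_of_ae]
      filter_upwards [Lp.coeFn_zero ℂ 2 (volume : Measure ℝ)] with x _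
      simp
    have := h ψ hψ hc hs
    rw [h0] at this
    exact neg_eq_zero.mp this.symm)
  have hae : ∀ᵐ x, x ∈ U := by
    rw [ae_iff]
    exact hU0
  rw [Lp.eq_zero_iff_ae_eq_zero]
  filter_upwards [key, hae] with x hx hxU
  exact hx hxU

/-- The Sobolev space `H¹(U)`. -/
def sobolevH1 (U : Set ℝ) : Submodule ℂ L2 where
  carrier := {u | ∃ v, IsWeakDeriv U u v}
  zero_mem' := ⟨0, IsWeakDeriv.zero U⟩
  add_mem' := by
    rintro u u' ⟨v, h⟩ ⟨v', h'⟩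
    exact ⟨v + v', h.add h'⟩
  smul_mem' := by
    rintro c u ⟨v, h⟩
    exact ⟨c • v, h.smul c⟩

/-- The pairs `(u, u'')` with `u ∈ H²(U)`. -/
def secondDerivGraph (U : Set ℝ) : Submodule ℂ (L2 × L2) where
  carrier := {p | ∃ v, IsWeakDeriv U p.1 v ∧ IsWeakDeriv U v p.2}
  zero_mem' := ⟨0, IsWeakDeriv.zero U, IsWeakDeriv.zero U⟩
  add_mem' := by
    rintro p q ⟨v, h1, h2⟩ ⟨w, k1, k2⟩
    exact ⟨v + w, h1.add k1, h2.add k2⟩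
  smul_mem' := by
    rintro c p ⟨v, h1, h2⟩
    exact ⟨c • v, h1.smul c, h2.smul c⟩

/-- The operator `u ↦ u''` on `L²(ℝ)` with domain the Sobolev space `H²(U)`. -/
def secondDeriv (U : Set ℝ) : L2 →ₗ.[ℂ] L2 := (secondDerivGraph U).toLinearPMap

/-- On `U` open of full measure, `secondDeriv U` is really the second weak derivative. -/
lemma secondDeriv_graph {U : Set ℝ} (hU : IsOpen U) (hU0 : volume Uᶜ = 0) :
    (secondDeriv U).graph = secondDerivGraph U := by
  refine Submodule.toLinearPMap_graph_eq _ ?_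
  rintro ⟨u, w⟩ ⟨v, h1, h2⟩ (h0 : u = 0)
  subst h0
  have hv : v = 0 := h1.eq_zero hU hU0
  subst hv
  exact h2.eq_zero hU hU0

lemma mem_secondDeriv_domain {U : Set ℝ} {u : L2} :
    u ∈ (secondDeriv U).domain ↔ ∃ v w, IsWeakDeriv U u v ∧ IsWeakDeriv U v w := by
  constructor
  · rintro ⟨⟨u', w⟩, ⟨v, h1, h2⟩, rfl⟩
    exact ⟨v, w, h1, h2⟩
  · rintro ⟨v, w, h1, h2⟩
    exact ⟨(u, w), ⟨v, h1, h2⟩, rfl⟩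

/-! ### Boundary values at the origin -/

/-- `u(0) = a` for the continuous representative of `u`. -/
def HasValueAtZero (u : L2) (a : ℂ) : Prop :=
  ∃ g : ℝ → ℂ, Continuous g ∧ (u : ℝ → ℂ) =ᵐ[volume] g ∧ g 0 = a

/-- `v(0+) = b` for the representative of `v` that is continuous on `[0, ∞)`. -/
def HasRightValueAtZero (v : L2) (b : ℂ) : Prop :=
  ∃ g : ℝ → ℂ, ContinuousOn g (Ici 0) ∧ (v : ℝ → ℂ) =ᵐ[volume.restrict (Ioi 0)] g ∧ g 0 = b

/-- `v(0-) = b` for the representative of `v` that is continuous on `(-∞, 0]`. -/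
def HasLeftValueAtZero (v : L2) (b : ℂ) : Prop :=
  ∃ g : ℝ → ℂ, ContinuousOn g (Iic 0) ∧ (v : ℝ → ℂ) =ᵐ[volume.restrict (Iio 0)] g ∧ g 0 = b

lemma HasValueAtZero.zero : HasValueAtZero 0 0 :=
  ⟨0, continuous_zero, Lp.coeFn_zero ℂ 2 (volume : Measure ℝ), rfl⟩

lemma HasValueAtZero.add {u u' : L2} {a a' : ℂ} :
    HasValueAtZero u a → HasValueAtZero u' a' → HasValueAtZero (u + u') (a + a') := by
  rintro ⟨g, h1, h2, h3⟩ ⟨g', k1, k2, k3⟩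
  exact ⟨g + g', h1.add k1, (Lp.coeFn_add u u').trans (h2.add k2), by simp [h3, k3]⟩

lemma HasValueAtZero.smul {u : L2} {a : ℂ} (c : ℂ) :
    HasValueAtZero u a → HasValueAtZero (c • u) (c * a) := by
  rintro ⟨g, h1, h2, h3⟩
  exact ⟨c • g, h1.const_smul c, (Lp.coeFn_smul c u).trans (h2.const_smul c), by simp [h3]⟩

lemma HasRightValueAtZero.zero : HasRightValueAtZero 0 0 :=
  ⟨0, continuousOn_const, ae_restrict_of_ae (Lp.coeFn_zero ℂ 2 (volume : Measure ℝ)), rfl⟩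

lemma HasRightValueAtZero.add {u u' : L2} {a a' : ℂ} :
    HasRightValueAtZero u a → HasRightValueAtZero u' a' →
      HasRightValueAtZero (u + u') (a + a') := by
  rintro ⟨g, h1, h2, h3⟩ ⟨g', k1, k2, k3⟩
  exact ⟨g + g', h1.add k1,
    Filter.EventuallyEq.trans (ae_restrict_of_ae (Lp.coeFn_add u u')) (h2.add k2),
    by simp [h3, k3]⟩

lemma HasRightValueAtZero.smul {u : L2} {a : ℂ} (c : ℂ) :
    HasRightValueAtZero u a → HasRightValueAtZero (c • u) (c * a) := by
  rintro ⟨g, h1, h2, h3⟩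
  exact ⟨c • g, h1.const_smul c,
    Filter.EventuallyEq.trans (ae_restrict_of_ae (Lp.coeFn_smul c u)) (h2.const_smul c),
    by simp [h3]⟩

lemma HasLeftValueAtZero.zero : HasLeftValueAtZero 0 0 :=
  ⟨0, continuousOn_const, ae_restrict_of_ae (Lp.coeFn_zero ℂ 2 (volume : Measure ℝ)), rfl⟩

lemma HasLeftValueAtZero.add {u u' : L2} {a a' : ℂ} :
    HasLeftValueAtZero u a → HasLeftValueAtZero u' a' →
      HasLeftValueAtZero (u + u') (a + a') := by
  rintro ⟨g, h1, h2, h3⟩ ⟨g', k1, k2, k3⟩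
  exact ⟨g + g', h1.add k1,
    Filter.EventuallyEq.trans (ae_restrict_of_ae (Lp.coeFn_add u u')) (h2.add k2),
    by simp [h3, k3]⟩

lemma HasLeftValueAtZero.smul {u : L2} {a : ℂ} (c : ℂ) :
    HasLeftValueAtZero u a → HasLeftValueAtZero (c • u) (c * a) := by
  rintro ⟨g, h1, h2, h3⟩
  exact ⟨c • g, h1.const_smul c,
    Filter.EventuallyEq.trans (ae_restrict_of_ae (Lp.coeFn_smul c u)) (h2.const_smul c),
    by simp [h3]⟩

/-- `{u : u(0) = 0}`. -/
def vanishAtZero : Submodule ℂ L2 where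
  carrier := {u | HasValueAtZero u 0}
  zero_mem' := HasValueAtZero.zero
  add_mem' := by
    intro u u' h h'
    simpa using HasValueAtZero.add h h'
  smul_mem' := by
    intro c u h
    simpa using HasValueAtZero.smul c h

/-- `{u : u'(0+) - u'(0-) = -Z u(0)}`, with `u'` the weak derivative of `u` on `ℝ \ {0}`. -/
def jumpCondition (Z : ℝ) : Submodule ℂ L2 where
  carrier := {u | ∃ (v : L2) (a bp bm : ℂ), IsWeakDeriv {0}ᶜ u v ∧ HasValueAtZero u a ∧
    HasRightValueAtZero v bp ∧ HasLeftValueAtZero v bm ∧ bp - bm = -(Z : ℂ) * a}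
  zero_mem' := ⟨0, 0, 0, 0, IsWeakDeriv.zero _, HasValueAtZero.zero, HasRightValueAtZero.zero,
    HasLeftValueAtZero.zero, by simp⟩
  add_mem' := by
    rintro u u' ⟨v, a, bp, bm, h1, h2, h3, h4, h5⟩ ⟨v', a', bp', bm', k1, k2, k3, k4, k5⟩
    exact ⟨v + v', a + a', bp + bp', bm + bm', h1.add k1, h2.add k2, h3.add k3, h4.add k4,
      by linear_combination h5 + k5⟩
  smul_mem' := by
    rintro c u ⟨v, a, bp, bm, h1, h2, h3, h4, h5⟩
    exact ⟨c • v, c * a, c * bp, c * bm, h1.smul c, h2.smul c, h3.smul c, h4.smul c,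
      by linear_combination c * h5⟩

/-! ### Schrödinger operators -/

/-- Multiplication by `V` on `L²(ℝ)`, with its maximal domain. -/
def mulOp (V : ℝ → ℝ) : L2 →ₗ.[ℂ] L2 where
  domain :=
    { carrier := {u | MemLp (fun x => V x • u x) 2 volume}
      zero_mem' := by
        refine (MemLp.zero' (ε := ℂ)).ae_eq ?_
        filter_upwards [Lp.coeFn_zero ℂ 2 (volume : Measure ℝ)] with x _
        simp
      add_mem' := by
        intro u u' h h'
        refine (h.add h').ae_eq ?_
        filter_upwards [Lp.coeFn_add u u'] with x hx
        rw [hx, Pi.add_apply, Pi.add_apply, smul_add]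
      smul_mem' := by
        intro c u h
        refine (h.const_smul c).ae_eq ?_
        filter_upwards [Lp.coeFn_smul c u] with x hx
        rw [hx, Pi.smul_apply, Pi.smul_apply, smul_comm] }
  toFun :=
    { toFun := fun u => MemLp.toLp (fun x => V x • (u : L2) x) u.2
      map_add' := by
        intro u u'
        ext1
        filter_upwards [MemLp.coeFn_toLp (u + u').2, MemLp.coeFn_toLp u.2, MemLp.coeFn_toLp u'.2,
          Lp.coeFn_add (u : L2) u', Lp.coeFn_add (MemLp.toLp _ u.2) (MemLp.toLp _ u'.2)]
          with x h1 h2 h3 h4 h5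
        rw [h1, h5, Pi.add_apply, h2, h3, Submodule.coe_add, h4, Pi.add_apply, smul_add]
      map_smul' := by
        intro c u
        ext1
        filter_upwards [MemLp.coeFn_toLp (c • u).2, MemLp.coeFn_toLp u.2,
          Lp.coeFn_smul c (u : L2), Lp.coeFn_smul c (MemLp.toLp _ u.2)] with x h1 h2 h3 h4
        rw [h1, RingHom.id_apply, h4, Pi.smul_apply, h2, Submodule.coe_smul, h3, Pi.smul_apply,
          smul_comm] }

/-- `D_Z = {g ∈ H¹(ℝ) ∩ H²(ℝ \ {0}) : g'(0+) - g'(0-) = -Z g(0)}`. -/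
def deltaDomain (Z : ℝ) : Submodule ℂ L2 :=
  sobolevH1 univ ⊓ jumpCondition Z ⊓ (secondDeriv {0}ᶜ).domain

/-- The operator `-d²/dx² + V` on the domain `D_Z` (for `V` bounded and measurable). -/
def deltaOp (Z : ℝ) (V : ℝ → ℝ) : L2 →ₗ.[ℂ] L2 :=
  (-secondDeriv {0}ᶜ).domRestrict (sobolevH1 univ ⊓ jumpCondition Z) + mulOp V

/-- The operator `-d²/dx² + V` on `{f ∈ H²(ℝ) : f(0) = 0}` (for `V` bounded and measurable). -/
def minOp (V : ℝ → ℝ) : L2 →ₗ.[ℂ] L2 :=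
  (-secondDeriv univ).domRestrict vanishAtZero + mulOp V

lemma mulOp_domain {V : ℝ → ℝ} (hV : Measurable V) {C : ℝ} (hC : ∀ x, |V x| ≤ C) :
    (mulOp V).domain = ⊤ := by
  refine eq_top_iff.mpr fun u _ => ?_
  refine (Lp.memLp u).of_le_mul (c := C) (hV.aestronglyMeasurable.smul (Lp.aestronglyMeasurable u))
    (Filter.Eventually.of_forall fun x => ?_)
  rw [norm_smul]
  exact mul_le_mul_of_nonneg_right (hC x) (norm_nonneg _)

lemma deltaOp_domain (Z : ℝ) {V : ℝ → ℝ} (hV : Measurable V) {C : ℝ} (hC : ∀ x, |V x| ≤ C) :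
    (deltaOp Z V).domain = deltaDomain Z := by
  change (_ ⊓ (secondDeriv {0}ᶜ).domain) ⊓ (mulOp V).domain = _
  rw [mulOp_domain hV hC, inf_top_eq]
  rfl

lemma minOp_domain {V : ℝ → ℝ} (hV : Measurable V) {C : ℝ} (hC : ∀ x, |V x| ≤ C) :
    (minOp V).domain = vanishAtZero ⊓ (secondDeriv univ).domain := by
  change (_ ⊓ (secondDeriv univ).domain) ⊓ (mulOp V).domain = _
  rw [mulOp_domain hV hC, inf_top_eq]

/-! ### Deficiency indices and the Morse index -/

/-- `ker (T - μ)` for a partially defined operator `T`. -/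
def eigenspace (T : L2 →ₗ.[ℂ] L2) (μ : ℂ) : Submodule ℂ L2 where
  carrier := {u | ∃ h : u ∈ T.domain, T ⟨u, h⟩ = μ • u}
  zero_mem' := ⟨T.domain.zero_mem, by
    rw [smul_zero]
    exact T.map_zero⟩
  add_mem' := by
    rintro u u' ⟨h, e⟩ ⟨h', e'⟩
    refine ⟨T.domain.add_mem h h', ?_⟩
    rw [smul_add, ← e, ← e', ← T.map_add]
    rfl
  smul_mem' := by
    rintro c u ⟨h, e⟩
    refine ⟨T.domain.smul_mem c h, ?_⟩
    rw [smul_comm, ← e, ← T.map_smul]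
    rfl

/-- The deficiency index `n₊(T) = dim ker (T* - i)` of a densely defined operator. -/
def deficiencyPlus (T : L2 →ₗ.[ℂ] L2) : Cardinal :=
  Module.rank ℂ (eigenspace T† Complex.I)

/-- The deficiency index `n₋(T) = dim ker (T* + i)` of a densely defined operator. -/
def deficiencyMinus (T : L2 →ₗ.[ℂ] L2) : Cardinal :=
  Module.rank ℂ (eigenspace T† (-Complex.I))

/-- The Morse index `n(T)`: the number of negative eigenvalues, counted with multiplicity. -/
def morseIndex (T : L2 →ₗ.[ℂ] L2) : Cardinal :=
  Cardinal.sum fun μ : Iio (0 : ℝ) => Module.rank ℂ (eigenspace T ((μ : ℝ) : ℂ))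

/-! ### The peak profile and the linearized operators -/

/-- `R(s) = √(α² - βω) sinh(2√(-ω) s) / (α + √(α² - βω) cosh(2√(-ω) s))`
with `α = λ₁/4`, `β = λ₂/3`. -/
def shiftFun (l1 l2 ω s : ℝ) : ℝ :=
  √((l1 / 4) ^ 2 - l2 / 3 * ω) * Real.sinh (2 * √(-ω) * s) /
    (l1 / 4 + √((l1 / 4) ^ 2 - l2 / 3 * ω) * Real.cosh (2 * √(-ω) * s))

/-- The profile
`φ(x) = [α/(-ω) + √(α² - βω)/(-ω) cosh(2√(-ω)(|x| + R⁻¹(Z/(2√(-ω)))))]^(-1/2)`. -/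
def profile (l1 l2 ω Z x : ℝ) : ℝ :=
  ((l1 / 4) / (-ω) + √((l1 / 4) ^ 2 - l2 / 3 * ω) / (-ω) *
    Real.cosh (2 * √(-ω) *
      (|x| + Function.invFun (shiftFun l1 l2 ω) (Z / (2 * √(-ω)))))) ^ (-(1 / 2) : ℝ)

/-- The potential `-ω - 3λ₁φ² - 5λ₂φ⁴`. -/
def potential (l1 l2 ω Z x : ℝ) : ℝ :=
  -ω - 3 * l1 * profile l1 l2 ω Z x ^ 2 - 5 * l2 * profile l1 l2 ω Z x ^ 4

/-- `𝓛_{1,Z} = -d²/dx² - ω - 3λ₁φ² - 5λ₂φ⁴` on `D_Z`. -/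
def linearizedOp (l1 l2 ω Z : ℝ) : L2 →ₗ.[ℂ] L2 := deltaOp Z (potential l1 l2 ω Z)

/-- `𝓛_min = -d²/dx² - ω - 3λ₁φ² - 5λ₂φ⁴` on `{f ∈ H²(ℝ) : f(0) = 0}`. -/
def minimalOp (l1 l2 ω Z : ℝ) : L2 →ₗ.[ℂ] L2 := minOp (potential l1 l2 ω Z)

/-- The potential is measurable and bounded, so that `linearizedOp` and `minimalOp` have the
domains announced. -/
lemma potential_bounded {l1 l2 ω Z : ℝ} (hl1 : 0 < l1) (hω : ω < 0) :
    Measurable (potential l1 l2 ω Z) ∧ ∃ C, ∀ x, |potential l1 l2 ω Z x| ≤ C := by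
  constructor
  · unfold potential profile
    fun_prop
  · set M : ℝ := ((l1 / 4) / (-ω)) ^ (-(1 / 2) : ℝ) with hM
    have hA : 0 < (l1 / 4) / (-ω) := div_pos (by linarith) (by linarith)
    have hp : ∀ x, 0 ≤ profile l1 l2 ω Z x ∧ profile l1 l2 ω Z x ≤ M := by
      intro x
      have hB : 0 ≤ √((l1 / 4) ^ 2 - l2 / 3 * ω) / (-ω) *
          Real.cosh (2 * √(-ω) *
            (|x| + Function.invFun (shiftFun l1 l2 ω) (Z / (2 * √(-ω))))) :=
        mul_nonneg (div_nonneg (Real.sqrt_nonneg _) (by linarith)) (Real.cosh_pos _).le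
      refine ⟨Real.rpow_nonneg (by linarith) _, ?_⟩
      exact Real.rpow_le_rpow_of_nonpos hA (by linarith) (by norm_num)
    refine ⟨-ω + 3 * l1 * M ^ 2 + 5 * |l2| * M ^ 4, fun x => ?_⟩
    obtain ⟨h0, h1⟩ := hp x
    have h2 : profile l1 l2 ω Z x ^ 2 ≤ M ^ 2 := pow_le_pow_left₀ h0 h1 2
    have h4 : profile l1 l2 ω Z x ^ 4 ≤ M ^ 4 := pow_le_pow_left₀ h0 h1 4
    have e2 : 3 * l1 * profile l1 l2 ω Z x ^ 2 ≤ 3 * l1 * M ^ 2 := by gcongr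
    have e2' : 0 ≤ 3 * l1 * profile l1 l2 ω Z x ^ 2 := by positivity
    have e4 : |5 * l2 * profile l1 l2 ω Z x ^ 4| ≤ 5 * |l2| * M ^ 4 := by
      rw [abs_mul, abs_mul, abs_of_nonneg (by positivity : 0 ≤ profile l1 l2 ω Z x ^ 4)]
      norm_num
      gcongr
    rw [abs_le] at e4
    unfold potential
    rw [abs_le]
    have hM2 : 0 ≤ 3 * l1 * M ^ 2 := by positivity
    constructor <;> linarith [e4.1, e4.2]

lemma linearizedOp_domain {l1 l2 ω Z : ℝ} (hl1 : 0 < l1) (hω : ω < 0) :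
    (linearizedOp l1 l2 ω Z).domain = deltaDomain Z := by
  obtain ⟨hm, C, hC⟩ := potential_bounded (l2 := l2) (Z := Z) hl1 hω
  exact deltaOp_domain Z hm hC

lemma minimalOp_domain {l1 l2 ω Z : ℝ} (hl1 : 0 < l1) (hω : ω < 0) :
    (minimalOp l1 l2 ω Z).domain = vanishAtZero ⊓ (secondDeriv univ).domain := by
  obtain ⟨hm, C, hC⟩ := potential_bounded (l2 := l2) (Z := Z) hl1 hω
  exact minOp_domain hm hC

end NLSCQ

end

namespace NLSCQ

variable {H : Type*} [NormedAddCommGroup H] [InnerProductSpace ℂ H] [CompleteSpace H]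
  {T T₀ : H →ₗ.[ℂ] H}

theorem inner_self_eq_ofReal {H : Type*} [NormedAddCommGroup H] [InnerProductSpace ℂ H] (x : H) :
    ⟪x, x⟫_ℂ = ((‖x‖ ^ 2 : ℝ) : ℂ) := by
  rw [inner_self_eq_norm_sq_to_K]
  push_cast
  rfl

/-- A densely defined symmetric operator that becomes surjective after adding an everywhere
defined symmetric map is self-adjoint. -/
theorem isSelfAdjoint_of_add_surjective (hd : Dense (T.domain : Set H))
    (hs : T.IsFormalAdjoint T) (A : H → H) (hA : ∀ x y, ⟪A x, y⟫_ℂ = ⟪x, A y⟫_ℂ)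
    (hsurj : ∀ h, ∃ f : T.domain, T f + A f = h) : IsSelfAdjoint T := by
  rw [LinearPMap.isSelfAdjoint_def]
  have hle : T ≤ T† := hs.le_adjoint hd
  refine (LinearPMap.eq_of_le_of_domain_eq hle (le_antisymm hle.1 fun u hu => ?_)).symm
  obtain ⟨v, hv⟩ := hsurj (T† ⟨u, hu⟩ + A u)
  have key : ∀ f : T.domain, ⟪u - v, T f + A f⟫_ℂ = 0 := by
    intro f
    have h1 : ⟪T† ⟨u, hu⟩, (f : H)⟫_ℂ = ⟪u, T f⟫_ℂ := LinearPMap.adjoint_isFormalAdjoint hd ⟨u, hu⟩ f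
    have h2 : ⟪T v + A v, (f : H)⟫_ℂ = ⟪(v : H), T f + A f⟫_ℂ := by
      rw [inner_add_left, inner_add_right, hs v f, hA]
    rw [inner_sub_left, ← h2, hv, inner_add_left, h1, inner_add_right, hA, sub_self]
  obtain ⟨f, hf⟩ := hsurj (u - v)
  have h0 := key f
  rw [hf, inner_self_eq_zero, sub_eq_zero] at h0
  rw [h0]
  exact v.2

/-- A self-adjoint operator shifted by `z` has a bounded inverse as soon as both shifts by `z` and
`conj z` are bounded below. -/
theorem exists_resolvent (hT : IsSelfAdjoint T) (z : ℂ) {c : ℝ} (hc : 0 < c)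
    (h1 : ∀ f : T.domain, c * ‖(f : H)‖ ≤ ‖T f - z • (f : H)‖)
    (h2 : ∀ f : T.domain, c * ‖(f : H)‖ ≤ ‖T f - (starRingEnd ℂ z) • (f : H)‖) :
    ∃ S : H →L[ℂ] H, (∀ h, ∃ hd : S h ∈ T.domain, T ⟨S h, hd⟩ - z • S h = h) ∧
      ∀ f : T.domain, S (T f - z • (f : H)) = f := by
  have hdense : Dense (T.domain : Set H) := hT.dense_domain
  let A : T.domain →ₗ[ℂ] H := T.toFun - z • T.domain.subtype
  have hA : ∀ f, A f = T f - z • (f : H) := fun f => rfl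
  have hinj : Function.Injective A := by
    rw [← LinearMap.ker_eq_bot, LinearMap.ker_eq_bot']
    intro f hf
    have := h1 f
    rw [← hA, hf, norm_zero] at this
    have h0 : ‖(f : H)‖ = 0 := le_antisymm (by nlinarith [norm_nonneg (f : H)]) (norm_nonneg _)
    exact Subtype.ext (norm_eq_zero.1 h0)
  have hclosed : IsClosed (LinearMap.range A : Set H) := by
    refine isClosed_of_closure_subset fun y hy => ?_
    obtain ⟨s, hs, hlim⟩ := mem_closure_iff_seq_limit.1 hy
    choose f hf using hs
    have hcs : CauchySeq fun n => (f n : H) := by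
      rw [Metric.cauchySeq_iff']
      intro ε hε
      obtain ⟨N, hN⟩ := Metric.cauchySeq_iff'.1 hlim.cauchySeq (c * ε) (by positivity)
      refine ⟨N, fun n hn => ?_⟩
      have h3 := hN n hn
      rw [dist_eq_norm, ← hf n, ← hf N, ← map_sub] at h3
      have h4 := h1 (f n - f N)
      rw [← hA] at h4
      rw [dist_eq_norm]
      exact lt_of_mul_lt_mul_left (h4.trans_lt h3) hc.le
    obtain ⟨g, hg⟩ := cauchySeq_tendsto_of_complete hcs
    have hTf : Filter.Tendsto (fun n => T (f n)) Filter.atTop (𝓝 (y + z • g)) := by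
      refine (hlim.add (hg.const_smul z)).congr fun n => ?_
      rw [← hf n, hA]
      abel
    have hmem : (g, y + z • g) ∈ T.graph :=
      hT.isClosed.mem_of_tendsto (hg.prodMk_nhds hTf)
        (Filter.Eventually.of_forall fun n => T.mem_graph (f n))
    obtain ⟨g', hg1, hg2⟩ := T.mem_graph_iff.1 hmem
    refine ⟨g', ?_⟩
    rw [hA, hg2, hg1]
    simp
  have hdr : (LinearMap.range A)ᗮ = ⊥ := by
    rw [Submodule.eq_bot_iff]
    intro v hv
    rw [Submodule.mem_orthogonal'] at hv
    have hv' : ∀ f : T.domain, ⟪(starRingEnd ℂ z) • v, (f : H)⟫_ℂ = ⟪v, T f⟫_ℂ := by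
      intro f
      have := hv (A f) ⟨f, rfl⟩
      rw [hA, inner_sub_right, inner_smul_right, sub_eq_zero] at this
      rw [inner_smul_left, Complex.conj_conj, this]
    have hvd : v ∈ T†.domain := LinearPMap.mem_adjoint_domain_of_exists v ⟨_, hv'⟩
    have hval : T† ⟨v, hvd⟩ = (starRingEnd ℂ z) • v := LinearPMap.adjoint_apply_eq hdense ⟨v, hvd⟩ hv'
    have hle : T† ≤ T := le_of_eq hT
    have hval' : T ⟨v, hle.1 hvd⟩ = (starRingEnd ℂ z) • v := by
      rw [← hval]
      exact (hle.2 rfl).symm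
    have := h2 ⟨v, hle.1 hvd⟩
    rw [hval', sub_self, norm_zero] at this
    exact norm_eq_zero.1 (le_antisymm (by nlinarith [norm_nonneg v]) (norm_nonneg _))
  have hsurj : Function.Surjective A := by
    rw [← LinearMap.range_eq_top]
    have : CompleteSpace (LinearMap.range A) := hclosed.completeSpace_coe
    exact Submodule.orthogonal_eq_bot_iff.1 hdr
  let e := LinearEquiv.ofBijective A ⟨hinj, hsurj⟩
  have he : ∀ f, e f = T f - z • (f : H) := fun f => rfl
  let S : H →L[ℂ] H := LinearMap.mkContinuous (T.domain.subtype ∘ₗ e.symm.toLinearMap) c⁻¹ (by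
    intro h
    have h3 := h1 (e.symm h)
    rw [← he, e.apply_symm_apply] at h3
    change ‖(e.symm h : H)‖ ≤ _
    rw [inv_mul_eq_div, le_div_iff₀ hc]
    linarith)
  have hS : ∀ h, S h = (e.symm h : H) := fun h => rfl
  refine ⟨S, fun h => ⟨(e.symm h).2, ?_⟩, fun f => ?_⟩
  · have := e.apply_symm_apply h
    rw [he] at this
    exact this
  · rw [hS, ← he, e.symm_apply_apply]

theorem im_mul_norm_le {H : Type*} [NormedAddCommGroup H] [InnerProductSpace ℂ H]
    {T : H →ₗ.[ℂ] H} (hs : T.IsFormalAdjoint T) (z : ℂ) (f : T.domain) :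
    |z.im| * ‖(f : H)‖ ≤ ‖T f - z • (f : H)‖ := by
  have him : (⟪(f : H), T f⟫_ℂ).im = 0 := by
    have h := hs f f
    rw [← inner_conj_symm, Complex.conj_eq_iff_im] at h
    exact h
  have h1 : (⟪(f : H), T f - z • (f : H)⟫_ℂ).im = -(z.im * ‖(f : H)‖ ^ 2) := by
    rw [inner_sub_right, inner_smul_right, inner_self_eq_ofReal, Complex.sub_im, him,
      Complex.mul_im, Complex.ofReal_im,
      Complex.ofReal_re]
    ring
  have h2 := (Complex.abs_im_le_norm _).trans (norm_inner_le_norm (𝕜 := ℂ) (f : H) (T f - z • (f : H)))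
  rw [h1, abs_neg, abs_mul, abs_of_nonneg (sq_nonneg ‖(f : H)‖)] at h2
  rcases (norm_nonneg (f : H)).eq_or_lt with h0 | h0
  · rw [← h0, mul_zero]
    exact norm_nonneg _
  · refine le_of_mul_le_mul_left ?_ h0
    linarith

/-- Restricting a self-adjoint operator to the kernel of a nonzero functional that is bounded in
the graph norm gives an operator with one-dimensional deficiency spaces. -/
theorem exists_span_adjoint_eigenspace (hT : IsSelfAdjoint T) (hd : Dense (T₀.domain : Set H))
    (hle : T₀ ≤ T) (l : T.domain →ₗ[ℂ] ℂ) (hl : ∀ f : T.domain, (f : H) ∈ T₀.domain ↔ l f = 0)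
    {C : ℝ} (hC : ∀ f : T.domain, ‖l f‖ ^ 2 ≤ (⟪T f, (f : H)⟫_ℂ).re + C * ‖(f : H)‖ ^ 2)
    (hl0 : l ≠ 0) {z : ℂ} (hz : z.im ≠ 0) :
    ∃ r : H, r ≠ 0 ∧ ∀ u, (∃ h : u ∈ T₀†.domain, T₀† ⟨u, h⟩ = z • u) ↔
      u ∈ Submodule.span ℂ {r} := by
  have hs : T.IsFormalAdjoint T := by
    have := LinearPMap.adjoint_isFormalAdjoint (T := T) hT.dense_domain
    rwa [LinearPMap.isSelfAdjoint_def.1 hT] at this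
  obtain ⟨S, hS1, hS2⟩ := exists_resolvent hT (starRingEnd ℂ z) (c := |z.im|) (abs_pos.2 hz)
    (fun f => by simpa using im_mul_norm_le hs (starRingEnd ℂ z) f)
    (fun f => by simpa using im_mul_norm_le hs z f)
  choose hSd hSe using hS1
  let Sd : H →ₗ[ℂ] T.domain := S.toLinearMap.codRestrict T.domain hSd
  have hm : ∀ h, ‖l (Sd h)‖ ≤ √((1 + ‖z‖ * ‖S‖) * ‖S‖ + |C| * ‖S‖ ^ 2) * ‖h‖ := by
    intro h
    refine abs_le_of_sq_le_sq' ?_ (by positivity) |>.2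
    rw [mul_pow, Real.sq_sqrt (by positivity)]
    refine (hC (Sd h)).trans ?_
    have e1 : T (Sd h) = h + (starRingEnd ℂ z) • S h := by
      rw [← sub_eq_iff_eq_add]
      exact hSe h
    have e2 : ‖S h‖ ≤ ‖S‖ * ‖h‖ := S.le_opNorm h
    have e3 : (⟪T (Sd h), S h⟫_ℂ).re ≤ ((1 + ‖z‖ * ‖S‖) * ‖h‖) * (‖S‖ * ‖h‖) := by
      refine (Complex.re_le_norm _).trans ((norm_inner_le_norm _ _).trans ?_)
      have : ‖T (Sd h)‖ ≤ (1 + ‖z‖ * ‖S‖) * ‖h‖ := by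
        rw [e1]
        refine (norm_add_le _ _).trans ?_
        rw [norm_smul, RCLike.norm_conj]
        nlinarith [norm_nonneg z]
      gcongr
    have e4 : C * ‖S h‖ ^ 2 ≤ |C| * (‖S‖ * ‖h‖) ^ 2 := by
      have : C ≤ |C| := le_abs_self C
      gcongr
    calc _ ≤ _ := add_le_add e3 e4
      _ = _ := by ring
  let m : H →L[ℂ] ℂ := LinearMap.mkContinuous (l ∘ₗ Sd) _ hm
  have hmdef : ∀ h, m h = l (Sd h) := fun h => rfl
  have hSdT : ∀ f : T.domain, Sd (T f - (starRingEnd ℂ z) • (f : H)) = f :=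
    fun f => Subtype.ext (hS2 f)
  let r := (InnerProductSpace.toDual ℂ H).symm m
  have hr : ∀ h, ⟪r, h⟫_ℂ = m h := fun h => InnerProductSpace.toDual_symm_apply
  refine ⟨r, ?_, fun u => ?_⟩
  · rintro h0
    apply hl0
    ext f
    have := hr (T f - (starRingEnd ℂ z) • (f : H))
    rw [h0, inner_zero_left, hmdef, hSdT] at this
    exact this.symm
  have hchar : (∃ h : u ∈ T₀†.domain, T₀† ⟨u, h⟩ = z • u) ↔ ∀ h, m h = 0 → ⟪u, h⟫_ℂ = 0 := by
    have haux : ∀ f : T₀.domain, ⟪z • u, (f : H)⟫_ℂ = ⟪u, T₀ f⟫_ℂ ↔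
        ⟪u, T ⟨f, hle.1 f.2⟩ - (starRingEnd ℂ z) • (f : H)⟫_ℂ = 0 := by
      intro f
      rw [inner_smul_left, inner_sub_right, inner_smul_right, sub_eq_zero, eq_comm,
        hle.2 (x := f) (y := ⟨f, hle.1 f.2⟩) rfl]
    constructor
    · rintro ⟨h, e⟩ k hk
      have hk' : (Sd k : H) ∈ T₀.domain := (hl _).2 hk
      have := LinearPMap.adjoint_isFormalAdjoint hd ⟨u, h⟩ ⟨Sd k, hk'⟩
      rw [e] at this
      rw [← hSe k]
      exact (haux ⟨Sd k, hk'⟩).1 this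
    · intro h
      have h' : ∀ f : T₀.domain, ⟪z • u, (f : H)⟫_ℂ = ⟪u, T₀ f⟫_ℂ := by
        intro f
        rw [haux]
        refine h _ ?_
        rw [hmdef]
        have := hSdT ⟨f, hle.1 f.2⟩
        rw [this]
        exact (hl ⟨f, hle.1 f.2⟩).1 f.2
      exact ⟨LinearPMap.mem_adjoint_domain_of_exists u ⟨_, h'⟩, LinearPMap.adjoint_apply_eq hd ⟨u, _⟩ h'⟩
  rw [hchar]
  have : (∀ h, m h = 0 → ⟪u, h⟫_ℂ = 0) ↔ u ∈ (Submodule.span ℂ {r})ᗮᗮ := by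
    rw [Submodule.mem_orthogonal']
    refine forall_congr' fun h => ?_
    rw [Submodule.mem_orthogonal_singleton_iff_inner_right, hr]
  rw [this, Submodule.orthogonal_orthogonal]

end NLSCQ

namespace NLSCQ

variable {H : Type*} [NormedAddCommGroup H] [InnerProductSpace ℂ H] [CompleteSpace H]
  {T : H →ₗ.[ℂ] H}

/-- If `S - b` is bounded below on the kernel of a bounded functional, then approximate
eigenvectors of norm at most one subconverge to an eigenvector. -/
theorem exists_eigenvector_of_approx (S : H →L[ℂ] H) (b : ℂ) (m : H →ₗ[ℂ] ℂ) {B K : ℝ}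
    (hm : ∀ h, ‖m h‖ ≤ B * ‖h‖) (hK : ∀ x, m x = 0 → ‖x‖ ≤ K * ‖S x - b • x‖)
    {x : ℕ → H} (hx1 : ∀ n, ‖x n‖ ≤ 1) {a : ℝ} (ha : 0 < a) (hx2 : ∀ᶠ n in Filter.atTop, a ≤ ‖x n‖)
    (hx3 : Filter.Tendsto (fun n => S (x n) - b • x n) Filter.atTop (𝓝 0)) :
    ∃ y ≠ 0, S y = b • y := by
  have hB : 0 ≤ |B| := abs_nonneg B
  obtain ⟨e, he⟩ : ∃ e : H, ∀ h, m (h - m h • e) = 0 := by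
    by_cases h0 : ∃ h, m h ≠ 0
    · obtain ⟨h, hh⟩ := h0
      refine ⟨(m h)⁻¹ • h, fun k => ?_⟩
      simp [hh]
    · push Not at h0
      exact ⟨0, fun h => h0 _⟩
  have hbd : ∀ n, m (x n) ∈ Metric.closedBall (0 : ℂ) |B| := by
    intro n
    rw [mem_closedBall_zero_iff]
    refine (hm _).trans ?_
    calc B * ‖x n‖ ≤ |B| * 1 := mul_le_mul (le_abs_self B) (hx1 n) (norm_nonneg _) hB
      _ = |B| := mul_one _
  obtain ⟨c, -, φ, hφ, hlim⟩ := (isCompact_closedBall (0 : ℂ) |B|).tendsto_subseq hbd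
  have hφt := hφ.tendsto_atTop
  let k : ℕ → H := fun n => x (φ n) - m (x (φ n)) • e
  let A : H →L[ℂ] H := S - b • ContinuousLinearMap.id ℂ H
  have hA : ∀ h, A h = S h - b • h := fun h => rfl
  have hAk : CauchySeq fun n => A (k n) := by
    have : Filter.Tendsto (fun n => A (k n)) Filter.atTop (𝓝 (0 - c • A e)) := by
      have h1 := (hx3.comp hφt).sub (hlim.smul_const (A e))
      refine h1.congr fun n => ?_
      have : A (k n) = A (x (φ n)) - m (x (φ n)) • A e := by simp only [k, map_sub, map_smul]
      rw [this, hA (x (φ n))]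
      rfl
    exact this.cauchySeq
  have hk : CauchySeq k := by
    rw [Metric.cauchySeq_iff']
    intro ε hε
    obtain ⟨N, hN⟩ := Metric.cauchySeq_iff'.1 hAk (ε / (|K| + 1)) (by positivity)
    refine ⟨N, fun n hn => ?_⟩
    have h1 := hN n hn
    rw [dist_eq_norm, ← map_sub, lt_div_iff₀ (by positivity)] at h1
    rw [dist_eq_norm]
    have h2 := hK (k n - k N) (by rw [map_sub, he, he, sub_self])
    rw [← hA] at h2
    have h3 : K * ‖A (k n - k N)‖ ≤ (|K| + 1) * ‖A (k n - k N)‖ := by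
      gcongr
      linarith [le_abs_self K]
    linarith
  obtain ⟨y, hy⟩ := cauchySeq_tendsto_of_complete hk
  have hxl : Filter.Tendsto (fun n => x (φ n)) Filter.atTop (𝓝 (y + c • e)) := by
    refine (hy.add (hlim.smul_const e)).congr fun n => ?_
    simp [k]
  refine ⟨y + c • e, ?_, ?_⟩
  · have : a ≤ ‖y + c • e‖ := ge_of_tendsto hxl.norm (hφt.eventually hx2)
    intro h0
    rw [h0, norm_zero] at this
    linarith
  · have h1 : Filter.Tendsto (fun n => A (x (φ n))) Filter.atTop (𝓝 (A (y + c • e))) :=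
      (A.continuous.tendsto _).comp hxl
    have h2 := tendsto_nhds_unique h1 (hx3.comp hφt)
    rwa [hA, sub_eq_zero] at h2

/-- A self-adjoint operator that is nonnegative on the kernel of a form-bounded functional and has
a negative direction has a negative eigenvalue. -/
theorem exists_negative_eigenvalue (hT : IsSelfAdjoint T) (l : T.domain →ₗ[ℂ] ℂ) {C : ℝ}
    (hC : ∀ f : T.domain, ‖l f‖ ^ 2 ≤ (⟪T f, (f : H)⟫_ℂ).re + C * ‖(f : H)‖ ^ 2)
    (hpos : ∀ f : T.domain, l f = 0 → 0 ≤ (⟪T f, (f : H)⟫_ℂ).re)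
    {φ : T.domain} (hφ : (⟪T φ, (φ : H)⟫_ℂ).re < 0) :
    ∃ μ : ℝ, μ < 0 ∧ ∃ f : T.domain, (f : H) ≠ 0 ∧ T f = (μ : ℂ) • (f : H) := by
  have hs : T.IsFormalAdjoint T := by
    have := LinearPMap.adjoint_isFormalAdjoint (T := T) hT.dense_domain
    rwa [LinearPMap.isSelfAdjoint_def.1 hT] at this
  have hre : ∀ (M : ℝ) (x y : H), (⟪x - (-(M : ℂ)) • y, y⟫_ℂ).re = (⟪x, y⟫_ℂ).re + M * ‖y‖ ^ 2 := by
    intro M x y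
    rw [neg_smul, sub_neg_eq_add, inner_add_left, inner_smul_left, inner_self_eq_ofReal,
      Complex.conj_ofReal, ← Complex.ofReal_mul,
      Complex.add_re, Complex.ofReal_re]
  set M : ℝ := |C| + 1 with hM
  have hM0 : 0 < M := by positivity
  have hlow : ∀ f : T.domain, 1 * ‖(f : H)‖ ≤ ‖T f - (-(M : ℂ)) • (f : H)‖ := by
    intro f
    have h1 := hre M (T f) f
    have h2 := (Complex.re_le_norm _).trans
      (norm_inner_le_norm (𝕜 := ℂ) (T f - (-(M : ℂ)) • (f : H)) (f : H))
    rw [h1] at h2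
    have h3 := hC f
    have h4 : C * ‖(f : H)‖ ^ 2 ≤ |C| * ‖(f : H)‖ ^ 2 := by
      gcongr
      exact le_abs_self C
    have h5 : ‖(f : H)‖ * ‖(f : H)‖ ≤ ‖T f - (-(M : ℂ)) • (f : H)‖ * ‖(f : H)‖ := by
      nlinarith [sq_nonneg ‖l f‖]
    rw [one_mul]
    rcases (norm_nonneg (f : H)).eq_or_lt with h0 | h0
    · rw [← h0]
      exact norm_nonneg _
    · exact le_of_mul_le_mul_right h5 h0
  obtain ⟨S, hS1, hS2⟩ := exists_resolvent hT (-(M : ℂ)) one_pos hlow (by simpa using hlow)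
  choose hSd hSe using hS1
  let Sd : H →ₗ[ℂ] T.domain := S.toLinearMap.codRestrict T.domain hSd
  have hSdv : ∀ h, (Sd h : H) = S h := fun h => rfl
  have hform : ∀ h, (⟪h, S h⟫_ℂ).re = (⟪T (Sd h), S h⟫_ℂ).re + M * ‖S h‖ ^ 2 := by
    intro h
    rw [← hre]
    congr 2
    exact (hSe h).symm
  have hsym : ∀ h k, ⟪S h, k⟫_ℂ = ⟪h, S k⟫_ℂ := by
    intro h k
    have h1 : T (Sd k) - (-(M : ℂ)) • S k = k := hSe k
    have h2 : T (Sd h) - (-(M : ℂ)) • S h = h := hSe h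
    calc ⟪S h, k⟫_ℂ = ⟪S h, T (Sd k) - (-(M : ℂ)) • S k⟫_ℂ := by rw [h1]
      _ = ⟪T (Sd h) - (-(M : ℂ)) • S h, S k⟫_ℂ := by
        rw [inner_sub_left, inner_sub_right, inner_smul_left, inner_smul_right]
        have := hs (Sd h) (Sd k)
        rw [hSdv, hSdv] at this
        rw [this]
        simp
      _ = ⟪h, S k⟫_ℂ := by rw [h2]
  have hSl : ∀ h, ‖l (Sd h)‖ ^ 2 + ‖S h‖ ^ 2 ≤ (⟪h, S h⟫_ℂ).re := by
    intro h
    have h1 := hC (Sd h)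
    have h2 := hform h
    rw [hSdv] at h1
    have h4 : C * ‖S h‖ ^ 2 ≤ |C| * ‖S h‖ ^ 2 := by
      gcongr
      exact le_abs_self C
    rw [h2, hM]
    nlinarith
  have hSp : ∀ h, 0 ≤ (⟪h, S h⟫_ℂ).re := fun h => le_trans (by positivity) (hSl h)
  set b := ‖S‖ with hb
  have hb0 : 0 ≤ b := norm_nonneg S
  have hcs : ∀ h, ‖S h‖ ^ 2 ≤ b * (⟪h, S h⟫_ℂ).re := by
    intro h
    rcases hb0.eq_or_lt with h0 | h0
    · have := S.le_opNorm h
      rw [← hb, ← h0, zero_mul] at this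
      have h0' : ‖S h‖ = 0 := le_antisymm this (norm_nonneg _)
      rw [h0', ← h0]
      simp
    · have h1 := hSp (h - ((b⁻¹ : ℝ) : ℂ) • S h)
      have h2 : (⟪h - ((b⁻¹ : ℝ) : ℂ) • S h, S (h - ((b⁻¹ : ℝ) : ℂ) • S h)⟫_ℂ).re =
          (⟪h, S h⟫_ℂ).re - 2 * b⁻¹ * ‖S h‖ ^ 2 + b⁻¹ ^ 2 * (⟪S h, S (S h)⟫_ℂ).re := by
        rw [map_sub, map_smul, inner_sub_left, inner_sub_right, inner_sub_right, inner_smul_left,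
          inner_smul_left, inner_smul_right, inner_smul_right, ← hsym h (S h),
          inner_self_eq_ofReal, Complex.conj_ofReal]
        simp only [Complex.sub_re, Complex.re_ofReal_mul, Complex.ofReal_re]
        ring
      rw [h2] at h1
      have h3 : (⟪S h, S (S h)⟫_ℂ).re ≤ b * ‖S h‖ ^ 2 := by
        refine (Complex.re_le_norm _).trans ((norm_inner_le_norm _ _).trans ?_)
        have := S.le_opNorm (S h)
        nlinarith [norm_nonneg (S h)]
      have h4 : b⁻¹ ^ 2 * (⟪S h, S (S h)⟫_ℂ).re ≤ b⁻¹ ^ 2 * (b * ‖S h‖ ^ 2) := by gcongr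
      have h5 : b⁻¹ ^ 2 * (b * ‖S h‖ ^ 2) = b⁻¹ * ‖S h‖ ^ 2 := by field_simp
      have h6 : b⁻¹ * ‖S h‖ ^ 2 ≤ (⟪h, S h⟫_ℂ).re := by linarith
      rw [inv_mul_eq_div, div_le_iff₀ h0] at h6
      linarith
  -- the top of the spectrum of the resolvent lies above `1 / M`
  have hbM : 1 < b * M := by
    have h1 : Sd (T φ - (-(M : ℂ)) • (φ : H)) = φ := Subtype.ext (hS2 φ)
    have h2 := hform (T φ - (-(M : ℂ)) • (φ : H))
    rw [← hSdv, h1] at h2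
    have h3 := hcs (T φ - (-(M : ℂ)) • (φ : H))
    rw [← hSdv, h1] at h3
    have h6 : 0 < ‖(φ : H)‖ ^ 2 := by
      have : (φ : H) ≠ 0 := by
        rintro h0
        rw [h0, inner_zero_right] at hφ
        simp at hφ
      positivity
    have h5 : 0 < b := by
      rcases hb0.eq_or_lt with h0 | h0
      · rw [← h0] at h3
        linarith
      · exact h0
    have h4 : ‖(φ : H)‖ ^ 2 < b * (M * ‖(φ : H)‖ ^ 2) := by
      refine h3.trans_lt (mul_lt_mul_of_pos_left ?_ h5)
      rw [h2]
      linarith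
    by_contra hcon
    push Not at hcon
    nlinarith
  have hbpos : 0 < b := by
    by_contra hcon
    nlinarith
  have hpos' : ∀ h, l (Sd h) = 0 → M * ‖S h‖ ^ 2 ≤ (⟪h, S h⟫_ℂ).re := by
    intro h hh
    have := hpos (Sd h) hh
    rw [hSdv] at this
    rw [hform]
    linarith
  have hlb : ∀ h, ‖l (Sd h)‖ ≤ √b * ‖h‖ := by
    intro h
    refine abs_le_of_sq_le_sq' ?_ (by positivity) |>.2
    rw [mul_pow, Real.sq_sqrt hb0]
    have h1 := hSl h
    have h2 : (⟪h, S h⟫_ℂ).re ≤ ‖h‖ * (b * ‖h‖) :=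
      (Complex.re_le_norm _).trans ((norm_inner_le_norm _ _).trans
        (mul_le_mul_of_nonneg_left (S.le_opNorm h) (norm_nonneg _)))
    nlinarith [sq_nonneg ‖S h‖]
  have hK : ∀ x, l (Sd x) = 0 → ‖x‖ ≤ (1 + 2 * M * b) / (b * (b * M - 1)) * ‖S x - (b : ℂ) • x‖ := by
    intro x hx
    set d := S x - (b : ℂ) • x with hd
    have hSx : S x = (b : ℂ) • x + d := by rw [hd]; abel
    have h1 := hpos' x hx
    have e1 : (⟪x, S x⟫_ℂ).re = b * ‖x‖ ^ 2 + (⟪x, d⟫_ℂ).re := by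
      rw [hSx, inner_add_right, inner_smul_right, inner_self_eq_ofReal, Complex.add_re, Complex.re_ofReal_mul,
        Complex.ofReal_re]
    have e2 : ‖S x‖ ^ 2 = b ^ 2 * ‖x‖ ^ 2 + 2 * (b * (⟪x, d⟫_ℂ).re) + ‖d‖ ^ 2 := by
      rw [hSx, @norm_add_sq ℂ, inner_smul_left, norm_smul, Complex.conj_ofReal,
        Complex.norm_real, Real.norm_of_nonneg hb0]
      simp only [RCLike.re_to_complex, Complex.re_ofReal_mul]
      ring
    rw [e1, e2] at h1
    have h2 : |(⟪x, d⟫_ℂ).re| ≤ ‖x‖ * ‖d‖ :=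
      (Complex.abs_re_le_norm _).trans (norm_inner_le_norm _ _)
    rw [abs_le] at h2
    have h3 : 0 < b * (b * M - 1) := mul_pos hbpos (by linarith)
    rw [div_mul_eq_mul_div, le_div_iff₀ h3]
    rcases (norm_nonneg x).eq_or_lt with h0 | h0
    · rw [← h0]
      have : 0 ≤ (1 + 2 * M * b) := by positivity
      nlinarith [mul_nonneg this (norm_nonneg d)]
    · refine le_of_mul_le_mul_left ?_ h0
      have h4 : (1 - 2 * M * b) * (⟪x, d⟫_ℂ).re ≤ (1 + 2 * M * b) * (‖x‖ * ‖d‖) := by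
        have : 0 ≤ M * b := by positivity
        nlinarith
      have h5 : 0 ≤ M * ‖d‖ ^ 2 := by positivity
      linarith
  have hseq : ∀ n : ℕ, ∃ x : H, ‖x‖ < 1 ∧ b - 1 / ((n : ℝ) + 1) < ‖S x‖ := fun n =>
    S.exists_lt_apply_of_lt_opNorm (sub_lt_self _ (by positivity))
  choose x hx1 hx2 using hseq
  have hSxb : ∀ n, ‖S (x n)‖ ≤ b := fun n =>
    (S.le_opNorm _).trans (mul_le_of_le_one_right hb0 (hx1 n).le)
  have hlimS : Filter.Tendsto (fun n => ‖S (x n)‖) Filter.atTop (𝓝 b) := by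
    refine tendsto_of_tendsto_of_tendsto_of_le_of_le (g := fun n : ℕ => b - 1 / ((n : ℝ) + 1))
      (h := fun _ => b) ?_ tendsto_const_nhds (fun n => (hx2 n).le) hSxb
    simpa using (tendsto_const_nhds (x := b)).sub tendsto_one_div_add_atTop_nhds_zero_nat
  have hdn : ∀ n, ‖S (x n) - (b : ℂ) • x n‖ ^ 2 ≤ 2 * (b ^ 2 - ‖S (x n)‖ ^ 2) := by
    intro n
    set y := x n
    set d := S y - (b : ℂ) • y with hd
    have h1 : ‖S d + (b : ℂ) • d‖ ^ 2 =
        ‖S (S y)‖ ^ 2 - 2 * b ^ 2 * ‖S y‖ ^ 2 + b ^ 4 * ‖y‖ ^ 2 := by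
      have e : S d + (b : ℂ) • d = S (S y) - ((b ^ 2 : ℝ) : ℂ) • y := by
        rw [hd, map_sub, map_smul, smul_sub, smul_smul, Complex.ofReal_pow, sq]
        abel
      rw [e, @norm_sub_sq ℂ, inner_smul_right, hsym, inner_self_eq_ofReal, norm_smul,
        Complex.norm_real, Real.norm_of_nonneg (by positivity)] 
      simp only [RCLike.re_to_complex, Complex.re_ofReal_mul, Complex.ofReal_re]
      ring
    have h2 : b ^ 2 * ‖d‖ ^ 2 ≤ ‖S d + (b : ℂ) • d‖ ^ 2 := by
      rw [@norm_add_sq ℂ, inner_smul_right, norm_smul, Complex.norm_real,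
        Real.norm_of_nonneg hb0]
      simp only [RCLike.re_to_complex, Complex.re_ofReal_mul]
      have h3 := hSp d
      rw [← hsym] at h3
      nlinarith [mul_nonneg hb0 h3, sq_nonneg ‖S d‖]
    have h3 : ‖S (S y)‖ ≤ b * b := (S.le_opNorm _).trans (mul_le_mul_of_nonneg_left (hSxb n) hb0)
    have h4 : ‖S (S y)‖ ^ 2 ≤ b ^ 4 := by
      calc _ ≤ (b * b) ^ 2 := by gcongr
        _ = b ^ 4 := by ring
    have h5 : b ^ 4 * ‖y‖ ^ 2 ≤ b ^ 4 := by
      refine mul_le_of_le_one_right (by positivity) ?_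
      have := hx1 n
      nlinarith [norm_nonneg y]
    have h6 : b ^ 2 * ‖d‖ ^ 2 ≤ b ^ 2 * (2 * (b ^ 2 - ‖S y‖ ^ 2)) := by nlinarith
    exact le_of_mul_le_mul_left h6 (by positivity)
  have hdlim : Filter.Tendsto (fun n => S (x n) - (b : ℂ) • x n) Filter.atTop (𝓝 0) := by
    rw [tendsto_zero_iff_norm_tendsto_zero]
    have h1 : Filter.Tendsto (fun n => ‖S (x n) - (b : ℂ) • x n‖ ^ 2) Filter.atTop (𝓝 0) := by
      refine squeeze_zero (fun n => sq_nonneg _) hdn ?_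
      have := ((tendsto_const_nhds (x := b ^ 2)).sub (hlimS.pow 2)).const_mul 2
      simpa using this
    have h2 := h1.sqrt
    simpa [Real.sqrt_sq] using h2
  have hxl : ∀ᶠ n in Filter.atTop, (1 / 2 : ℝ) ≤ ‖x n‖ := by
    filter_upwards [hlimS.eventually (lt_mem_nhds (show b / 2 < b by linarith))] with n hn
    have h1 := S.le_opNorm (x n)
    rw [← hb] at h1
    by_contra hcon
    push Not at hcon
    nlinarith
  obtain ⟨y, hy0, hy⟩ := exists_eigenvector_of_approx S (b : ℂ) (l ∘ₗ Sd) hlb hK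
    (fun n => (hx1 n).le) one_half_pos hxl hdlim
  have hbc : (b : ℂ) ≠ 0 := by exact_mod_cast hbpos.ne'
  refine ⟨b⁻¹ - M, ?_, Sd y, ?_, ?_⟩
  · rw [sub_neg, inv_lt_iff_one_lt_mul₀ hbpos, mul_comm]
    exact hbM
  · rw [hSdv, hy]
    exact smul_ne_zero hbc hy0
  · have h1 : T (Sd y) - (-(M : ℂ)) • S y = y := hSe y
    have h2 : y = ((b⁻¹ : ℝ) : ℂ) • S y := by
      rw [hy, smul_smul, ← Complex.ofReal_mul, inv_mul_cancel₀ hbpos.ne', Complex.ofReal_one,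
        one_smul]
    rw [hSdv, Complex.ofReal_sub, sub_smul, ← h2]
    rw [neg_smul, sub_neg_eq_add] at h1
    exact eq_sub_of_add_eq h1

/-- A symmetric operator that is nonnegative on the kernel of a linear functional has Morse index
at most one. -/
theorem morseIndex_le_one {T : L2 →ₗ.[ℂ] L2} (hs : T.IsFormalAdjoint T) (l : T.domain →ₗ[ℂ] ℂ)
    (hpos : ∀ f : T.domain, l f = 0 → 0 ≤ (⟪T f, (f : L2)⟫_ℂ).re) : morseIndex T ≤ 1 := by
  have hre : ∀ (μ : ℝ) (f : L2), (⟪(μ : ℂ) • f, f⟫_ℂ).re = μ * ‖f‖ ^ 2 := by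
    intro μ f
    rw [inner_smul_left, inner_self_eq_ofReal, Complex.conj_ofReal, ← Complex.ofReal_mul, Complex.ofReal_re]
  have hinj : ∀ (μ : ℝ), μ < 0 → ∀ f : T.domain, T f = (μ : ℂ) • (f : L2) → l f = 0 →
      (f : L2) = 0 := by
    intro μ hμ f hf hl
    have h := hpos f hl
    rw [hf, hre] at h
    have h2 : ‖(f : L2)‖ ^ 2 = 0 := le_antisymm (by nlinarith) (sq_nonneg _)
    simpa using h2
  have hrank : ∀ μ : ℝ, μ < 0 → Module.rank ℂ (eigenspace T (μ : ℂ)) ≤ 1 := by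
    intro μ hμ
    let j : eigenspace T (μ : ℂ) →ₗ[ℂ] T.domain :=
      Submodule.inclusion (fun u hu => hu.1)
    have hj : Function.Injective (l ∘ₗ j) := by
      rw [← LinearMap.ker_eq_bot, LinearMap.ker_eq_bot']
      intro u hu
      exact Subtype.ext (hinj μ hμ (j u) u.2.2 hu)
    simpa using LinearMap.rank_le_of_injective _ hj
  have huniq : ∀ μ ν : ℝ, μ < 0 → ν < 0 → μ ≠ ν → ∀ f g : T.domain, T f = (μ : ℂ) • (f : L2) →
      T g = (ν : ℂ) • (g : L2) → (g : L2) ≠ 0 → (f : L2) = 0 := by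
    intro μ ν hμ hν hne f g hf hg hg0
    have horth : ⟪(f : L2), (g : L2)⟫_ℂ = 0 := by
      have h := hs f g
      rw [hf, hg, inner_smul_left, inner_smul_right, Complex.conj_ofReal, ← sub_eq_zero,
        ← sub_mul, mul_eq_zero] at h
      refine h.resolve_left ?_
      exact sub_ne_zero.2 (fun h => hne (Complex.ofReal_injective h))
    have horth' : ⟪(g : L2), (f : L2)⟫_ℂ = 0 := inner_eq_zero_symm.1 horth
    have hlg : l g ≠ 0 := fun h => hg0 (hinj ν hν g hg h)
    have h := hpos (l g • f - l f • g) (by simp [mul_comm])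
    have e : (⟪T (l g • f - l f • g), ((l g • f - l f • g : T.domain) : L2)⟫_ℂ).re =
        μ * (‖l g‖ * ‖(f : L2)‖) ^ 2 + ν * (‖l f‖ * ‖(g : L2)‖) ^ 2 := by
      rw [T.map_sub, T.map_smul, T.map_smul, hf, hg]
      have e1 : ((l g • f - l f • g : T.domain) : L2) = l g • (f : L2) - l f • (g : L2) := rfl
      rw [e1, smul_comm (l g), smul_comm (l f)]
      rw [inner_sub_left, inner_sub_right, inner_sub_right]
      have z1 : ⟪(μ : ℂ) • l g • (f : L2), l f • (g : L2)⟫_ℂ = 0 := by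
        rw [inner_smul_left, inner_smul_left, inner_smul_right, horth, mul_zero, mul_zero, mul_zero]
      have z2 : ⟪(ν : ℂ) • l f • (g : L2), l g • (f : L2)⟫_ℂ = 0 := by
        rw [inner_smul_left, inner_smul_left, inner_smul_right, horth', mul_zero, mul_zero, mul_zero]
      rw [z1, z2, sub_zero, zero_sub, sub_neg_eq_add, Complex.add_re, hre, hre, norm_smul,
        norm_smul]
    rw [e] at h
    have h2 : 0 ≤ (‖l f‖ * ‖(g : L2)‖) ^ 2 := sq_nonneg _
    have h3 : (‖l g‖ * ‖(f : L2)‖) ^ 2 = 0 := le_antisymm (by nlinarith) (sq_nonneg _)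
    have h4 : ‖l g‖ ≠ 0 := norm_ne_zero_iff.2 hlg
    simpa [h4, hlg] using h3
  by_cases hex : ∃ μ : Iio (0 : ℝ), eigenspace T ((μ : ℝ) : ℂ) ≠ ⊥
  · obtain ⟨μ₀, h0⟩ := hex
    obtain ⟨g, ⟨hgd, hg⟩, hg0⟩ := Submodule.exists_mem_ne_zero_of_ne_bot h0
    have hz : ∀ μ : Iio (0 : ℝ), Module.rank ℂ (eigenspace T ((μ : ℝ) : ℂ)) ≤
        if μ = μ₀ then 1 else 0 := by
      intro μ
      split_ifs with hμ
      · exact hrank μ μ.2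
      · have : eigenspace T ((μ : ℝ) : ℂ) = ⊥ := by
          rw [Submodule.eq_bot_iff]
          rintro f ⟨hfd, hf⟩
          exact huniq μ μ₀ μ.2 μ₀.2 (fun h => hμ (Subtype.ext h)) ⟨f, hfd⟩ ⟨g, hgd⟩ hf hg hg0
        rw [this, rank_bot]
    refine (Cardinal.sum_le_sum _ _ hz).trans ?_
    have hcard : (Cardinal.sum fun μ : Iio (0 : ℝ) => if μ = μ₀ then (1 : Cardinal.{0}) else 0) =
        Cardinal.sum fun μ : Iio (0 : ℝ) => Cardinal.mk {_x : Unit // μ = μ₀} := by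
      congr 1
      ext μ
      split_ifs with h <;> simp [h]
    rw [hcard, ← Cardinal.mk_sigma, Cardinal.le_one_iff_subsingleton]
    refine ⟨?_⟩
    rintro ⟨a, _, ha⟩ ⟨b, _, hb⟩
    subst ha
    subst hb
    rfl
  · push Not at hex
    have : morseIndex T = 0 := by
      unfold morseIndex
      have : (fun μ : Iio (0 : ℝ) => Module.rank ℂ (eigenspace T ((μ : ℝ) : ℂ))) = fun _ => 0 := by
        funext μ
        rw [hex μ, rank_bot]
      rw [this]
      simp
    rw [this]
    exact zero_le_one

theorem one_le_morseIndex {T : L2 →ₗ.[ℂ] L2} {μ : ℝ} (hμ : μ < 0) (f : T.domain)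
    (hf0 : (f : L2) ≠ 0) (hf : T f = (μ : ℂ) • (f : L2)) : 1 ≤ morseIndex T := by
  refine le_trans ?_ (Cardinal.le_sum (fun μ : Iio (0 : ℝ) =>
    Module.rank ℂ (eigenspace T ((μ : ℝ) : ℂ))) ⟨μ, hμ⟩)
  rw [Cardinal.one_le_iff_ne_zero]
  intro h0
  rw [rank_zero_iff] at h0
  have : (⟨f, f.2, hf⟩ : eigenspace T (μ : ℂ)) = 0 := Subsingleton.elim _ _
  exact hf0 (congrArg Subtype.val this)

end NLSCQ

namespace NLSCQ

open ComplexConjugate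

/-! ### Absolutely continuous functions on the half line -/

theorem _root_.IntervalIntegrable.absolutelyContinuousOnInterval_integral {E : Type*}
    [NormedAddCommGroup E] [NormedSpace ℝ E] {f : ℝ → E} {a b : ℝ}
    (h : IntervalIntegrable f volume a b) :
    AbsolutelyContinuousOnInterval (fun x => ∫ v in a..x, f v) a b := by
  have h1 := h.norm.absolutelyContinuousOnInterval_intervalIntegral (c := a) left_mem_uIcc
  unfold AbsolutelyContinuousOnInterval at h1 ⊢
  refine squeeze_zero' (Filter.Eventually.of_forall fun _ => Finset.sum_nonneg fun _ _ =>
    dist_nonneg) ?_ h1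
  rw [Filter.eventually_inf_principal]
  refine Filter.Eventually.of_forall ?_
  rintro ⟨n, I⟩ hnI
  refine Finset.sum_le_sum fun i hi => ?_
  obtain ⟨h2, h3⟩ := hnI.1 i hi
  have i1 : IntervalIntegrable f volume a (I i).1 :=
    h.mono_set (uIcc_subset_uIcc left_mem_uIcc h2)
  have i2 : IntervalIntegrable f volume a (I i).2 :=
    h.mono_set (uIcc_subset_uIcc left_mem_uIcc h3)
  rw [dist_eq_norm, dist_eq_norm, intervalIntegral.integral_interval_sub_left i1 i2,
    intervalIntegral.integral_interval_sub_left i1.norm i2.norm]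
  exact intervalIntegral.norm_integral_le_abs_integral_norm

/-- `F` is a primitive of the locally integrable function `f` on `[0, ∞)`. -/
def IsPrimitive (F f : ℝ → ℂ) : Prop :=
  (∀ b, 0 ≤ b → IntervalIntegrable f volume 0 b) ∧ ∀ b, 0 ≤ b → F b = F 0 + ∫ x in 0..b, f x

namespace IsPrimitive

variable {F f G g : ℝ → ℂ}

theorem absolutelyContinuous (hF : IsPrimitive F f) {b : ℝ} (hb : 0 ≤ b) :
    AbsolutelyContinuousOnInterval (fun x => F 0 + ∫ v in 0..x, f v) 0 b := by
  have h := (hF.1 b hb).absolutelyContinuousOnInterval_integral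
  unfold AbsolutelyContinuousOnInterval at h ⊢
  simpa only [dist_add_left] using h

theorem continuousOn (hF : IsPrimitive F f) : ContinuousOn F (Ici 0) := by
  intro x hx
  have h0 : (0 : ℝ) ≤ x + 1 := by linarith [mem_Ici.1 hx]
  have h1 := (hF.absolutelyContinuous h0).continuousOn
  rw [uIcc_of_le h0] at h1
  have h2 : ContinuousOn F (Icc 0 (x + 1)) := h1.congr fun y hy => hF.2 y hy.1
  refine (h2 x ⟨hx, by linarith⟩).mono_of_mem_nhdsWithin ?_
  rw [mem_nhdsWithin]
  exact ⟨Iio (x + 1), isOpen_Iio, by simp, fun y hy => ⟨hy.2, le_of_lt hy.1⟩⟩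

theorem congr_ae (hF : IsPrimitive F f) (h : f =ᵐ[volume.restrict (Ioi 0)] g) :
    IsPrimitive F g := by
  have h' : ∀ b, 0 ≤ b → f =ᵐ[volume.restrict (uIoc 0 b)] g := by
    intro b hb
    rw [uIoc_of_le hb]
    exact ae_restrict_of_ae_restrict_of_subset Ioc_subset_Ioi_self h
  refine ⟨fun b hb => (hF.1 b hb).congr_ae (h' b hb), fun b hb => ?_⟩
  rw [hF.2 b hb]
  congr 1
  refine intervalIntegral.integral_congr_ae ?_
  exact (ae_restrict_iff' measurableSet_uIoc).1 (h' b hb)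

theorem mul (hF : IsPrimitive F f) (hG : IsPrimitive G g) :
    IsPrimitive (fun x => F x * G x) (fun x => f x * G x + F x * g x) := by
  have hint : ∀ b, 0 ≤ b →
      IntervalIntegrable (fun x => f x * G x + F x * g x) volume 0 b := by
    intro b hb
    have hs : uIcc 0 b ⊆ Ici 0 := by
      rw [uIcc_of_le hb]
      exact Icc_subset_Ici_self
    exact ((hF.1 b hb).mul_continuousOn (hG.continuousOn.mono hs)).add
      ((hG.1 b hb).continuousOn_mul (hF.continuousOn.mono hs))
  refine ⟨hint, fun b hb => ?_⟩
  have hac := ((hF.absolutelyContinuous hb).fun_smul (hG.absolutelyContinuous hb)).fun_sub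
    (hint b hb).absolutelyContinuousOnInterval_integral
  have hder := hac.const_of_ae_hasDerivAt_zero (by
    filter_upwards [(hF.1 b hb).ae_hasDerivAt_integral, (hG.1 b hb).ae_hasDerivAt_integral,
      (hint b hb).ae_hasDerivAt_integral] with x h1 h2 h3 hx
    have hx0 : 0 ≤ x := by
      rw [uIcc_of_le hb] at hx
      exact hx.1
    have d1 := (h1 hx 0 left_mem_uIcc).const_add (F 0)
    have d2 := (h2 hx 0 left_mem_uIcc).const_add (G 0)
    have d3 := h3 hx 0 left_mem_uIcc
    have d := (d1.mul d2).sub d3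
    rw [← hF.2 x hx0, ← hG.2 x hx0, sub_self] at d
    exact d)
  obtain ⟨C, hC⟩ := hder
  have e0 := hC 0 left_mem_uIcc
  have eb := hC b right_mem_uIcc
  simp only [intervalIntegral.integral_same, add_zero, sub_zero, smul_eq_mul] at e0
  rw [← hF.2 b hb, ← hG.2 b hb, ← e0, smul_eq_mul, sub_eq_iff_eq_add] at eb
  exact eb

theorem star (hF : IsPrimitive F f) :
    IsPrimitive (fun x => conj (F x)) (fun x => conj (f x)) := by
  refine ⟨fun b hb => ?_, fun b hb => ?_⟩
  · have h := hF.1 b hb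
    rw [intervalIntegrable_iff] at h ⊢
    exact (Complex.conjLIE.toContinuousLinearEquiv.toContinuousLinearMap).integrable_comp h
  · change conj (F b) = conj (F 0) + ∫ x in 0..b, conj (f x)
    rw [hF.2 b hb, map_add]
    congr 1
    rw [intervalIntegral.integral_of_le hb, intervalIntegral.integral_of_le hb, integral_conj]

theorem of_hasDerivAt (h : ∀ x, 0 ≤ x → HasDerivAt F (f x) x) (hf : ContinuousOn f (Ici 0)) :
    IsPrimitive F f := by
  have hi : ∀ b, 0 ≤ b → IntervalIntegrable f volume 0 b := by
    intro b hb
    refine (hf.mono ?_).intervalIntegrable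
    rw [uIcc_of_le hb]
    exact Icc_subset_Ici_self
  refine ⟨hi, fun b hb => ?_⟩
  rw [intervalIntegral.integral_eq_sub_of_hasDerivAt (fun x hx => ?_) (hi b hb)]
  · ring
  · rw [uIcc_of_le hb] at hx
    exact h x hx.1

theorem integral_Ioi (hF : IsPrimitive F f) (h1 : IntegrableOn F (Ioi 0))
    (h2 : IntegrableOn f (Ioi 0)) : ∫ x in Ioi 0, f x = -F 0 := by
  have hl := intervalIntegral_tendsto_integral_Ioi 0 h2 Filter.tendsto_id
  have hl2 : Filter.Tendsto F Filter.atTop (𝓝 (F 0 + ∫ x in Ioi 0, f x)) := by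
    refine (hl.const_add (F 0)).congr' ?_
    filter_upwards [Filter.eventually_ge_atTop 0] with b hb
    exact (hF.2 b hb).symm
  have hz : F 0 + ∫ x in Ioi 0, f x = 0 := by
    by_contra hne
    have hpos : 0 < ‖F 0 + ∫ x in Ioi 0, f x‖ := norm_pos_iff.2 hne
    have hev := hl2.norm.eventually (lt_mem_nhds (half_lt_self hpos))
    obtain ⟨B, hB⟩ := Filter.eventually_atTop.1 hev
    have hc : IntegrableOn (fun _ : ℝ => ‖F 0 + ∫ x in Ioi 0, f x‖ / 2) (Ioi (max B 0)) := by
      refine Integrable.mono (h1.mono_set (Ioi_subset_Ioi (le_max_right B 0)))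
        aestronglyMeasurable_const ?_
      filter_upwards [ae_restrict_mem measurableSet_Ioi] with x hx
      rw [Real.norm_of_nonneg (by positivity)]
      exact (hB x ((le_max_left B 0).trans (le_of_lt hx))).le
    rw [integrableOn_const_iff] at hc
    rcases hc with hc | hc
    · rw [enorm_eq_zero] at hc
      linarith
    · simp at hc
  linear_combination hz

end IsPrimitive

/-- `F ∈ H¹(0, ∞)`, continuous on `[0, ∞)`, with derivative `f`. -/
structure IsHalfLineH1 (F f : ℝ → ℂ) : Prop where
  prim : IsPrimitive F f
  memLp : MemLp F 2 (volume.restrict (Ioi 0))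
  memLp' : MemLp f 2 (volume.restrict (Ioi 0))

namespace IsHalfLineH1

variable {F f f' G g g' : ℝ → ℂ}

theorem star (h : IsHalfLineH1 F f) :
    IsHalfLineH1 (fun x => conj (F x)) (fun x => conj (f x)) :=
  ⟨h.prim.star, h.memLp.star, h.memLp'.star⟩

theorem integral_by_parts (hF : IsHalfLineH1 F f) (hG : IsHalfLineH1 G g) :
    ∫ x in Ioi 0, (f x * G x + F x * g x) = -(F 0 * G 0) :=
  (hF.prim.mul hG.prim).integral_Ioi (hF.memLp.integrable_mul hG.memLp)
    ((hF.memLp'.integrable_mul hG.memLp).add (hF.memLp.integrable_mul hG.memLp'))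

/-- Green's formula on the half line. -/
theorem integral_green (hF : IsHalfLineH1 F f) (hf : IsHalfLineH1 f f') (hG : IsHalfLineH1 G g)
    (hg : IsHalfLineH1 g g') :
    ∫ x in Ioi 0, (conj (f' x) * G x - conj (F x) * g' x) =
      conj (F 0) * g 0 - conj (f 0) * G 0 := by
  have h1 := hf.star.integral_by_parts hG
  have h2 := hF.star.integral_by_parts hg
  have i1 : IntegrableOn (fun x => conj (f' x) * G x + conj (f x) * g x) (Ioi 0) :=
    (hf.star.memLp'.integrable_mul hG.memLp).add (hf.star.memLp.integrable_mul hG.memLp')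
  have i2 : IntegrableOn (fun x => conj (f x) * g x + conj (F x) * g' x) (Ioi 0) :=
    (hF.star.memLp'.integrable_mul hg.memLp).add (hF.star.memLp.integrable_mul hg.memLp')
  have h3 := integral_sub i1 i2
  rw [h1, h2] at h3
  rw [show conj (F 0) * g 0 - conj (f 0) * G 0 =
    -(conj (f 0) * G 0) - -(conj (F 0) * g 0) by ring, ← h3]
  refine integral_congr_ae (Filter.Eventually.of_forall fun x => ?_)
  ring

theorem mul_bounded (hF : IsHalfLineH1 F f) {p p' : ℝ → ℝ}
    (hp : ∀ x, 0 ≤ x → HasDerivAt p (p' x) x) (hp' : ContinuousOn p' (Ici 0)) {B : ℝ}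
    (hB : ∀ x, 0 ≤ x → |p x| ≤ B) (hB' : ∀ x, 0 ≤ x → |p' x| ≤ B) :
    IsHalfLineH1 (fun x => (p x : ℂ) * F x) (fun x => (p' x : ℂ) * F x + (p x : ℂ) * f x) := by
  have hprim : IsPrimitive (fun x => (p x : ℂ)) (fun x => (p' x : ℂ)) :=
    IsPrimitive.of_hasDerivAt (fun x hx => (hp x hx).ofReal_comp)
      (Complex.continuous_ofReal.comp_continuousOn hp')
  have hpc : ContinuousOn p (Ioi 0) := fun x hx =>
    (hp x (le_of_lt hx)).continuousAt.continuousWithinAt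
  have key : ∀ {q : ℝ → ℝ}, ContinuousOn q (Ioi 0) → (∀ x, 0 ≤ x → |q x| ≤ B) →
      ∀ {u : ℝ → ℂ}, MemLp u 2 (volume.restrict (Ioi 0)) →
        MemLp (fun x => (q x : ℂ) * u x) 2 (volume.restrict (Ioi 0)) := by
    intro q hq hqB u hu
    refine hu.of_le_mul (c := B) ?_ ?_
    · exact ((Complex.continuous_ofReal.comp_continuousOn hq).aestronglyMeasurable
        measurableSet_Ioi).mul hu.1
    · filter_upwards [ae_restrict_mem measurableSet_Ioi] with x hx
      rw [norm_mul, Complex.norm_real, Real.norm_eq_abs]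
      exact mul_le_mul_of_nonneg_right (hqB x (le_of_lt hx)) (norm_nonneg _)
  exact ⟨hprim.mul hF.prim, key hpc hB hF.memLp,
    (key (hp'.mono Ioi_subset_Ici_self) hB' hF.memLp).add (key hpc hB hF.memLp')⟩

/-- Jacobi's factorization: `-F'' + (p' + p²) F` has the quadratic form `∫ |F' - p F|²`, up to
boundary terms. -/
theorem le_integral_of_riccati (hF : IsHalfLineH1 F f) (hf : IsHalfLineH1 f f') {p p' : ℝ → ℝ}
    (hp : ∀ x, 0 ≤ x → HasDerivAt p (p' x) x) (hp' : ContinuousOn p' (Ici 0)) {B : ℝ}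
    (hB : ∀ x, 0 ≤ x → |p x| ≤ B) (hB' : ∀ x, 0 ≤ x → |p' x| ≤ B) :
    (conj (f 0) * F 0).re - p 0 * ‖F 0‖ ^ 2 ≤
      ∫ x in Ioi 0, (-(conj (f' x) * F x).re + (p' x + p x ^ 2) * ‖F x‖ ^ 2) := by
  have hpF := hF.mul_bounded hp hp' hB hB'
  have h1 := hf.star.integral_by_parts hF
  have h2 := hF.star.integral_by_parts hpF
  have i1 : IntegrableOn (fun x => conj (f' x) * F x + conj (f x) * f x) (Ioi 0) :=
    (hf.star.memLp'.integrable_mul hF.memLp).add (hf.star.memLp.integrable_mul hF.memLp')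
  have i2 : IntegrableOn (fun x => conj (f x) * ((p x : ℂ) * F x) +
      conj (F x) * ((p' x : ℂ) * F x + (p x : ℂ) * f x)) (Ioi 0) :=
    (hF.star.memLp'.integrable_mul hpF.memLp).add (hF.star.memLp.integrable_mul hpF.memLp')
  have h3 := integral_sub i1 i2
  rw [h1, h2] at h3
  have h4 := (integral_re (i1.sub i2)).trans (congrArg RCLike.re h3)
  have i3 := (i1.sub i2).re
  have i4 : IntegrableOn (fun x => ‖f x - (p x : ℂ) * F x‖ ^ 2) (Ioi 0) :=
    (hF.memLp'.sub hpF.memLp).integrable_norm_pow (by norm_num)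
  have e : ∀ x, -(conj (f' x) * F x).re + (p' x + p x ^ 2) * ‖F x‖ ^ 2 =
      ‖f x - (p x : ℂ) * F x‖ ^ 2 - (conj (f' x) * F x + conj (f x) * f x -
        (conj (f x) * ((p x : ℂ) * F x) +
          conj (F x) * ((p' x : ℂ) * F x + (p x : ℂ) * f x))).re := by
    intro x
    rw [← Complex.normSq_eq_norm_sq, ← Complex.normSq_eq_norm_sq]
    simp only [Complex.normSq_apply, Complex.add_re, Complex.sub_re, Complex.sub_im,
      Complex.mul_re, Complex.mul_im, Complex.conj_re, Complex.conj_im, Complex.ofReal_re,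
      Complex.ofReal_im, Complex.add_im]
    ring
  have h5 : ∫ x in Ioi 0, (-(conj (f' x) * F x).re + (p' x + p x ^ 2) * ‖F x‖ ^ 2) =
      (∫ x in Ioi 0, ‖f x - (p x : ℂ) * F x‖ ^ 2) -
        (-(conj (f 0) * F 0) - -(conj (F 0) * ((p 0 : ℂ) * F 0))).re := by
    rw [← RCLike.re_to_complex, ← h4, ← integral_sub i4 i3]
    exact integral_congr_ae (Filter.Eventually.of_forall e)
  have h6 : 0 ≤ ∫ x in Ioi 0, ‖f x - (p x : ℂ) * F x‖ ^ 2 := integral_nonneg fun x => sq_nonneg _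
  have h7 : (-(conj (f 0) * F 0) - -(conj (F 0) * ((p 0 : ℂ) * F 0))).re =
      -(conj (f 0) * F 0).re + p 0 * ‖F 0‖ ^ 2 := by
    rw [← Complex.normSq_eq_norm_sq]
    simp only [Complex.normSq_apply, Complex.sub_re, Complex.neg_re,
      Complex.mul_re, Complex.mul_im, Complex.conj_re, Complex.conj_im, Complex.ofReal_re,
      Complex.ofReal_im]
    ring
  rw [h5, h7]
  linarith

end IsHalfLineH1

end NLSCQ

namespace NLSCQ

open ComplexConjugate

/-! ### Splitting the line at the origin -/

theorem integrableOn_comp_neg_Ioi {E : Type*} [NormedAddCommGroup E] {f : ℝ → E}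
    (hf : Integrable f) : IntegrableOn (fun x => f (-x)) (Ioi 0) :=
  hf.comp_neg.integrableOn

theorem integral_eq_add_integral_comp_neg {E : Type*} [NormedAddCommGroup E] [NormedSpace ℝ E]
    {f : ℝ → E} (hf : Integrable f) :
    ∫ x, f x = (∫ x in Ioi 0, f x) + ∫ x in Ioi 0, f (-x) := by
  rw [integral_comp_neg_Ioi, neg_zero, add_comm,
    intervalIntegral.integral_Iic_add_Ioi hf.integrableOn hf.integrableOn]

theorem ae_comp_neg {P : ℝ → Prop} (h : ∀ᵐ x, P x) : ∀ᵐ x : ℝ, P (-x) :=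
  (Measure.measurePreserving_neg (volume : Measure ℝ)).quasiMeasurePreserving.ae h

theorem ae_Ioi_comp_neg {P : ℝ → Prop} (h : ∀ᵐ x ∂(volume.restrict (Iio 0)), P x) :
    ∀ᵐ x ∂(volume.restrict (Ioi (0 : ℝ))), P (-x) := by
  rw [ae_restrict_iff' measurableSet_Iio] at h
  rw [ae_restrict_iff' measurableSet_Ioi]
  filter_upwards [ae_comp_neg h] with x hx hx0
  exact hx (by simpa using hx0)

theorem eq_of_ae_eq_Ioi {F G : ℝ → ℂ} (h : F =ᵐ[volume.restrict (Ioi 0)] G)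
    (hF : ContinuousOn F (Ici 0)) (hG : ContinuousOn G (Ici 0)) : EqOn F G (Ici 0) := by
  refine Measure.eqOn_of_ae_eq (μ := volume) ?_ hF hG ?_
  · rwa [restrict_Ioi_eq_restrict_Ici] at h
  · rw [interior_Ici, closure_Ioi]

/-! ### Weak derivatives and primitives -/

theorem integrable_test_smul {ψ : ℝ → ℝ} (h : Continuous ψ) (hc : HasCompactSupport ψ) {f : ℝ → ℂ}
    (hf : LocallyIntegrable f) : Integrable fun x => ψ x • f x :=
  hf.integrable_smul_left_of_hasCompactSupport h hc

/-- Integration by parts against a test function, across the origin. -/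
theorem integral_deriv_smul_eq {u v FR FL : ℝ → ℂ} (hu : LocallyIntegrable u)
    (hv : LocallyIntegrable v) (hR : IsPrimitive FR v) (huR : u =ᵐ[volume.restrict (Ioi 0)] FR)
    (hL : IsPrimitive FL (fun x => -v (-x)))
    (huL : (fun x => u (-x)) =ᵐ[volume.restrict (Ioi 0)] FL) {ψ : ℝ → ℝ}
    (hψ : ContDiff ℝ ((⊤ : ℕ∞) : WithTop ℕ∞) ψ) (hc : HasCompactSupport ψ)
    (h0 : ψ 0 = 0 ∨ FR 0 = FL 0) : ∫ x, deriv ψ x • u x = -∫ x, ψ x • v x := by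
  have hd : Continuous (deriv ψ) := hψ.continuous_deriv (by simp)
  have i1 := integrable_test_smul hd hc.deriv hu
  have i2 := integrable_test_smul hψ.continuous hc hv
  have i0 := integrable_test_smul hψ.continuous hc hu
  have pR : IsPrimitive (fun x => (ψ x : ℂ)) (fun x => ((deriv ψ x : ℝ) : ℂ)) :=
    IsPrimitive.of_hasDerivAt
      (fun x _ => ((hψ.differentiable (by simp)) x).hasDerivAt.ofReal_comp)
      (Complex.continuous_ofReal.comp hd).continuousOn
  have pL : IsPrimitive (fun x => (ψ (-x) : ℂ)) (fun x => -((deriv ψ (-x) : ℝ) : ℂ)) := by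
    refine IsPrimitive.of_hasDerivAt (fun x _ => ?_) (by fun_prop)
    have h1 := ((hψ.differentiable (by simp)) (-x)).hasDerivAt.scomp x (hasDerivAt_neg x)
    have h2 := h1.ofReal_comp
    simpa using h2
  have eR : ∫ x in Ioi 0, (deriv ψ x • u x + ψ x • v x) = -(ψ 0 * FR 0) := by
    rw [← (pR.mul hR).integral_Ioi]
    · refine integral_congr_ae ?_
      filter_upwards [huR] with x hx
      rw [hx, Complex.real_smul, Complex.real_smul]
    · refine i0.integrableOn.congr ?_
      filter_upwards [huR] with x hx
      rw [hx, Complex.real_smul]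
    · refine (i1.add i2).integrableOn.congr ?_
      filter_upwards [huR] with x hx
      rw [Pi.add_apply, hx, Complex.real_smul, Complex.real_smul]
  have eL : ∫ x in Ioi 0, (deriv ψ (-x) • u (-x) + ψ (-x) • v (-x)) = ψ 0 * FL 0 := by
    have e := (pL.mul hL).integral_Ioi ?_ ?_
    · rw [neg_zero] at e
      rw [← neg_neg ((ψ 0 : ℂ) * FL 0), ← e, ← integral_neg]
      refine integral_congr_ae ?_
      filter_upwards [huL] with x hx
      rw [hx, Complex.real_smul, Complex.real_smul]
      ring
    · refine (integrableOn_comp_neg_Ioi i0).congr ?_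
      filter_upwards [huL] with x hx
      rw [hx, Complex.real_smul]
    · refine (integrableOn_comp_neg_Ioi (i1.add i2)).neg.congr ?_
      filter_upwards [huL] with x hx
      simp only [Pi.neg_apply, Pi.add_apply]
      rw [hx, Complex.real_smul, Complex.real_smul]
      ring
  have e := integral_eq_add_integral_comp_neg (i1.add i2)
  simp only [Pi.add_apply] at e
  rw [eR, eL, integral_add i1 i2] at e
  have : -((ψ 0 : ℂ) * FR 0) + ψ 0 * FL 0 = 0 := by
    rcases h0 with h0 | h0
    · simp [h0]
    · rw [h0]
      ring
  rw [this] at e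
  exact eq_neg_of_add_eq_zero_left e

theorem intervalIntegrable_of_locallyIntegrable {v : ℝ → ℂ} (hv : LocallyIntegrable v) (a b : ℝ) :
    IntervalIntegrable v volume a b :=
  (hv.integrableOn_isCompact isCompact_uIcc).intervalIntegrable

theorem isPrimitive_integral {v : ℝ → ℂ} (hv : LocallyIntegrable v) (c : ℂ) :
    IsPrimitive (fun x => c + ∫ t in 0..x, v t) v :=
  ⟨fun _ _ => intervalIntegrable_of_locallyIntegrable hv _ _, fun _ _ => by simp⟩

theorem isPrimitive_integral_neg {v : ℝ → ℂ} (hv : LocallyIntegrable v) (c : ℂ) :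
    IsPrimitive (fun x => c + ∫ t in 0..(-x), v t) (fun x => -v (-x)) := by
  refine ⟨fun b hb => ?_, fun b _ => ?_⟩
  · have := (intervalIntegrable_of_locallyIntegrable hv 0 (-b)).comp_sub_left 0
    simp only [zero_sub, sub_self, sub_neg_eq_add, zero_add] at this
    exact this.neg
  · have h1 : ∫ x in 0..b, -v (-x) = ∫ t in 0..(-b), v t := by
      rw [intervalIntegral.integral_neg, intervalIntegral.integral_comp_neg (fun x => v x),
        neg_zero, ← intervalIntegral.integral_symm]
    rw [h1]
    simp

/-- A test function with vanishing integral, supported in an interval, is the derivative of a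
test function supported in that interval. -/
theorem exists_test_primitive {I : Set ℝ} (hIc : I.OrdConnected) {θ : ℝ → ℝ}
    (hθ : ContDiff ℝ ((⊤ : ℕ∞) : WithTop ℕ∞) θ) (hc : HasCompactSupport θ) (hs : tsupport θ ⊆ I)
    (h0 : ∫ x, θ x = 0) : ∃ η : ℝ → ℝ, ContDiff ℝ ((⊤ : ℕ∞) : WithTop ℕ∞) η ∧
      HasCompactSupport η ∧ tsupport η ⊆ I ∧ deriv η = θ := by
  rcases (tsupport θ).eq_empty_or_nonempty with he | hne
  · have : θ = 0 := tsupport_eq_empty_iff.1 he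
    refine ⟨0, contDiff_const, HasCompactSupport.zero, ?_, ?_⟩
    · rw [tsupport_eq_empty_iff.2 rfl]
      exact empty_subset I
    · rw [this]
      exact deriv_zero
  set a := sInf (tsupport θ) with ha
  set b := sSup (tsupport θ) with hb
  have haK : a ∈ tsupport θ := hc.isCompact.sInf_mem hne
  have hbK : b ∈ tsupport θ := hc.isCompact.sSup_mem hne
  have hsub : Icc a b ⊆ I := hIc.out (hs haK) (hs hbK)
  have hout : ∀ x, x ∉ Icc a b → θ x = 0 := by
    intro x hx
    by_contra hne
    have hxK : x ∈ tsupport θ := subset_tsupport _ hne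
    exact hx ⟨csInf_le hc.isCompact.bddBelow hxK, le_csSup hc.isCompact.bddAbove hxK⟩
  have hab : a ≤ b := csInf_le hc.isCompact.bddBelow hbK
  have hcont := hθ.continuous
  have hd : ∀ x, HasDerivAt (fun x => ∫ t in a..x, θ t) (θ x) x := fun x =>
    intervalIntegral.integral_hasDerivAt_right (hcont.intervalIntegrable _ _)
      (hcont.stronglyMeasurableAtFilter _ _) hcont.continuousAt
  have hder : deriv (fun x => ∫ t in a..x, θ t) = θ := funext fun x => (hd x).deriv
  have hzero : ∀ x, x ∉ Icc a b → ∫ t in a..x, θ t = 0 := by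
    intro x hx
    rcases lt_or_ge x a with h | h
    · rw [intervalIntegral.integral_symm, intervalIntegral.integral_of_le h.le,
        integral_Ioc_eq_integral_Ioo, setIntegral_eq_zero_of_forall_eq_zero, neg_zero]
      intro t ht
      exact hout t fun h' => absurd h'.1 (not_le.2 ht.2)
    · have hbx : b < x := by
        by_contra hcon
        exact hx ⟨h, not_lt.1 hcon⟩
      rw [intervalIntegral.integral_of_le h, ← integral_Icc_eq_integral_Ioc,
        setIntegral_eq_integral_of_forall_compl_eq_zero, h0]
      intro t ht
      exact hout t fun h' => ht ⟨h'.1, h'.2.trans hbx.le⟩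
  have hts : tsupport (fun x => ∫ t in a..x, θ t) ⊆ Icc a b := by
    refine closure_minimal (fun x hx => ?_) isClosed_Icc
    by_contra hcon
    exact hx (hzero x hcon)
  refine ⟨fun x => ∫ t in a..x, θ t, ?_, ?_, hts.trans hsub, hder⟩
  · rw [contDiff_infty_iff_deriv, hder]
    exact ⟨fun x => (hd x).differentiableAt, hθ⟩
  · exact isCompact_Icc.of_isClosed_subset (isClosed_tsupport _) hts

/-- A locally integrable function with vanishing distributional derivative on an interval is
constant there. -/
theorem ae_eq_const_of_integral_deriv_smul {I : Set ℝ} (hI : IsOpen I) (hIc : I.OrdConnected)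
    (hne : I.Nonempty) {g : ℝ → ℂ} (hg : LocallyIntegrable g)
    (h : ∀ ψ : ℝ → ℝ, ContDiff ℝ ((⊤ : ℕ∞) : WithTop ℕ∞) ψ → HasCompactSupport ψ →
      tsupport ψ ⊆ I → ∫ x, deriv ψ x • g x = 0) :
    ∃ c : ℂ, g =ᵐ[volume.restrict I] fun _ => c := by
  obtain ⟨x₀, hx₀⟩ := hne
  obtain ⟨r, hr, hrI⟩ := Metric.nhds_basis_closedBall.mem_iff.1 (hI.mem_nhds hx₀)
  let B : ContDiffBump x₀ := ⟨r / 2, r, by positivity, by linarith⟩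
  set χ := B.normed volume with hχ
  have hχ1 : ContDiff ℝ ((⊤ : ℕ∞) : WithTop ℕ∞) χ := B.contDiff_normed
  have hχc : HasCompactSupport χ := B.hasCompactSupport_normed
  have hχs : tsupport χ ⊆ I := by
    rw [hχ, B.tsupport_normed_eq]
    exact hrI
  have hχi : ∫ x, χ x = 1 := B.integral_normed
  refine ⟨∫ x, χ x • g x, ?_⟩
  have hgc : LocallyIntegrable (fun x => g x - ∫ y, χ y • g y) :=
    hg.sub (locallyIntegrable_const _)
  have key := hI.ae_eq_zero_of_integral_contDiff_smul_eq_zero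
    (hgc.locallyIntegrableOn I) (by
    intro ψ hψ hc hs
    have iψ : Integrable ψ := hψ.continuous.integrable_of_hasCompactSupport hc
    have iχ : Integrable χ := hχ1.continuous.integrable_of_hasCompactSupport hχc
    obtain ⟨η, h1, h2, h3, h4⟩ := exists_test_primitive hIc (θ := fun x => ψ x - (∫ y, ψ y) * χ x)
      (hψ.sub (contDiff_const.mul hχ1)) (hc.sub (hχc.mul_left)) (by
        refine (tsupport_sub _ _).trans (union_subset hs ?_)
        exact (tsupport_mul_subset_right).trans hχs) (by
        rw [integral_sub iψ (iχ.const_mul _), integral_const_mul, hχi, mul_one, sub_self])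
    have h5 := h η h1 h2 h3
    rw [h4] at h5
    have j1 := integrable_test_smul hψ.continuous hc hg
    have j2 := integrable_test_smul hχ1.continuous hχc hg
    have j3 : Integrable fun x => (∫ y, ψ y) • χ x • g x := j2.smul (∫ y, ψ y)
    have h6 : ∫ x, ((ψ x - (∫ y, ψ y) * χ x) • g x) =
        (∫ x, ψ x • g x) - (∫ y, ψ y) • ∫ x, χ x • g x := by
      rw [← integral_smul, ← integral_sub j1 j3]
      refine integral_congr_ae (Filter.Eventually.of_forall fun x => ?_)
      simp only [sub_smul, mul_smul]
    rw [h6] at h5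
    have h7 : ∫ x, ψ x • (g x - ∫ y, χ y • g y) =
        (∫ x, ψ x • g x) - (∫ y, ψ y) • ∫ x, χ x • g x := by
      rw [← integral_smul_const, ← integral_sub j1 (iψ.smul_const _)]
      refine integral_congr_ae (Filter.Eventually.of_forall fun x => ?_)
      simp only [smul_sub]
    rw [h7, h5])
  rw [Filter.EventuallyEq, ae_restrict_iff' hI.measurableSet]
  filter_upwards [key] with x hx hxI
  exact sub_eq_zero.1 (hx hxI)

theorem L2.locallyIntegrable (u : L2) : LocallyIntegrable (fun x => u x) :=
  (Lp.memLp u).locallyIntegrable (by norm_num)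

/-- On an interval, an `L²` function is a primitive of its weak derivative. -/
theorem IsWeakDeriv.exists_ae_eq {U I : Set ℝ} {u v : L2} (h : IsWeakDeriv U u v) (hI : IsOpen I)
    (hIc : I.OrdConnected) (hne : I.Nonempty) (hIU : I ⊆ U) :
    ∃ c : ℂ, (u : ℝ → ℂ) =ᵐ[volume.restrict I] fun x => c + ∫ t in 0..x, v t := by
  have hW : Continuous fun x => ∫ t in 0..x, v t :=
    intervalIntegral.continuous_primitive (intervalIntegrable_of_locallyIntegrable (L2.locallyIntegrable v)) 0
  have hWl : LocallyIntegrable fun x => ∫ t in 0..x, v t := hW.locallyIntegrable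
  obtain ⟨c, hc⟩ := ae_eq_const_of_integral_deriv_smul hI hIc hne
    ((L2.locallyIntegrable u).sub hWl) (by
    intro ψ hψ hc hs
    have hd : Continuous (deriv ψ) := hψ.continuous_deriv (by simp)
    have h1 := h ψ hψ hc (hs.trans hIU)
    have h2 := integral_deriv_smul_eq hWl (L2.locallyIntegrable v)
      (isPrimitive_integral (L2.locallyIntegrable v) 0)
      (Filter.Eventually.of_forall fun x => (zero_add _).symm)
      (isPrimitive_integral_neg (L2.locallyIntegrable v) 0)
      (Filter.Eventually.of_forall fun x => (zero_add _).symm) hψ hc (Or.inr (by simp))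
    simp only [Pi.sub_apply, smul_sub]
    rw [integral_sub (integrable_smul_test hd hc.deriv u) (integrable_test_smul hd hc.deriv hWl), h1,
      h2, sub_self])
  refine ⟨c, ?_⟩
  filter_upwards [hc] with x hx
  rw [Pi.sub_apply, sub_eq_iff_eq_add] at hx
  exact hx

theorem L2.memLp_comp_neg (u : L2) :
    MemLp (fun x => u (-x)) 2 (volume.restrict (Ioi (0 : ℝ))) :=
  ((Lp.memLp u).comp_measurePreserving
    (Measure.measurePreserving_neg (volume : Measure ℝ))).restrict _

theorem IsWeakDeriv.exists_right {U : Set ℝ} {u v : L2} (h : IsWeakDeriv U u v)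
    (hU : Ioi 0 ⊆ U) : ∃ F : ℝ → ℂ, IsHalfLineH1 F v ∧ (u : ℝ → ℂ) =ᵐ[volume.restrict (Ioi 0)] F := by
  obtain ⟨c, hc⟩ := h.exists_ae_eq isOpen_Ioi ordConnected_Ioi nonempty_Ioi hU
  exact ⟨_, ⟨isPrimitive_integral (L2.locallyIntegrable v) c,
    ((Lp.memLp u).restrict _).ae_eq hc, (Lp.memLp v).restrict _⟩, hc⟩

theorem IsWeakDeriv.exists_left {U : Set ℝ} {u v : L2} (h : IsWeakDeriv U u v)
    (hU : Iio 0 ⊆ U) : ∃ F : ℝ → ℂ, IsHalfLineH1 F (fun x => -v (-x)) ∧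
      (fun x => u (-x)) =ᵐ[volume.restrict (Ioi 0)] F := by
  obtain ⟨c, hc⟩ := h.exists_ae_eq isOpen_Iio ordConnected_Iio nonempty_Iio hU
  have hc' := ae_Ioi_comp_neg hc
  exact ⟨_, ⟨isPrimitive_integral_neg (L2.locallyIntegrable v) c,
    (L2.memLp_comp_neg u).ae_eq hc', (L2.memLp_comp_neg v).neg⟩, hc'⟩

theorem IsWeakDeriv.sub {U : Set ℝ} {u v u' v' : L2} (h : IsWeakDeriv U u v)
    (h' : IsWeakDeriv U u' v') : IsWeakDeriv U (u - u') (v - v') := by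
  have := h.add (h'.smul (-1))
  simpa [sub_eq_add_neg] using this

theorem IsWeakDeriv.mono {U V : Set ℝ} {u v : L2} (h : IsWeakDeriv U u v) (hVU : V ⊆ U) :
    IsWeakDeriv V u v :=
  fun ψ hψ hc hs => h ψ hψ hc (hs.trans hVU)

theorem IsWeakDeriv.unique {u v v' : L2} (h : IsWeakDeriv {0}ᶜ u v) (h' : IsWeakDeriv {0}ᶜ u v') :
    v = v' := by
  have h1 := h.sub h'
  rw [sub_self] at h1
  exact sub_eq_zero.1 (h1.eq_zero isOpen_compl_singleton (by simp))

/-- Gluing `H¹` functions on the two half lines. -/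
theorem isWeakDeriv_of_halfLines {U : Set ℝ} {u v : L2} {FR FL : ℝ → ℂ} (hR : IsPrimitive FR v)
    (huR : (u : ℝ → ℂ) =ᵐ[volume.restrict (Ioi 0)] FR) (hL : IsPrimitive FL (fun x => -v (-x)))
    (huL : (fun x => u (-x)) =ᵐ[volume.restrict (Ioi 0)] FL) (h0 : (0 : ℝ) ∉ U ∨ FR 0 = FL 0) :
    IsWeakDeriv U u v := by
  intro ψ hψ hc hs
  refine integral_deriv_smul_eq (L2.locallyIntegrable u) (L2.locallyIntegrable v) hR huR hL huL hψ
    hc (h0.imp_left fun h => ?_)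
  by_contra hne
  exact h (hs (subset_tsupport _ hne))

end NLSCQ

namespace NLSCQ

open ComplexConjugate

/-! ### The action of the operators -/

theorem secondDeriv_apply {U : Set ℝ} (hU : IsOpen U) (hU0 : volume Uᶜ = 0)
    (f : (secondDeriv U).domain) {v w : L2} (h1 : IsWeakDeriv U f v) (h2 : IsWeakDeriv U v w) :
    secondDeriv U f = w := by
  have hmem : ((f : L2), w) ∈ (secondDeriv U).graph := by
    rw [secondDeriv_graph hU hU0]
    exact ⟨v, h1, h2⟩
  obtain ⟨g, hg1, hg2⟩ := (secondDeriv U).mem_graph_iff.1 hmem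
  have : g = f := Subtype.ext hg1
  exact this ▸ hg2

theorem deltaOp_apply {Z : ℝ} {V : ℝ → ℝ} (f : (deltaOp Z V).domain) {v w : L2}
    (h1 : IsWeakDeriv {0}ᶜ f v) (h2 : IsWeakDeriv {0}ᶜ v w) :
    deltaOp Z V f = -w + mulOp V ⟨f, f.2.2⟩ := by
  have h := secondDeriv_apply isOpen_compl_singleton (by simp) ⟨(f : L2), f.2.1.2⟩ h1 h2
  rw [← h]
  rfl

theorem minOp_apply {V : ℝ → ℝ} (f : (minOp V).domain) {v w : L2}
    (h1 : IsWeakDeriv univ f v) (h2 : IsWeakDeriv univ v w) :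
    minOp V f = -w + mulOp V ⟨f, f.2.2⟩ := by
  have h := secondDeriv_apply isOpen_univ (by simp) ⟨(f : L2), f.2.1.2⟩ h1 h2
  rw [← h]
  rfl

theorem mulOp_apply_ae {V : ℝ → ℝ} (f : (mulOp V).domain) :
    (mulOp V f : ℝ → ℂ) =ᵐ[volume] fun x => V x • (f : L2) x :=
  MemLp.coeFn_toLp f.2

theorem deltaOp_apply_ae {Z : ℝ} {V : ℝ → ℝ} (f : (deltaOp Z V).domain) {v w : L2}
    (h1 : IsWeakDeriv {0}ᶜ f v) (h2 : IsWeakDeriv {0}ᶜ v w) :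
    (deltaOp Z V f : ℝ → ℂ) =ᵐ[volume] fun x => -w x + V x • (f : L2) x := by
  rw [deltaOp_apply f h1 h2]
  filter_upwards [Lp.coeFn_add (-w) (mulOp V ⟨f, f.2.2⟩), Lp.coeFn_neg w,
    mulOp_apply_ae (V := V) ⟨f, f.2.2⟩] with x e1 e2 e3
  rw [e1, Pi.add_apply, e2, Pi.neg_apply, e3]

/-! ### Boundary values -/

theorem HasValueAtZero.unique {u : L2} {a b : ℂ} (ha : HasValueAtZero u a)
    (hb : HasValueAtZero u b) : a = b := by
  obtain ⟨g, h1, h2, rfl⟩ := ha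
  obtain ⟨g', k1, k2, rfl⟩ := hb
  have : g = g' := (h1.ae_eq_iff_eq volume k1).1 (h2.symm.trans k2)
  rw [this]

/-- The value at the origin as a linear functional. -/
noncomputable def valueAtZero (D : Submodule ℂ L2) (hD : ∀ u ∈ D, ∃ a, HasValueAtZero u a) : D →ₗ[ℂ] ℂ where
  toFun u := (hD u u.2).choose
  map_add' u u' := (hD _ (u + u').2).choose_spec.unique
    ((hD u u.2).choose_spec.add (hD u' u'.2).choose_spec)
  map_smul' c u := (hD _ (c • u).2).choose_spec.unique ((hD u u.2).choose_spec.smul c)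

theorem valueAtZero_spec (D : Submodule ℂ L2) (hD : ∀ u ∈ D, ∃ a, HasValueAtZero u a) (u : D) :
    HasValueAtZero u (valueAtZero D hD u) :=
  (hD u u.2).choose_spec

theorem HasValueAtZero.right {u : L2} {a : ℂ} (h : HasValueAtZero u a) :
    HasRightValueAtZero u a := by
  obtain ⟨g, h1, h2, h3⟩ := h
  exact ⟨g, h1.continuousOn, ae_restrict_of_ae h2, h3⟩

theorem HasValueAtZero.left {u : L2} {a : ℂ} (h : HasValueAtZero u a) :
    HasLeftValueAtZero u a := by
  obtain ⟨g, h1, h2, h3⟩ := h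
  exact ⟨g, h1.continuousOn, ae_restrict_of_ae h2, h3⟩

theorem HasRightValueAtZero.eq {u : L2} {b : ℂ} (h : HasRightValueAtZero u b) {F : ℝ → ℂ}
    (hF : ContinuousOn F (Ici 0)) (huF : (u : ℝ → ℂ) =ᵐ[volume.restrict (Ioi 0)] F) : F 0 = b := by
  obtain ⟨g, h1, h2, rfl⟩ := h
  exact eq_of_ae_eq_Ioi (huF.symm.trans h2) hF h1 (by simp)

theorem HasLeftValueAtZero.eq {u : L2} {b : ℂ} (h : HasLeftValueAtZero u b) {F : ℝ → ℂ}
    (hF : ContinuousOn F (Ici 0))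
    (huF : (fun x => u (-x)) =ᵐ[volume.restrict (Ioi 0)] F) : F 0 = b := by
  obtain ⟨g, h1, h2, rfl⟩ := h
  have h2' : (fun x => u (-x)) =ᵐ[volume.restrict (Ioi 0)] fun x => g (-x) := ae_Ioi_comp_neg h2
  have h1' : ContinuousOn (fun x => g (-x)) (Ici 0) :=
    h1.comp continuousOn_neg fun x hx => by simpa using hx
  have := eq_of_ae_eq_Ioi (huF.symm.trans h2') hF h1' (show (0 : ℝ) ∈ Ici 0 by simp)
  simpa using this

theorem IsWeakDeriv.exists_hasValueAtZero {u v : L2} (h : IsWeakDeriv univ u v) :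
    ∃ a, HasValueAtZero u a := by
  obtain ⟨c, hc⟩ := h.exists_ae_eq isOpen_univ ordConnected_univ univ_nonempty subset_rfl
  rw [Measure.restrict_univ] at hc
  exact ⟨_, _, continuous_const.add (intervalIntegral.continuous_primitive
    (intervalIntegrable_of_locallyIntegrable (L2.locallyIntegrable v)) 0), hc, rfl⟩

/-! ### The domain `D_Z` in terms of functions on the half line -/

theorem IsHalfLineH1.congr_ae {F f g : ℝ → ℂ} (h : IsHalfLineH1 F f)
    (hfg : f =ᵐ[volume.restrict (Ioi 0)] g) : IsHalfLineH1 F g :=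
  ⟨h.prim.congr_ae hfg, h.memLp, h.memLp'.ae_eq hfg⟩

theorem IsHalfLineH1.neg {F f : ℝ → ℂ} (h : IsHalfLineH1 F f) :
    IsHalfLineH1 (fun x => -F x) (fun x => -f x) := by
  refine ⟨⟨fun b hb => (h.prim.1 b hb).neg, fun b hb => ?_⟩, h.memLp.neg, h.memLp'.neg⟩
  simp only
  rw [intervalIntegral.integral_neg, h.prim.2 b hb]
  ring

/-- `u ∈ D_Z` with first and second derivatives `v`, `w` and value `a` at the origin is described
by the functions `u(x)`, `u(-x)` of `x > 0`, with derivatives `R'`, `L'`. -/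
structure IsDeltaData (Z : ℝ) (u v w : L2) (a : ℂ) (R R' L L' : ℝ → ℂ) : Prop where
  right : IsHalfLineH1 R R'
  right' : IsHalfLineH1 R' w
  left : IsHalfLineH1 L L'
  left' : IsHalfLineH1 L' (fun x => w (-x))
  eq_right : (u : ℝ → ℂ) =ᵐ[volume.restrict (Ioi 0)] R
  eq_left : (fun x => u (-x)) =ᵐ[volume.restrict (Ioi 0)] L
  eq_right' : (v : ℝ → ℂ) =ᵐ[volume.restrict (Ioi 0)] R'
  eq_left' : (fun x => -v (-x)) =ᵐ[volume.restrict (Ioi 0)] L'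
  right_zero : R 0 = a
  left_zero : L 0 = a
  jump : R' 0 + L' 0 = -(Z : ℂ) * a

theorem exists_isDeltaData {Z : ℝ} {u : L2} (hu : u ∈ deltaDomain Z) :
    ∃ v w a R R' L L', IsWeakDeriv univ u v ∧ IsWeakDeriv {0}ᶜ v w ∧ HasValueAtZero u a ∧
      IsDeltaData Z u v w a R R' L L' := by
  obtain ⟨⟨⟨v, hv⟩, v₁, a, bp, bm, hv₁, ha, hbp, hbm, hj⟩, hd⟩ := hu
  obtain ⟨v₂, w, hv₂, hw⟩ := mem_secondDeriv_domain.1 hd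
  have e1 : v₁ = v := hv₁.unique (hv.mono (subset_univ _))
  have e2 : v₂ = v := hv₂.unique (hv.mono (subset_univ _))
  subst e1 e2
  have hsub : Ioi (0 : ℝ) ⊆ {0}ᶜ := fun x hx => ne_of_gt hx
  have hsub' : Iio (0 : ℝ) ⊆ {0}ᶜ := fun x hx => ne_of_lt hx
  obtain ⟨R, hR, huR⟩ := hv₁.exists_right hsub
  obtain ⟨L, hL, huL⟩ := hv₁.exists_left hsub'
  obtain ⟨R', hR', huR'⟩ := hw.exists_right hsub
  obtain ⟨L', hL', huL'⟩ := hw.exists_left hsub'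
  have hvL : (fun x => -v₂ (-x)) =ᵐ[volume.restrict (Ioi 0)] fun x => -L' x := by
    filter_upwards [huL'] with x hx
    rw [hx]
  refine ⟨v₂, w, a, R, R', L, fun x => -L' x, hv, hw, ha, hR.congr_ae huR', hR',
    hL.congr_ae hvL, by simpa using hL'.neg, huR, huL, huR', hvL,
    ha.right.eq hR.prim.continuousOn huR, ha.left.eq hL.prim.continuousOn huL, ?_⟩
  rw [hbp.eq hR'.prim.continuousOn huR', hbm.eq hL'.prim.continuousOn huL', ← hj]
  ring

theorem deltaDomain_exists_value {Z : ℝ} {V : ℝ → ℝ} (u : L2) (hu : u ∈ (deltaOp Z V).domain) :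
    ∃ a, HasValueAtZero u a := by
  obtain ⟨⟨⟨-, -, a, -, -, -, ha, -⟩, -⟩, -⟩ := hu
  exact ⟨a, ha⟩

theorem deltaOp_domain_le {Z : ℝ} {V : ℝ → ℝ} : (deltaOp Z V).domain ≤ deltaDomain Z :=
  fun _ hu => hu.1

/-- The minimal operator is the restriction of the point interaction to functions that vanish at
the origin. -/
theorem mem_minOp_domain_iff {Z : ℝ} {V : ℝ → ℝ} (f : (deltaOp Z V).domain) :
    (f : L2) ∈ (minOp V).domain ↔
      valueAtZero (deltaOp Z V).domain deltaDomain_exists_value f = 0 := by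
  have hspec := valueAtZero_spec (deltaOp Z V).domain deltaDomain_exists_value f
  constructor
  · rintro ⟨⟨h, -⟩, -⟩
    exact hspec.unique h
  · intro h0
    rw [h0] at hspec
    refine ⟨⟨hspec, ?_⟩, f.2.2⟩
    obtain ⟨v, w, a, R, R', L, L', hv, hw, ha, hdata⟩ := exists_isDeltaData (deltaOp_domain_le f.2)
    have ha0 : a = 0 := ha.unique hspec
    refine mem_secondDeriv_domain.2 ⟨v, w, hv, ?_⟩
    refine isWeakDeriv_of_halfLines (FL := fun x => -L' x) hdata.right'.prim hdata.eq_right'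
      hdata.left'.neg.prim ?_ (Or.inr ?_)
    · filter_upwards [hdata.eq_left'] with x hx
      rw [← hx, neg_neg]
    · have := hdata.jump
      rw [ha0, mul_zero] at this
      exact eq_neg_of_add_eq_zero_left this

theorem minOp_le_deltaOp (Z : ℝ) (V : ℝ → ℝ) : minOp V ≤ deltaOp Z V := by
  have hdom : (minOp V).domain ≤ (deltaOp Z V).domain := by
    rintro u ⟨⟨h0, hu⟩, hV⟩
    obtain ⟨v, w, hv, hw⟩ := mem_secondDeriv_domain.1 hu
    obtain ⟨b, hb⟩ := hw.exists_hasValueAtZero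
    exact ⟨⟨⟨⟨v, hv⟩, v, 0, b, b, hv.mono (subset_univ _), h0, hb.right, hb.left, by simp⟩,
      mem_secondDeriv_domain.2 ⟨v, w, hv.mono (subset_univ _), hw.mono (subset_univ _)⟩⟩, hV⟩
  refine ⟨hdom, ?_⟩
  rintro ⟨f, hf⟩ ⟨g, hg⟩ (rfl : f = g)
  obtain ⟨v, w, hv, hw⟩ := mem_secondDeriv_domain.1 hf.1.2
  rw [minOp_apply ⟨f, hf⟩ hv hw,
    deltaOp_apply ⟨f, hg⟩ (hv.mono (subset_univ _)) (hw.mono (subset_univ _))]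

/-! ### Symmetry and form bounds -/

theorem L2.inner_eq (f g : L2) : ⟪f, g⟫_ℂ = ∫ x, conj (f x) * g x := by
  rw [L2.inner_def]
  exact integral_congr_ae (Filter.Eventually.of_forall fun x => RCLike.inner_apply' _ _)

theorem L2.integrable_conj_mul (f g : L2) : Integrable fun x => conj (f x) * g x :=
  (Lp.memLp f).star.integrable_mul (Lp.memLp g)

theorem L2.norm_sq_eq (f : L2) : ‖f‖ ^ 2 = ∫ x, ‖f x‖ ^ 2 := by
  have h := inner_self_eq_ofReal f
  rw [L2.inner_eq] at h
  have e : ∀ x, conj (f x) * f x = ((‖f x‖ ^ 2 : ℝ) : ℂ) := by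
    intro x
    rw [mul_comm, Complex.mul_conj, Complex.normSq_eq_norm_sq]
  simp only [e] at h
  exact (Complex.ofReal_injective
    ((integral_ofReal (𝕜 := ℂ) (f := fun x => ‖f x‖ ^ 2)).symm.trans h)).symm

theorem L2.integrable_norm_sq (f : L2) : Integrable fun x => ‖f x‖ ^ 2 :=
  (Lp.memLp f).integrable_norm_pow (by norm_num)

theorem inner_mulOp_symm {V : ℝ → ℝ} (f g : (mulOp V).domain) :
    ⟪mulOp V f, (g : L2)⟫_ℂ = ⟪(f : L2), mulOp V g⟫_ℂ := by
  rw [L2.inner_eq, L2.inner_eq]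
  refine integral_congr_ae ?_
  filter_upwards [mulOp_apply_ae f, mulOp_apply_ae g] with x e1 e2
  rw [e1, e2, Complex.real_smul, Complex.real_smul, map_mul, Complex.conj_ofReal]
  ring

theorem deltaOp_isFormalAdjoint (Z : ℝ) (V : ℝ → ℝ) :
    (deltaOp Z V).IsFormalAdjoint (deltaOp Z V) := by
  intro f g
  obtain ⟨v₁, w₁, a, R, R', L, L', hv₁, hw₁, -, d⟩ := exists_isDeltaData (deltaOp_domain_le f.2)
  obtain ⟨v₂, w₂, b, S, S', M, M', hv₂, hw₂, -, e⟩ := exists_isDeltaData (deltaOp_domain_le g.2)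
  rw [deltaOp_apply f (hv₁.mono (subset_univ _)) hw₁, deltaOp_apply g (hv₂.mono (subset_univ _)) hw₂,
    inner_add_left, inner_add_right, inner_mulOp_symm ⟨f, f.2.2⟩ ⟨g, g.2.2⟩, inner_neg_left,
    inner_neg_right]
  congr 1
  rw [neg_inj, ← sub_eq_zero, L2.inner_eq, L2.inner_eq,
    ← integral_sub (L2.integrable_conj_mul _ _) (L2.integrable_conj_mul _ _)]
  refine (integral_eq_add_integral_comp_neg
    ((L2.integrable_conj_mul _ _).sub (L2.integrable_conj_mul _ _))).trans ?_
  have h1 : ∫ x in Ioi 0, (conj (w₁ x) * (g : L2) x - conj ((f : L2) x) * w₂ x) =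
      conj (R 0) * S' 0 - conj (R' 0) * S 0 := by
    rw [← d.right.integral_green d.right' e.right e.right']
    refine integral_congr_ae ?_
    filter_upwards [d.eq_right, e.eq_right] with x h1 h2
    rw [h1, h2]
  have h2 : ∫ x in Ioi 0, (conj (w₁ (-x)) * (g : L2) (-x) - conj ((f : L2) (-x)) * w₂ (-x)) =
      conj (L 0) * M' 0 - conj (L' 0) * M 0 := by
    rw [← d.left.integral_green d.left' e.left e.left']
    refine integral_congr_ae ?_
    filter_upwards [d.eq_left, e.eq_left] with x h1 h2
    rw [h1, h2]
  refine (congrArg₂ (· + ·) h1 h2).trans ?_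
  rw [d.right_zero, d.left_zero, e.right_zero, e.left_zero]
  have j1 := congrArg conj d.jump
  rw [map_add, map_mul, map_neg, Complex.conj_ofReal] at j1
  linear_combination conj a * e.jump - b * j1

/-- Jacobi's factorization on both half lines. -/
theorem IsDeltaData.form_bound {Z : ℝ} {u v w : L2} {a : ℂ} {R R' L L' : ℝ → ℂ}
    (d : IsDeltaData Z u v w a R R' L L') {p p' W : ℝ → ℝ}
    (hp : ∀ x, 0 ≤ x → HasDerivAt p (p' x) x) (hp' : ContinuousOn p' (Ici 0)) {B : ℝ}
    (hB : ∀ x, 0 ≤ x → |p x| ≤ B) (hB' : ∀ x, 0 ≤ x → |p' x| ≤ B)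
    (hW : ∀ x, 0 < x → W x = p' x + p x ^ 2) (hWe : ∀ x, 0 < x → W (-x) = W x)
    (hi : Integrable fun x => W x * ‖u x‖ ^ 2) :
    (-Z - 2 * p 0) * ‖a‖ ^ 2 ≤ ∫ x, (-(conj (w x) * u x).re + W x * ‖u x‖ ^ 2) := by
  have h1 := d.right.le_integral_of_riccati d.right' hp hp' hB hB'
  have h2 := d.left.le_integral_of_riccati d.left' hp hp' hB hB'
  have i : Integrable fun x => -(conj (w x) * u x).re + W x * ‖u x‖ ^ 2 :=
    (L2.integrable_conj_mul w u).re.neg.add hi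
  rw [integral_eq_add_integral_comp_neg i]
  have e1 : ∫ x in Ioi 0, (-(conj (w x) * u x).re + W x * ‖u x‖ ^ 2) =
      ∫ x in Ioi 0, (-(conj (w x) * R x).re + (p' x + p x ^ 2) * ‖R x‖ ^ 2) := by
    refine integral_congr_ae ?_
    filter_upwards [d.eq_right, ae_restrict_mem measurableSet_Ioi] with x hx hx0
    rw [hx, hW x hx0]
  have e2 : ∫ x in Ioi 0, (-(conj (w (-x)) * u (-x)).re + W (-x) * ‖u (-x)‖ ^ 2) =
      ∫ x in Ioi 0, (-(conj (w (-x)) * L x).re + (p' x + p x ^ 2) * ‖L x‖ ^ 2) := by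
    refine integral_congr_ae ?_
    filter_upwards [d.eq_left, ae_restrict_mem measurableSet_Ioi] with x hx hx0
    rw [hx, hWe x hx0, hW x hx0]
  rw [e1, e2]
  rw [d.right_zero] at h1
  rw [d.left_zero] at h2
  have e3 : (conj (R' 0) * a).re + (conj (L' 0) * a).re = -Z * ‖a‖ ^ 2 := by
    rw [← Complex.add_re, ← add_mul, ← map_add, d.jump, map_mul, map_neg, Complex.conj_ofReal,
      ← Complex.normSq_eq_norm_sq]
    simp only [Complex.normSq_apply, Complex.neg_re, Complex.neg_im, Complex.mul_re,
      Complex.mul_im, Complex.conj_re, Complex.conj_im, Complex.ofReal_re, Complex.ofReal_im]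
    ring
  linarith

theorem integrable_mul_norm_sq {V : ℝ → ℝ} (hV : Measurable V) {C : ℝ} (hC : ∀ x, |V x| ≤ C)
    (u : L2) : Integrable fun x => V x * ‖u x‖ ^ 2 :=
  (L2.integrable_norm_sq u).bdd_mul hV.aestronglyMeasurable
    (Filter.Eventually.of_forall fun x => by rw [Real.norm_eq_abs]; exact hC x)

theorem re_inner_deltaOp {Z : ℝ} {V : ℝ → ℝ} (f : (deltaOp Z V).domain) {v w : L2}
    (h1 : IsWeakDeriv {0}ᶜ f v) (h2 : IsWeakDeriv {0}ᶜ v w) :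
    (⟪deltaOp Z V f, (f : L2)⟫_ℂ).re =
      ∫ x, (-(conj (w x) * (f : L2) x).re + V x * ‖(f : L2) x‖ ^ 2) := by
  rw [L2.inner_eq, ← RCLike.re_to_complex, ← integral_re (L2.integrable_conj_mul _ _)]
  refine integral_congr_ae ?_
  filter_upwards [deltaOp_apply_ae f h1 h2] with x hx
  rw [hx, ← Complex.normSq_eq_norm_sq]
  simp only [RCLike.re_to_complex, Complex.normSq_apply, Complex.add_re, Complex.neg_re,
    Complex.neg_im, Complex.mul_re, Complex.add_im, Complex.conj_re, Complex.conj_im,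
    Complex.real_smul, Complex.mul_im, Complex.ofReal_re, Complex.ofReal_im]
  ring

/-- The value at the origin is bounded in the form sense. -/
theorem norm_valueAtZero_sq_le (Z : ℝ) {V : ℝ → ℝ} (hV : Measurable V) {C : ℝ}
    (hC : ∀ x, |V x| ≤ C) (f : (deltaOp Z V).domain) :
    ‖valueAtZero (deltaOp Z V).domain deltaDomain_exists_value f‖ ^ 2 ≤
      (⟪deltaOp Z V f, (f : L2)⟫_ℂ).re + (C + ((Z + 1) / 2) ^ 2) * ‖(f : L2)‖ ^ 2 := by
  obtain ⟨v, w, a, R, R', L, L', hv, hw, ha, d⟩ := exists_isDeltaData (deltaOp_domain_le f.2)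
  rw [(valueAtZero_spec _ _ f).unique ha, re_inner_deltaOp f (hv.mono (subset_univ _)) hw]
  have i := L2.integrable_norm_sq (f : L2)
  have hb := d.form_bound (p := fun _ => -((Z + 1) / 2)) (p' := fun _ => 0)
    (W := fun _ => ((Z + 1) / 2) ^ 2) (B := |(Z + 1) / 2|) (fun x _ => hasDerivAt_const _ _)
    continuousOn_const (fun x _ => by rw [abs_neg]) (fun x _ => by simp)
    (fun x _ => by ring) (fun x _ => rfl) (i.const_mul _)
  have j1 : Integrable fun x => -(conj (w x) * (f : L2) x).re :=
    (L2.integrable_conj_mul w f).re.neg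
  have j2 := integrable_mul_norm_sq hV hC (f : L2)
  rw [integral_add j1 (i.const_mul _), integral_const_mul, ← L2.norm_sq_eq] at hb
  rw [integral_add j1 j2]
  have hVb : -C * ‖(f : L2)‖ ^ 2 ≤ ∫ x, V x * ‖(f : L2) x‖ ^ 2 := by
    rw [L2.norm_sq_eq, ← integral_const_mul]
    refine integral_mono (i.const_mul _) j2 fun x => ?_
    exact mul_le_mul_of_nonneg_right (abs_le.1 (hC x)).1 (sq_nonneg _)
  have e : (-Z - 2 * -((Z + 1) / 2)) * ‖a‖ ^ 2 = ‖a‖ ^ 2 := by ring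
  simp only [e] at hb
  linarith

/-- If the even potential is `p' + p²` on the half line, then the form is nonnegative on functions
that vanish at the origin. -/
theorem re_inner_deltaOp_nonneg {Z : ℝ} {V : ℝ → ℝ} (hV : Measurable V) {C : ℝ}
    (hC : ∀ x, |V x| ≤ C) {p p' : ℝ → ℝ}
    (hp : ∀ x, 0 ≤ x → HasDerivAt p (p' x) x) (hp' : ContinuousOn p' (Ici 0)) {B : ℝ}
    (hB : ∀ x, 0 ≤ x → |p x| ≤ B) (hB' : ∀ x, 0 ≤ x → |p' x| ≤ B)
    (hVp : ∀ x, 0 < x → V x = p' x + p x ^ 2) (hVe : ∀ x, V (-x) = V x)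
    (f : (deltaOp Z V).domain)
    (hf : valueAtZero (deltaOp Z V).domain deltaDomain_exists_value f = 0) :
    0 ≤ (⟪deltaOp Z V f, (f : L2)⟫_ℂ).re := by
  obtain ⟨v, w, a, R, R', L, L', hv, hw, ha, d⟩ := exists_isDeltaData (deltaOp_domain_le f.2)
  rw [(valueAtZero_spec _ _ f).unique ha] at hf
  rw [re_inner_deltaOp f (hv.mono (subset_univ _)) hw]
  have hb := d.form_bound hp hp' hB hB' hVp (fun x _ => hVe x) (integrable_mul_norm_sq hV hC _)
  rw [hf, norm_zero] at hb
  simpa using hb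

end NLSCQ

namespace NLSCQ

open ComplexConjugate

/-! ### Test functions and density -/

/-- The class in `L²` of a continuous function with compact support. -/
noncomputable def testL2 {ψ : ℝ → ℝ} (h : Continuous ψ) (hc : HasCompactSupport ψ) : L2 :=
  MemLp.toLp (fun x => (ψ x : ℂ))
    ((Complex.continuous_ofReal.comp h).memLp_of_hasCompactSupport (hc.comp_left Complex.ofReal_zero))

theorem testL2_ae {ψ : ℝ → ℝ} (h : Continuous ψ) (hc : HasCompactSupport ψ) :
    (testL2 h hc : ℝ → ℂ) =ᵐ[volume] fun x => (ψ x : ℂ) :=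
  MemLp.coeFn_toLp _

theorem inner_testL2 {ψ : ℝ → ℝ} (h : Continuous ψ) (hc : HasCompactSupport ψ) (u : L2) :
    ⟪testL2 h hc, u⟫_ℂ = ∫ x, ψ x • u x := by
  rw [L2.inner_eq]
  refine integral_congr_ae ?_
  filter_upwards [testL2_ae h hc] with x hx
  rw [hx, Complex.conj_ofReal, Complex.real_smul]

theorem isWeakDeriv_iff_inner {U : Set ℝ} {u v : L2} : IsWeakDeriv U u v ↔
    ∀ (ψ : ℝ → ℝ) (h : ContDiff ℝ ((⊤ : ℕ∞) : WithTop ℕ∞) ψ) (hc : HasCompactSupport ψ),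
      tsupport ψ ⊆ U → ⟪testL2 (h.continuous_deriv (by simp)) hc.deriv, u⟫_ℂ =
        -⟪testL2 h.continuous hc, v⟫_ℂ := by
  simp only [inner_testL2]
  rfl

theorem IsWeakDeriv.of_tendsto {U : Set ℝ} {u v : ℕ → L2} {u₀ v₀ : L2}
    (h : ∀ n, IsWeakDeriv U (u n) (v n)) (hu : Filter.Tendsto u Filter.atTop (𝓝 u₀))
    (hv : Filter.Tendsto v Filter.atTop (𝓝 v₀)) : IsWeakDeriv U u₀ v₀ := by
  rw [isWeakDeriv_iff_inner]
  intro ψ hψ hc hs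
  refine tendsto_nhds_unique (tendsto_const_nhds.inner hu) ?_
  refine (tendsto_const_nhds.inner hv).neg.congr fun n => ?_
  exact (isWeakDeriv_iff_inner.1 (h n) ψ hψ hc hs).symm

/-- The classical derivative is the weak derivative. -/
theorem isWeakDeriv_of_hasDerivAt {u v : L2} {θ θ' : ℝ → ℝ} (h : ∀ x, HasDerivAt θ (θ' x) x)
    (hc : Continuous θ') (hu : (u : ℝ → ℂ) =ᵐ[volume] fun x => (θ x : ℂ))
    (hv : (v : ℝ → ℂ) =ᵐ[volume] fun x => (θ' x : ℂ)) : IsWeakDeriv univ u v := by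
  refine isWeakDeriv_of_halfLines (FR := fun x => (θ x : ℂ)) (FL := fun x => (θ (-x) : ℂ))
    ((IsPrimitive.of_hasDerivAt (fun x _ => (h x).ofReal_comp)
      (Complex.continuous_ofReal.comp hc).continuousOn).congr_ae (ae_restrict_of_ae hv.symm))
    (ae_restrict_of_ae hu) ?_ (ae_restrict_of_ae (ae_comp_neg hu)) (Or.inr (by simp))
  refine IsPrimitive.congr_ae (f := fun x => -(θ' (-x) : ℂ)) ?_ ?_
  · refine IsPrimitive.of_hasDerivAt (fun x _ => ?_) (by fun_prop)
    have h1 := ((h (-x)).scomp x (hasDerivAt_neg x)).ofReal_comp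
    simpa using h1
  · refine ae_restrict_of_ae ?_
    filter_upwards [ae_comp_neg hv] with x hx
    rw [hx]

theorem isWeakDeriv_testL2 {ψ : ℝ → ℝ} (h : ContDiff ℝ ((⊤ : ℕ∞) : WithTop ℕ∞) ψ)
    (hc : HasCompactSupport ψ) :
    IsWeakDeriv univ (testL2 h.continuous hc) (testL2 (h.continuous_deriv (by simp)) hc.deriv) :=
  isWeakDeriv_of_hasDerivAt (fun x => (h.differentiable (by simp) x).hasDerivAt)
    (h.continuous_deriv (by simp)) (testL2_ae _ _) (testL2_ae _ _)

theorem dense_minOp_domain {V : ℝ → ℝ} (hV : Measurable V) {C : ℝ} (hC : ∀ x, |V x| ≤ C) :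
    Dense ((minOp V).domain : Set L2) := by
  rw [Submodule.dense_iff_topologicalClosure_eq_top, Submodule.topologicalClosure_eq_top_iff,
    Submodule.eq_bot_iff]
  intro g hg
  rw [Submodule.mem_orthogonal] at hg
  refine IsWeakDeriv.eq_zero (U := {0}ᶜ) isOpen_compl_singleton (by simp) ?_
  rw [isWeakDeriv_iff_inner]
  intro ψ hψ hc hs
  have hd : ContDiff ℝ ((⊤ : ℕ∞) : WithTop ℕ∞) (deriv ψ) := (contDiff_infty_iff_deriv.1 hψ).2
  rw [inner_zero_right, hg, neg_zero]
  rw [minOp_domain hV hC]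
  refine ⟨⟨fun x => (ψ x : ℂ), Complex.continuous_ofReal.comp hψ.continuous, testL2_ae _ _, ?_⟩,
    mem_secondDeriv_domain.2 ⟨_, _, isWeakDeriv_testL2 hψ hc, isWeakDeriv_testL2 hd hc.deriv⟩⟩
  by_contra hne
  exact hs (subset_tsupport _ fun h0 => hne (by simp [h0])) rfl

/-! ### The equation `u' + k u = h` -/

theorem IsWeakDeriv.re_inner_eq_zero {u v : L2} (h : IsWeakDeriv univ u v) :
    (⟪v, u⟫_ℂ).re = 0 := by
  obtain ⟨a, ha⟩ := h.exists_hasValueAtZero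
  obtain ⟨R, hR, huR⟩ := h.exists_right (subset_univ _)
  obtain ⟨L, hL, huL⟩ := h.exists_left (subset_univ _)
  have eR := ha.right.eq hR.prim.continuousOn huR
  have eL := ha.left.eq hL.prim.continuousOn huL
  have i1 := L2.integrable_conj_mul v u
  have i2 := L2.integrable_conj_mul u v
  have h1 := hR.star.integral_by_parts hR
  have h2 := hL.star.integral_by_parts hL
  have e1 : ∫ x in Ioi 0, (conj (v x) * u x + conj (u x) * v x) = -(conj a * a) := by
    rw [← eR, ← h1]
    refine integral_congr_ae ?_
    filter_upwards [huR] with x hx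
    rw [hx]
  have e2 : ∫ x in Ioi 0, (conj (v (-x)) * u (-x) + conj (u (-x)) * v (-x)) = conj a * a := by
    rw [← eL, ← neg_neg (conj (L 0) * L 0), ← h2, ← integral_neg]
    refine integral_congr_ae ?_
    filter_upwards [huL] with x hx
    rw [hx, map_neg]
    ring
  have e3 : ⟪v, u⟫_ℂ + ⟪u, v⟫_ℂ = 0 := by
    rw [L2.inner_eq, L2.inner_eq, ← integral_add i1 i2]
    refine (integral_eq_add_integral_comp_neg (i1.add i2)).trans ?_
    refine (congrArg₂ (· + ·) e1 e2).trans ?_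
    ring
  have e4 := congrArg Complex.re e3
  rw [← inner_conj_symm u v, Complex.add_re, Complex.conj_re, Complex.zero_re] at e4
  linarith

theorem IsWeakDeriv.norm_add_smul_sq {u v : L2} (h : IsWeakDeriv univ u v) (k : ℝ) :
    ‖v + (k : ℂ) • u‖ ^ 2 = ‖v‖ ^ 2 + k ^ 2 * ‖u‖ ^ 2 := by
  rw [@norm_add_sq ℂ, inner_smul_right, RCLike.re_to_complex, Complex.re_ofReal_mul,
    h.re_inner_eq_zero, norm_smul, Complex.norm_real, mul_pow, Real.norm_eq_abs, sq_abs]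
  ring

theorem exists_isWeakDeriv_add_smul {k : ℝ} (hk : k ≠ 0) (h : L2) :
    ∃ u v, IsWeakDeriv univ u v ∧ v + (k : ℂ) • u = h := by
  let D : Submodule ℂ L2 :=
    { carrier := {h | ∃ u v, IsWeakDeriv univ u v ∧ v + (k : ℂ) • u = h}
      zero_mem' := ⟨0, 0, IsWeakDeriv.zero _, by simp⟩
      add_mem' := by
        rintro _ _ ⟨u, v, h1, rfl⟩ ⟨u', v', h2, rfl⟩
        exact ⟨u + u', v + v', h1.add h2, by rw [smul_add]; abel⟩
      smul_mem' := by
        rintro c _ ⟨u, v, h1, rfl⟩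
        exact ⟨c • u, c • v, h1.smul c, by rw [smul_add, smul_comm]⟩ }
  have hclosed : IsClosed (D : Set L2) := by
    refine isClosed_of_closure_subset fun y hy => ?_
    obtain ⟨s, hs, hlim⟩ := mem_closure_iff_seq_limit.1 hy
    choose u v huv hsum using hs
    have hdist : ∀ n m, k ^ 2 * ‖u n - u m‖ ^ 2 ≤ ‖s n - s m‖ ^ 2 := by
      intro n m
      have := ((huv n).sub (huv m)).norm_add_smul_sq k
      rw [smul_sub, show v n - v m + ((k : ℂ) • u n - (k : ℂ) • u m) = s n - s m by
        rw [← hsum, ← hsum]; abel] at this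
      rw [this]
      nlinarith [sq_nonneg ‖v n - v m‖]
    have hcs : CauchySeq u := by
      rw [Metric.cauchySeq_iff']
      intro ε hε
      obtain ⟨N, hN⟩ := Metric.cauchySeq_iff'.1 hlim.cauchySeq (|k| * ε) (by positivity)
      refine ⟨N, fun n hn => ?_⟩
      have h1 := hN n hn
      rw [dist_eq_norm] at h1 ⊢
      have h2 := hdist n N
      rw [← sq_abs k, ← mul_pow] at h2
      have h3 := (abs_le_of_sq_le_sq' h2 (norm_nonneg _)).2
      exact lt_of_mul_lt_mul_left (h3.trans_lt h1) (abs_nonneg k)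
    obtain ⟨u₀, hu₀⟩ := cauchySeq_tendsto_of_complete hcs
    have hv : Filter.Tendsto v Filter.atTop (𝓝 (y - (k : ℂ) • u₀)) := by
      refine (hlim.sub (hu₀.const_smul (k : ℂ))).congr fun n => ?_
      rw [← hsum]
      abel
    exact ⟨u₀, _, IsWeakDeriv.of_tendsto huv hu₀ hv, by abel⟩
  have horth : Dᗮ = ⊥ := by
    rw [Submodule.eq_bot_iff]
    intro g hg
    rw [Submodule.mem_orthogonal] at hg
    have hw : IsWeakDeriv univ g ((k : ℂ) • g) := by
      rw [isWeakDeriv_iff_inner]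
      intro ψ hψ hc _
      have := hg _ ⟨_, _, isWeakDeriv_testL2 hψ hc, rfl⟩
      rw [inner_add_left, inner_smul_left, Complex.conj_ofReal] at this
      rw [inner_smul_right]
      exact eq_neg_of_add_eq_zero_left this
    have h0 := hw.re_inner_eq_zero
    rw [inner_smul_left, Complex.conj_ofReal, Complex.re_ofReal_mul, inner_self_eq_ofReal,
      Complex.ofReal_re] at h0
    have : ‖g‖ ^ 2 = 0 := (mul_eq_zero.1 h0).resolve_left hk
    simpa using this
  have : CompleteSpace D := hclosed.completeSpace_coe
  have htop : D = ⊤ := Submodule.orthogonal_eq_bot_iff.1 horth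
  exact (htop ▸ Submodule.mem_top : h ∈ D)

/-- The equation `-f'' + k² f = h` is solvable in `H²(ℝ)`. -/
theorem exists_helmholtz {k : ℝ} (hk : k ≠ 0) (h : L2) :
    ∃ f v w, IsWeakDeriv univ f v ∧ IsWeakDeriv univ v w ∧ -w + ((k : ℂ) ^ 2) • f = h := by
  obtain ⟨g, g', hg, e1⟩ := exists_isWeakDeriv_add_smul (neg_ne_zero.2 hk) (-h)
  obtain ⟨f, v, hf, e2⟩ := exists_isWeakDeriv_add_smul hk g
  refine ⟨f, v, g' - (k : ℂ) • v, hf, ?_, ?_⟩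
  · have : v = g - (k : ℂ) • f := by rw [← e2]; abel
    rw [this]
    have h1 := hg.sub (hf.smul (k : ℂ))
    rwa [this] at h1
  · have h1 : h = -(g' + ((-k : ℝ) : ℂ) • g) := by rw [e1, neg_neg]
    rw [h1, ← e2, Complex.ofReal_neg]
    module

/-! ### Even functions that are smooth on each half line -/

theorem integrable_exp_neg_mul_abs {k : ℝ} (hk : 0 < k) :
    Integrable fun x : ℝ => Real.exp (-k * |x|) := by
  rw [← integrableOn_univ, ← Iic_union_Ioi (a := (0 : ℝ))]
  refine IntegrableOn.union ?_ ?_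
  · refine (integrableOn_exp_mul_Iic hk 0).congr_fun (fun x hx => ?_) measurableSet_Iic
    simp only
    rw [abs_of_nonpos hx, neg_mul_neg]
  · refine (exp_neg_integrableOn_Ioi 0 hk).congr_fun (fun x hx => ?_) measurableSet_Ioi
    simp only
    rw [abs_of_pos hx]

theorem memLp_two_of_exp_bound {f : ℝ → ℝ} (hf : Measurable f) {K k : ℝ} (hk : 0 < k)
    (h : ∀ x, |f x| ≤ K * Real.exp (-k * |x|)) : MemLp (fun x => (f x : ℂ)) 2 volume := by
  have hm : Measurable fun x => (f x : ℂ) := Complex.measurable_ofReal.comp hf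
  rw [memLp_two_iff_integrable_sq_norm hm.aestronglyMeasurable]
  refine ((integrable_exp_neg_mul_abs (k := 2 * k) (by positivity)).const_mul (K ^ 2)).mono'
    (hm.norm.pow_const 2).aestronglyMeasurable
    (Filter.Eventually.of_forall fun x => ?_)
  rw [Real.norm_of_nonneg (by positivity), Complex.norm_real, Real.norm_eq_abs]
  have h1 := pow_le_pow_left₀ (abs_nonneg _) (h x) 2
  rw [mul_pow, ← Real.exp_nat_mul] at h1
  rwa [show -(2 * k) * |x| = ((2 : ℕ) : ℝ) * (-k * |x|) by push_cast; ring]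

theorem exists_radial {g g' g'' : ℝ → ℝ} (hg : ∀ x, HasDerivAt g (g' x) x)
    (hg' : ∀ x, HasDerivAt g' (g'' x) x) (hc : Continuous g'') {K k : ℝ} (hk : 0 < k)
    (b : ∀ x, 0 ≤ x → |g x| ≤ K * Real.exp (-k * x))
    (b' : ∀ x, 0 ≤ x → |g' x| ≤ K * Real.exp (-k * x))
    (b'' : ∀ x, 0 ≤ x → |g'' x| ≤ K * Real.exp (-k * x)) :
    ∃ u v w : L2, ((u : ℝ → ℂ) =ᵐ[volume] fun x => (g |x| : ℂ)) ∧
      ((w : ℝ → ℂ) =ᵐ[volume] fun x => (g'' |x| : ℂ)) ∧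
      IsWeakDeriv univ u v ∧ IsWeakDeriv {0}ᶜ v w ∧ HasValueAtZero u (g 0) ∧
      HasRightValueAtZero v (g' 0) ∧ HasLeftValueAtZero v (-(g' 0 : ℂ)) := by
  have gc : Continuous g := continuous_iff_continuousAt.2 fun x => (hg x).continuousAt
  have gc' : Continuous g' := continuous_iff_continuousAt.2 fun x => (hg' x).continuousAt
  have m0 := memLp_two_of_exp_bound (f := fun x => g |x|) (by fun_prop) hk
    (fun x => b _ (abs_nonneg x))
  have m1 := memLp_two_of_exp_bound (f := fun x => if 0 < x then g' x else -g' (-x))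
    (Measurable.ite measurableSet_Ioi (by fun_prop) (by fun_prop)) hk (fun x => by
      split_ifs with h
      · rw [abs_of_pos h]
        exact b' x h.le
      · have h' := not_lt.1 h
        rw [abs_of_nonpos h', abs_neg]
        exact b' _ (by linarith))
  have m2 := memLp_two_of_exp_bound (f := fun x => g'' |x|) (by fun_prop) hk
    (fun x => b'' _ (abs_nonneg x))
  have e0 := m0.coeFn_toLp
  have e1 := m1.coeFn_toLp
  have e2 := m2.coeFn_toLp
  have v_right : (m1.toLp : ℝ → ℂ) =ᵐ[volume.restrict (Ioi 0)] fun x => (g' x : ℂ) := by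
    filter_upwards [ae_restrict_of_ae e1, ae_restrict_mem measurableSet_Ioi] with x hx h0
    rw [hx, if_pos (mem_Ioi.1 h0)]
  have v_left : (fun x => m1.toLp _ (-x)) =ᵐ[volume.restrict (Ioi (0 : ℝ))]
      fun x => -(g' x : ℂ) := by
    filter_upwards [ae_restrict_of_ae (ae_comp_neg e1), ae_restrict_mem measurableSet_Ioi]
      with x hx h0
    rw [hx, if_neg (by simpa using le_of_lt h0), neg_neg, Complex.ofReal_neg]
  have u_right : (m0.toLp : ℝ → ℂ) =ᵐ[volume.restrict (Ioi 0)] fun x => (g x : ℂ) := by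
    filter_upwards [ae_restrict_of_ae e0, ae_restrict_mem measurableSet_Ioi] with x hx h0
    rw [hx, abs_of_pos h0]
  have u_left : (fun x => m0.toLp _ (-x)) =ᵐ[volume.restrict (Ioi (0 : ℝ))]
      fun x => (g x : ℂ) := by
    filter_upwards [ae_restrict_of_ae (ae_comp_neg e0), ae_restrict_mem measurableSet_Ioi]
      with x hx h0
    rw [hx, abs_neg, abs_of_pos h0]
  have w_right : (m2.toLp : ℝ → ℂ) =ᵐ[volume.restrict (Ioi 0)] fun x => (g'' x : ℂ) := by
    filter_upwards [ae_restrict_of_ae e2, ae_restrict_mem measurableSet_Ioi] with x hx h0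
    rw [hx, abs_of_pos h0]
  have w_left : (fun x => m2.toLp _ (-x)) =ᵐ[volume.restrict (Ioi (0 : ℝ))]
      fun x => (g'' x : ℂ) := by
    filter_upwards [ae_restrict_of_ae (ae_comp_neg e2), ae_restrict_mem measurableSet_Ioi]
      with x hx h0
    rw [hx, abs_neg, abs_of_pos h0]
  have p0 : IsPrimitive (fun x => (g x : ℂ)) (fun x => (g' x : ℂ)) :=
    IsPrimitive.of_hasDerivAt (fun x _ => (hg x).ofReal_comp)
      (Complex.continuous_ofReal.comp gc').continuousOn
  have p1 : IsPrimitive (fun x => (g' x : ℂ)) (fun x => (g'' x : ℂ)) :=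
    IsPrimitive.of_hasDerivAt (fun x _ => (hg' x).ofReal_comp)
      (Complex.continuous_ofReal.comp hc).continuousOn
  have p1n : IsPrimitive (fun x => -(g' x : ℂ)) (fun x => -(g'' x : ℂ)) :=
    IsPrimitive.of_hasDerivAt (fun x _ => (hg' x).ofReal_comp.neg)
      (Complex.continuous_ofReal.comp hc).neg.continuousOn
  refine ⟨m0.toLp, m1.toLp, m2.toLp, e0, e2, ?_, ?_, ?_, ?_, ?_⟩
  · refine isWeakDeriv_of_halfLines (p0.congr_ae v_right.symm) u_right (p0.congr_ae ?_) u_left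
      (Or.inr rfl)
    filter_upwards [v_left] with x hx
    rw [hx, neg_neg]
  · refine isWeakDeriv_of_halfLines (p1.congr_ae w_right.symm) v_right (p1n.congr_ae ?_) v_left
      (Or.inl (by simp))
    filter_upwards [w_left] with x hx
    rw [hx]
  · exact ⟨fun x => (g |x| : ℂ), by fun_prop, e0, by simp⟩
  · exact ⟨fun x => (g' x : ℂ), by fun_prop, v_right, rfl⟩
  · refine ⟨fun x => -(g' (-x) : ℂ), by fun_prop, ?_, by simp⟩
    filter_upwards [ae_restrict_of_ae e1, ae_restrict_mem measurableSet_Iio] with x hx h0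
    rw [hx, if_neg (not_lt.2 (le_of_lt h0)), Complex.ofReal_neg]

/-! ### Self-adjointness -/

/-- For large `k` the equation `-u'' + k² u = h` is solvable in `D_Z`. -/
theorem exists_deltaDomain_helmholtz {Z k : ℝ} (hk : 0 < k) (hkZ : 2 * k ≠ Z) (h : L2) :
    ∃ u v w, u ∈ deltaDomain Z ∧ IsWeakDeriv {0}ᶜ u v ∧ IsWeakDeriv {0}ᶜ v w ∧
      -w + ((k : ℂ) ^ 2) • u = h := by
  obtain ⟨f, v, w, hf, hv, e⟩ := exists_helmholtz hk.ne' h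
  obtain ⟨a, ha⟩ := hf.exists_hasValueAtZero
  obtain ⟨b, hb⟩ := hv.exists_hasValueAtZero
  have hd : ∀ (c x : ℝ), HasDerivAt (fun x => c * Real.exp (-k * x))
      (-k * c * Real.exp (-k * x)) x := by
    intro c x
    have := (((hasDerivAt_id x).const_mul (-k)).exp).const_mul c
    rw [mul_one] at this
    exact this.congr_deriv (by simp only [id_eq]; ring)
  have hexp : ∀ c x : ℝ, |c| ≤ 1 + k + k ^ 2 →
      |c * Real.exp (-k * x)| ≤ (1 + k + k ^ 2) * Real.exp (-k * x) := by
    intro c x hc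
    rw [abs_mul, abs_of_pos (Real.exp_pos _)]
    gcongr
  obtain ⟨p, p', p'', ep, ep'', hp, hp', hp0, hpr, hpl⟩ := exists_radial
    (g := fun x => 1 * Real.exp (-k * x)) (g' := fun x => -k * 1 * Real.exp (-k * x))
    (g'' := fun x => -k * (-k * 1) * Real.exp (-k * x)) (K := 1 + k + k ^ 2)
    (hd 1) (hd (-k * 1)) (by fun_prop) hk
    (fun x _ => hexp _ x (by rw [abs_one]; nlinarith))
    (fun x _ => hexp _ x (by rw [mul_one, abs_neg, abs_of_pos hk]; nlinarith))
    (fun x _ => hexp _ x (by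
      rw [mul_one, neg_mul_neg, abs_of_pos (mul_pos hk hk)]
      nlinarith))
  have epp : p'' = ((k : ℂ) ^ 2) • p := by
    ext1
    filter_upwards [ep, ep'', Lp.coeFn_smul ((k : ℂ) ^ 2) p] with x h1 h2 h3
    rw [h2, h3, Pi.smul_apply, h1, smul_eq_mul]
    push_cast
    ring
  simp only [mul_zero, Real.exp_zero, mul_one, Complex.ofReal_one, Complex.ofReal_neg] at hp0 hpr hpl
  have hkZc : (2 * (k : ℂ) - Z) ≠ 0 := by
    rw [sub_ne_zero]
    exact_mod_cast hkZ
  set c : ℂ := Z * a / (2 * k - Z) with hc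
  have hsub : ({0}ᶜ : Set ℝ) ⊆ univ := subset_univ _
  have hu1 : IsWeakDeriv univ (f + c • p) (v + c • p') := hf.add (hp.smul c)
  have hu2 : IsWeakDeriv {0}ᶜ (v + c • p') (w + c • p'') := (hv.mono hsub).add (hp'.smul c)
  refine ⟨f + c • p, v + c • p', w + c • p'', ?_, hu1.mono hsub, hu2, ?_⟩
  · refine ⟨⟨⟨_, hu1⟩, v + c • p', a + c * 1, b + c * -k, b + c * (- -k), hu1.mono hsub,
      ha.add (hp0.smul c), hb.right.add (hpr.smul c), hb.left.add (hpl.smul c), ?_⟩,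
      mem_secondDeriv_domain.2 ⟨_, _, hu1.mono hsub, hu2⟩⟩
    have : c * (2 * k - Z) = Z * a := by rw [hc, div_mul_cancel₀ _ hkZc]
    linear_combination -this
  · rw [← e, epp]
    module

theorem deltaOp_isSelfAdjoint (Z : ℝ) {V : ℝ → ℝ} (hV : Measurable V) {C : ℝ}
    (hC : ∀ x, |V x| ≤ C) : IsSelfAdjoint (deltaOp Z V) := by
  have htop : ∀ u, u ∈ (mulOp V).domain := fun u => by rw [mulOp_domain hV hC]; trivial
  obtain ⟨k, hk, hkZ⟩ : ∃ k : ℝ, 0 < k ∧ 2 * k ≠ Z :=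
    ⟨|Z| + 1, by positivity, fun h => by have := le_abs_self Z; linarith [abs_nonneg Z]⟩
  refine isSelfAdjoint_of_add_surjective
    ((dense_minOp_domain hV hC).mono (minOp_le_deltaOp Z V).1) (deltaOp_isFormalAdjoint Z V)
    (fun h => ((k : ℂ) ^ 2) • h - mulOp V ⟨h, htop h⟩) (fun x y => ?_) (fun h => ?_)
  · rw [inner_sub_left, inner_sub_right, inner_mulOp_symm ⟨x, htop x⟩ ⟨y, htop y⟩, inner_smul_left,
      inner_smul_right, map_pow, Complex.conj_ofReal]
  · obtain ⟨u, v, w, hu, hv, hw, e⟩ := exists_deltaDomain_helmholtz hk hkZ h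
    refine ⟨⟨u, by rwa [deltaOp_domain Z hV hC]⟩, ?_⟩
    rw [deltaOp_apply _ hv hw, ← e]
    abel

end NLSCQ

namespace NLSCQ

open Real

/-! ### The profile on the half line -/

/-- `α + γ cosh (2κ(x + a))`. -/
noncomputable def peakDenom (α γ κ a x : ℝ) : ℝ := α + γ * cosh (2 * κ * (x + a))

/-- The profile `(κ² / (α + γ cosh (2κ(x + a))))^(1/2)`. -/
noncomputable def peak (α γ κ a x : ℝ) : ℝ := κ / √(peakDenom α γ κ a x)

/-- The logarithmic derivative of `peak`, up to the factor `-κ`. -/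
noncomputable def peakSlope (α γ κ a x : ℝ) : ℝ :=
  γ * sinh (2 * κ * (x + a)) / peakDenom α γ κ a x

/-- The logarithmic derivative of the derivative of `peak`. -/
noncomputable def peakRiccati (α γ κ a x : ℝ) : ℝ :=
  κ * (2 * α * cosh (2 * κ * (x + a)) + 3 * γ - γ * cosh (2 * κ * (x + a)) ^ 2) /
    (sinh (2 * κ * (x + a)) * peakDenom α γ κ a x)

section

variable {α γ κ a : ℝ}

theorem peakDenom_pos (hα : 0 < α) (hγ : 0 < γ) (x : ℝ) : 0 < peakDenom α γ κ a x := by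
  have := cosh_pos (2 * κ * (x + a))
  unfold peakDenom
  positivity

theorem hasDerivAt_arg (x : ℝ) : HasDerivAt (fun x => 2 * κ * (x + a)) (2 * κ) x := by
  simpa using ((hasDerivAt_id x).add_const a).const_mul (2 * κ)

theorem hasDerivAt_peakDenom (x : ℝ) : HasDerivAt (peakDenom α γ κ a)
    (2 * κ * γ * sinh (2 * κ * (x + a))) x :=
  ((((hasDerivAt_arg x).cosh).const_mul γ).const_add α).congr_deriv (by ring)

theorem peak_sq (hα : 0 < α) (hγ : 0 < γ) (x : ℝ) :
    peak α γ κ a x ^ 2 = κ ^ 2 / peakDenom α γ κ a x := by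
  rw [peak, div_pow, sq_sqrt (peakDenom_pos hα hγ x).le]

theorem peak_pos (hα : 0 < α) (hγ : 0 < γ) (hκ : 0 < κ) (x : ℝ) : 0 < peak α γ κ a x :=
  div_pos hκ (sqrt_pos.2 (peakDenom_pos hα hγ x))

theorem hasDerivAt_peak (hα : 0 < α) (hγ : 0 < γ) (x : ℝ) : HasDerivAt (peak α γ κ a)
    (-κ * peakSlope α γ κ a x * peak α γ κ a x) x := by
  have hD := peakDenom_pos (κ := κ) (a := a) hα hγ x
  have hs := sqrt_pos.2 hD
  have h := ((hasDerivAt_peakDenom x).sqrt hD.ne').fun_inv hs.ne' |>.const_mul κ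
  refine h.congr_deriv ?_
  unfold peakSlope peak
  rw [sq_sqrt hD.le]
  field_simp

theorem hasDerivAt_peakSlope (hα : 0 < α) (hγ : 0 < γ) (x : ℝ) : HasDerivAt (peakSlope α γ κ a)
    (2 * κ * γ * (α * cosh (2 * κ * (x + a)) + γ) / peakDenom α γ κ a x ^ 2) x := by
  have hD := peakDenom_pos (κ := κ) (a := a) hα hγ x
  have h := (((hasDerivAt_arg (κ := κ) (a := a) x).sinh).const_mul γ).fun_div
    (hasDerivAt_peakDenom (α := α) (γ := γ) x) hD.ne'
  refine h.congr_deriv ?_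
  have hcs := cosh_sq (2 * κ * (x + a))
  congr 1
  unfold peakDenom
  linear_combination (2 * κ * γ ^ 2) * hcs

theorem hasDerivAt_deriv_peak (hα : 0 < α) (hγ : 0 < γ) (x : ℝ) :
    HasDerivAt (fun x => -κ * peakSlope α γ κ a x * peak α γ κ a x)
      ((κ ^ 2 - 4 * α * peak α γ κ a x ^ 2 -
        3 * ((γ ^ 2 - α ^ 2) / κ ^ 2) * peak α γ κ a x ^ 4) * peak α γ κ a x) x := by
  have hD := peakDenom_pos (κ := κ) (a := a) hα hγ x
  have h := ((hasDerivAt_peakSlope (κ := κ) (a := a) hα hγ x).const_mul (-κ)).fun_mul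
    (hasDerivAt_peak (κ := κ) (a := a) hα hγ x)
  refine h.congr_deriv ?_
  rw [show peak α γ κ a x ^ 4 = (peak α γ κ a x ^ 2) ^ 2 by ring, peak_sq hα hγ]
  have hcs := cosh_sq (2 * κ * (x + a))
  have hk : (γ ^ 2 - α ^ 2) / κ ^ 2 * (κ ^ 2 / peakDenom α γ κ a x) ^ 2 =
      (γ ^ 2 - α ^ 2) * κ ^ 2 / peakDenom α γ κ a x ^ 2 := by
    rcases eq_or_ne κ 0 with h0 | h0
    · simp [h0]
    · field_simp
  rw [mul_assoc 3, hk]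
  unfold peakSlope
  generalize hDd : peakDenom α γ κ a x = D at *
  have hDe : D = α + γ * cosh (2 * κ * (x + a)) := hDd.symm
  generalize sinh (2 * κ * (x + a)) = s at *
  generalize cosh (2 * κ * (x + a)) = c at *
  field_simp
  rw [hDe]
  linear_combination (-(κ ^ 2 * γ ^ 2 * peak α γ κ a x)) * hcs

theorem abs_peakSlope_le (hα : 0 < α) (hγ : 0 < γ) (x : ℝ) : |peakSlope α γ κ a x| ≤ 1 := by
  have hD := peakDenom_pos (κ := κ) (a := a) hα hγ x
  rw [peakSlope, abs_div, abs_of_pos hD, div_le_one hD, abs_mul, abs_of_pos hγ]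
  have h1 : |sinh (2 * κ * (x + a))| ≤ cosh (2 * κ * (x + a)) := by
    rw [← abs_of_pos (cosh_pos (2 * κ * (x + a)))]
    refine sq_le_sq.1 ?_
    rw [cosh_sq]
    linarith
  unfold peakDenom
  nlinarith

theorem peak_le (hα : 0 < α) (hγ : 0 < γ) (hκ : 0 < κ) (ha : 0 < a) {x : ℝ} :
    peak α γ κ a x ≤ √(2 * κ ^ 2 / γ) * exp (-κ * x) := by
  have hD := peakDenom_pos (κ := κ) (a := a) hα hγ x
  refine abs_le_of_sq_le_sq' ?_ (by positivity) |>.2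
  rw [peak_sq hα hγ, mul_pow, sq_sqrt (by positivity), ← exp_nat_mul, div_le_iff₀ hD]
  have h1 : exp (2 * κ * x) / 2 ≤ cosh (2 * κ * (x + a)) := by
    rw [cosh_eq]
    have : exp (2 * κ * x) ≤ exp (2 * κ * (x + a)) := by
      apply exp_le_exp.2
      nlinarith
    have := exp_pos (-(2 * κ * (x + a)))
    linarith
  have h2 : exp (((2 : ℕ) : ℝ) * (-κ * x)) * exp (2 * κ * x) = 1 := by
    rw [← exp_add, ← exp_zero]
    congr 1
    push_cast
    ring
  have h3 : γ * (exp (2 * κ * x) / 2) ≤ peakDenom α γ κ a x := by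
    unfold peakDenom
    nlinarith
  calc κ ^ 2 = 2 * κ ^ 2 / γ * exp (((2 : ℕ) : ℝ) * (-κ * x)) * (γ * (exp (2 * κ * x) / 2)) := by
        generalize exp (2 * κ * x) = e at *
        generalize exp (((2 : ℕ) : ℝ) * (-κ * x)) = e' at *
        field_simp
        linear_combination (-1) * h2
    _ ≤ _ := by gcongr

theorem sinh_arg_pos (hκ : 0 < κ) (ha : 0 < a) {x : ℝ} (hx : 0 ≤ x) :
    0 < sinh (2 * κ * (x + a)) := by
  rw [sinh_pos_iff]
  positivity

/-- `peakRiccati` solves the Riccati equation of the linearization at `peak`. -/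
theorem hasDerivAt_peakRiccati (hα : 0 < α) (hγ : 0 < γ) (hκ : 0 < κ) (ha : 0 < a) {x : ℝ}
    (hx : 0 ≤ x) : HasDerivAt (peakRiccati α γ κ a)
      (κ ^ 2 - 12 * α * peak α γ κ a x ^ 2 - 15 * ((γ ^ 2 - α ^ 2) / κ ^ 2) * peak α γ κ a x ^ 4 -
        peakRiccati α γ κ a x ^ 2) x := by
  have hD := peakDenom_pos (κ := κ) (a := a) hα hγ x
  have hs := sinh_arg_pos hκ ha hx
  have hc := (hasDerivAt_arg (κ := κ) (a := a) x).cosh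
  have hn := (((hc.const_mul (2 * α)).add_const (3 * γ)).fun_sub
    ((hc.fun_pow 2).const_mul γ)).const_mul κ
  have hd := ((hasDerivAt_arg (κ := κ) (a := a) x).sinh).fun_mul
    (hasDerivAt_peakDenom (α := α) (γ := γ) (κ := κ) (a := a) x)
  have h := hn.fun_div hd (mul_pos hs hD).ne'
  refine h.congr_deriv ?_
  rw [show peak α γ κ a x ^ 4 = (peak α γ κ a x ^ 2) ^ 2 by ring, peak_sq hα hγ]
  have hcs := cosh_sq (2 * κ * (x + a))
  unfold peakRiccati
  generalize hDd : peakDenom α γ κ a x = D at *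
  have hDe : D = α + γ * cosh (2 * κ * (x + a)) := hDd.symm
  generalize sinh (2 * κ * (x + a)) = s at *
  generalize cosh (2 * κ * (x + a)) = c at *
  have hs2 : s ^ 2 = c ^ 2 - 1 := by linarith
  field_simp
  norm_num only [pow_one]
  rw [hDe]
  linear_combination (4 * (α - γ * c) * (α + γ * c) - 2 * γ * (2 * α * c + 3 * γ - γ * c ^ 2) -
    ((α + γ * c) * (α + γ * c - 12 * α) - 15 * (γ ^ 2 - α ^ 2))) * hs2

theorem abs_peakRiccati_le (hα : 0 < α) (hγ : 0 < γ) (hκ : 0 < κ) (ha : 0 < a) {x : ℝ}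
    (hx : 0 ≤ x) : |peakRiccati α γ κ a x| ≤
      κ + 2 * κ * (α / γ + γ / α) / sinh (2 * κ * a) := by
  have hD := peakDenom_pos (κ := κ) (a := a) hα hγ x
  have hs := sinh_arg_pos hκ ha hx
  have hs0 : 0 < sinh (2 * κ * a) := by
    rw [sinh_pos_iff]
    positivity
  have hss : sinh (2 * κ * a) ≤ sinh (2 * κ * (x + a)) := by
    rw [sinh_le_sinh]
    nlinarith
  have hcp := cosh_pos (2 * κ * (x + a))
  have e : peakRiccati α γ κ a x = -κ * peakSlope α γ κ a x +
      2 * κ * (α * cosh (2 * κ * (x + a)) + γ) / peakDenom α γ κ a x /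
        sinh (2 * κ * (x + a)) := by
    unfold peakRiccati peakSlope
    have hcs := cosh_sq (2 * κ * (x + a))
    generalize sinh (2 * κ * (x + a)) = s at *
    generalize cosh (2 * κ * (x + a)) = c at *
    field_simp
    linear_combination (-γ) * hcs
  rw [e]
  refine (abs_add_le _ _).trans (add_le_add ?_ ?_)
  · rw [abs_mul, abs_neg, abs_of_pos hκ]
    exact mul_le_of_le_one_right hκ.le (abs_peakSlope_le hα hγ x)
  · rw [abs_of_nonneg (by positivity)]
    refine div_le_div₀ (by positivity) ?_ hs0 hss
    rw [div_le_iff₀ hD, mul_assoc (2 * κ) (α / γ + γ / α)]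
    refine mul_le_mul_of_nonneg_left ?_ (by positivity)
    unfold peakDenom
    have h1 : (α / γ + γ / α) * (α + γ * cosh (2 * κ * (x + a))) =
        α * cosh (2 * κ * (x + a)) + γ + (α ^ 2 / γ + γ ^ 2 / α * cosh (2 * κ * (x + a))) := by
      field_simp
      ring
    rw [h1]
    have : 0 ≤ α ^ 2 / γ + γ ^ 2 / α * cosh (2 * κ * (x + a)) := by positivity
    linarith

theorem continuousOn_peakRiccati (hα : 0 < α) (hγ : 0 < γ) (hκ : 0 < κ) (ha : 0 < a) :
    ContinuousOn (peakRiccati α γ κ a) (Ici 0) := by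
  intro x hx
  exact (hasDerivAt_peakRiccati hα hγ hκ ha hx).continuousAt.continuousWithinAt

theorem continuous_peak (hα : 0 < α) (hγ : 0 < γ) : Continuous (peak α γ κ a) :=
  continuous_iff_continuousAt.2 fun x => (hasDerivAt_peak hα hγ x).continuousAt

theorem peak_sq_le_peak_zero_sq (hα : 0 < α) (hγ : 0 < γ) (hκ : 0 < κ) (ha : 0 < a) {x : ℝ}
    (hx : 0 ≤ x) : peak α γ κ a x ^ 2 ≤ peak α γ κ a 0 ^ 2 := by
  rw [peak_sq hα hγ, peak_sq hα hγ]
  refine div_le_div_of_nonneg_left (by positivity) (peakDenom_pos hα hγ 0) ?_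
  unfold peakDenom
  have : cosh (2 * κ * (0 + a)) ≤ cosh (2 * κ * (x + a)) := by
    rw [cosh_le_cosh, abs_of_pos (by positivity), abs_of_pos (by positivity)]
    nlinarith
  nlinarith

theorem peak_sq_lt (hα : 0 < α) (hγ : 0 < γ) (hκ : 0 < κ) (x : ℝ) :
    peak α γ κ a x ^ 2 < κ ^ 2 / α := by
  rw [peak_sq hα hγ]
  refine div_lt_div_of_pos_left (by positivity) hα ?_
  unfold peakDenom
  have := cosh_pos (2 * κ * (x + a))
  have : 0 < γ * cosh (2 * κ * (x + a)) := by positivity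
  linarith

/-- The first integral of the profile equation. -/
theorem sq_mul_peakSlope_sq (hα : 0 < α) (hγ : 0 < γ) (hκ : 0 < κ) (x : ℝ) :
    κ ^ 2 * peakSlope α γ κ a x ^ 2 = κ ^ 2 - 2 * α * peak α γ κ a x ^ 2 -
      (γ ^ 2 - α ^ 2) / κ ^ 2 * (peak α γ κ a x ^ 2) ^ 2 := by
  have hD := peakDenom_pos (κ := κ) (a := a) hα hγ x
  rw [peak_sq hα hγ]
  have hcs := cosh_sq (2 * κ * (x + a))
  unfold peakSlope
  generalize hDd : peakDenom α γ κ a x = D at *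
  have hDe : D = α + γ * cosh (2 * κ * (x + a)) := hDd.symm
  generalize sinh (2 * κ * (x + a)) = s at *
  generalize cosh (2 * κ * (x + a)) = c at *
  field_simp
  rw [hDe]
  linear_combination (-γ ^ 2) * hcs

end

end NLSCQ

namespace NLSCQ

open Real ComplexConjugate

/-! ### The profile and its linearization -/

theorem exists_peakSlope_eq {α γ κ t : ℝ} (hα : 0 < α) (hγ : 0 < γ) (hκ : 0 < κ) (ht0 : 0 ≤ t)
    (ht1 : t < 1) : ∃ s, peakSlope α γ κ 0 s = t := by
  have hc : Continuous (peakSlope α γ κ 0) :=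
    continuous_iff_continuousAt.2 fun x => (hasDerivAt_peakSlope hα hγ x).continuousAt
  have h1t : 0 < 1 - t := by linarith
  set S : ℝ := (α + γ) / (γ * (2 * κ) * (1 - t)) with hS
  have hS0 : 0 < S := by positivity
  have hD := peakDenom_pos (κ := κ) (a := 0) hα hγ S
  have hv : t ≤ peakSlope α γ κ 0 S := by
    rw [peakSlope, le_div_iff₀ hD, peakDenom]
    have hy : 0 ≤ 2 * κ * (S + 0) := by positivity
    have h1 : 2 * κ * (S + 0) ≤ cosh (2 * κ * (S + 0)) :=
      (self_le_sinh_iff.2 hy).trans (sinh_lt_cosh _).le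
    have h2 : cosh (2 * κ * (S + 0)) - sinh (2 * κ * (S + 0)) ≤ 1 := by
      rw [cosh_sub_sinh, exp_le_one_iff]
      linarith
    have h3 : γ * (2 * κ * (S + 0)) * (1 - t) = α + γ := by
      rw [hS]
      field_simp
      simp
    have h4 : γ * (2 * κ * (S + 0)) * (1 - t) ≤ γ * cosh (2 * κ * (S + 0)) * (1 - t) := by gcongr
    nlinarith
  obtain ⟨s, -, hs⟩ := intermediate_value_Icc hS0.le hc.continuousOn
    (show t ∈ Icc (peakSlope α γ κ 0 0) (peakSlope α γ κ 0 S) from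
      ⟨by simpa [peakSlope] using ht0, hv⟩)
  exact ⟨s, hs⟩

/-- The parameters of the profile. -/
structure IsPeakData (l1 l2 ω Z α γ κ a : ℝ) : Prop where
  α_pos : 0 < α
  γ_pos : 0 < γ
  κ_pos : 0 < κ
  a_pos : 0 < a
  l1_eq : l1 = 4 * α
  l2_eq : l2 = 3 * ((γ ^ 2 - α ^ 2) / κ ^ 2)
  ω_eq : ω = -κ ^ 2
  slope_eq : peakSlope α γ κ a 0 = Z / (2 * κ)
  profile_eq : ∀ x, profile l1 l2 ω Z x = peak α γ κ a |x|

theorem exists_isPeakData {l1 l2 ω Z : ℝ} (hl1 : 0 < l1) (hZ : 0 < Z) (hω : Z ^ 2 / 4 < -ω)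
    (hγ : 0 < (l1 / 4) ^ 2 - l2 / 3 * ω) : ∃ α γ κ a, IsPeakData l1 l2 ω Z α γ κ a := by
  have hω0 : 0 < -ω := lt_of_le_of_lt (by positivity) hω
  have hα : 0 < l1 / 4 := by positivity
  have hκ := sqrt_pos.2 hω0
  have hκ2 : √(-ω) ^ 2 = -ω := sq_sqrt hω0.le
  have hγ' := sqrt_pos.2 hγ
  have hγ2 := sq_sqrt hγ.le
  set κ := √(-ω) with hκd
  set γ := √((l1 / 4) ^ 2 - l2 / 3 * ω) with hγd
  have hsh : shiftFun l1 l2 ω = peakSlope (l1 / 4) γ κ 0 := by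
    ext s
    simp only [shiftFun, peakSlope, peakDenom, add_zero, ← hκd, ← hγd]
  have ht : Z / (2 * κ) < 1 := by
    rw [div_lt_one (by positivity)]
    nlinarith
  have ha : peakSlope (l1 / 4) γ κ 0 (Function.invFun (shiftFun l1 l2 ω) (Z / (2 * κ))) =
      Z / (2 * κ) := by
    rw [← hsh]
    refine Function.invFun_eq ?_
    rw [hsh]
    exact exists_peakSlope_eq hα hγ' hκ (by positivity) ht
  refine ⟨l1 / 4, γ, κ, Function.invFun (shiftFun l1 l2 ω) (Z / (2 * κ)), ?_⟩
  have hpr : ∀ x, profile l1 l2 ω Z x = ((l1 / 4) / (-ω) + γ / (-ω) * cosh (2 * κ *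
      (|x| + Function.invFun (shiftFun l1 l2 ω) (Z / (2 * κ))))) ^ (-(1 / 2) : ℝ) := fun x => rfl
  generalize Function.invFun (shiftFun l1 l2 ω) (Z / (2 * κ)) = a at *
  refine ⟨hα, hγ', hκ, ?_, by ring, ?_, by rw [hκ2, neg_neg], ?_, fun x => ?_⟩
  · have hD := peakDenom_pos (κ := κ) (a := 0) hα hγ' a
    have h1 : 0 < peakSlope (l1 / 4) γ κ 0 a := by
      rw [ha]
      positivity
    rw [peakSlope, lt_div_iff₀ hD, zero_mul, mul_pos_iff_of_pos_left hγ', sinh_pos_iff, add_zero,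
      mul_pos_iff_of_pos_left (by positivity)] at h1
    exact h1
  · have hω1 : ω ≠ 0 := by linarith
    rw [hγ2, hκ2]
    field_simp
    ring
  · rw [← ha]
    simp only [peakSlope, peakDenom, add_zero, zero_add]
  · have hD := peakDenom_pos (κ := κ) (a := a) hα hγ' |x|
    rw [hpr, show (l1 / 4) / (-ω) + γ / (-ω) * cosh (2 * κ * (|x| + a)) =
      peakDenom (l1 / 4) γ κ a |x| / κ ^ 2 by rw [hκ2, peakDenom]; ring,
      rpow_neg (by positivity), ← sqrt_eq_rpow, sqrt_div hD.le, sqrt_sq hκ.le, inv_div, peak]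

namespace IsPeakData

variable {l1 l2 ω Z α γ κ a : ℝ}

theorem potential_eq (h : IsPeakData l1 l2 ω Z α γ κ a) (x : ℝ) : potential l1 l2 ω Z x =
    κ ^ 2 - 12 * α * peak α γ κ a |x| ^ 2 -
      15 * ((γ ^ 2 - α ^ 2) / κ ^ 2) * peak α γ κ a |x| ^ 4 := by
  rw [potential, h.profile_eq]
  nth_rewrite 1 [h.ω_eq]
  nth_rewrite 1 [h.l1_eq]
  nth_rewrite 1 [h.l2_eq]
  ring

/-- The linearization is nonnegative on functions that vanish at the origin. -/
theorem re_inner_linearizedOp_nonneg (h : IsPeakData l1 l2 ω Z α γ κ a)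
    (f : (linearizedOp l1 l2 ω Z).domain)
    (hf : valueAtZero (linearizedOp l1 l2 ω Z).domain deltaDomain_exists_value f = 0) :
    0 ≤ (⟪linearizedOp l1 l2 ω Z f, (f : L2)⟫_ℂ).re := by
  have hω : ω < 0 := by rw [h.ω_eq]; have := h.κ_pos; simp; positivity
  have hl1 : 0 < l1 := by rw [h.l1_eq]; have := h.α_pos; positivity
  obtain ⟨hV, C, hC⟩ := potential_bounded (l2 := l2) (Z := Z) hl1 hω
  set B := κ + 2 * κ * (α / γ + γ / α) / sinh (2 * κ * a) with hB
  have hB1 := fun x hx => abs_peakRiccati_le h.α_pos h.γ_pos h.κ_pos h.a_pos (x := x) hx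
  have hB0 : 0 ≤ B := (abs_nonneg _).trans (hB1 0 le_rfl)
  have hC0 : 0 ≤ C := (abs_nonneg _).trans (hC 0)
  have he : ∀ x, 0 ≤ x → κ ^ 2 - 12 * α * peak α γ κ a x ^ 2 -
      15 * ((γ ^ 2 - α ^ 2) / κ ^ 2) * peak α γ κ a x ^ 4 = potential l1 l2 ω Z x := by
    intro x hx
    rw [h.potential_eq, abs_of_nonneg hx]
  have hc := continuous_peak (κ := κ) (a := a) h.α_pos h.γ_pos
  refine re_inner_deltaOp_nonneg hV hC (p := peakRiccati α γ κ a) (B := B + C + B ^ 2)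
    (fun x hx => hasDerivAt_peakRiccati h.α_pos h.γ_pos h.κ_pos h.a_pos hx)
    (ContinuousOn.sub (by fun_prop)
      ((continuousOn_peakRiccati h.α_pos h.γ_pos h.κ_pos h.a_pos).pow 2))
    (fun x hx => (hB1 x hx).trans (by nlinarith)) (fun x hx => ?_) (fun x hx => ?_) (fun x => ?_)
    f hf
  · rw [he x hx]
    refine (abs_sub _ _).trans ?_
    rw [abs_pow]
    have := pow_le_pow_left₀ (abs_nonneg _) (hB1 x hx) 2
    linarith [hC x]
  · rw [he x hx.le]
    ring
  · rw [h.potential_eq, h.potential_eq, abs_neg]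

/-- The profile lies in the domain of the linearization. -/
theorem exists_profile_mem (h : IsPeakData l1 l2 ω Z α γ κ a) :
    ∃ (φ : (linearizedOp l1 l2 ω Z).domain) (v w : L2),
      (((φ : L2) : ℝ → ℂ) =ᵐ[volume] fun x => (peak α γ κ a |x| : ℂ)) ∧
      ((w : ℝ → ℂ) =ᵐ[volume] fun x => (((κ ^ 2 - 4 * α * peak α γ κ a |x| ^ 2 -
        3 * ((γ ^ 2 - α ^ 2) / κ ^ 2) * peak α γ κ a |x| ^ 4) * peak α γ κ a |x| : ℝ) : ℂ)) ∧
      IsWeakDeriv {0}ᶜ (φ : L2) v ∧ IsWeakDeriv {0}ᶜ v w ∧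
      HasValueAtZero (φ : L2) (peak α γ κ a 0) := by
  have hα := h.α_pos
  have hγ := h.γ_pos
  have hκ := h.κ_pos
  have hω : ω < 0 := by rw [h.ω_eq]; simp; positivity
  have hl1 : 0 < l1 := by rw [h.l1_eq]; positivity
  set δ := (γ ^ 2 - α ^ 2) / κ ^ 2 with hδ
  have hc := continuous_peak (κ := κ) (a := a) hα hγ
  set N := κ ^ 2 + 4 * α * (κ ^ 2 / α) + 3 * |δ| * (κ ^ 2 / α) ^ 2 with hN
  have hN0 : 0 ≤ N := by positivity
  have hb : ∀ x, 0 ≤ x → ∀ q M : ℝ, 0 ≤ M → |q| ≤ M → M ≤ 1 + κ + N →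
      |q * peak α γ κ a x| ≤ (1 + κ + N) * √(2 * κ ^ 2 / γ) * exp (-κ * x) := by
    intro x hx q M hM hq hM'
    rw [abs_mul, abs_of_pos (peak_pos hα hγ hκ x), mul_assoc]
    exact mul_le_mul (hq.trans hM') (peak_le hα hγ hκ h.a_pos) (peak_pos hα hγ hκ x).le
      (by positivity)
  obtain ⟨u, v, w, hu, hw, huv, hvw, h0, hr, hl⟩ := exists_radial
    (g := peak α γ κ a) (K := (1 + κ + N) * √(2 * κ ^ 2 / γ))
    (hasDerivAt_peak hα hγ) (hasDerivAt_deriv_peak hα hγ) (by fun_prop) hκ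
    (fun x hx => by simpa using hb x hx 1 1 zero_le_one (by simp) (by linarith))
    (fun x hx => hb x hx _ κ hκ.le (by
      rw [abs_mul, abs_neg, abs_of_pos hκ]
      exact mul_le_of_le_one_right hκ.le (abs_peakSlope_le hα hγ x)) (by linarith))
    (fun x hx => hb x hx _ N hN0 (by
      have h1 := (peak_sq_lt (a := a) hα hγ hκ x).le
      have h2 : peak α γ κ a x ^ 4 ≤ (κ ^ 2 / α) ^ 2 := by
        rw [show peak α γ κ a x ^ 4 = (peak α γ κ a x ^ 2) ^ 2 by ring]
        gcongr
      refine (abs_sub _ _).trans (add_le_add ((abs_sub _ _).trans (add_le_add ?_ ?_)) ?_)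
      · rw [abs_of_pos (by positivity)]
      · rw [abs_of_nonneg (by positivity)]
        gcongr
      · rw [abs_mul, abs_mul, abs_of_pos (by norm_num : (0 : ℝ) < 3),
          abs_of_nonneg (by positivity : 0 ≤ peak α γ κ a x ^ 4)]
        gcongr) (by linarith))
  have hmem : u ∈ (linearizedOp l1 l2 ω Z).domain := by
    rw [linearizedOp_domain hl1 hω]
    refine ⟨⟨⟨v, huv⟩, v, _, _, _, huv.mono (subset_univ _), h0, hr, hl, ?_⟩,
      mem_secondDeriv_domain.2 ⟨v, w, huv.mono (subset_univ _), hvw⟩⟩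
    rw [h.slope_eq, sub_neg_eq_add]
    norm_cast
    field_simp
    ring
  exact ⟨⟨u, hmem⟩, v, w, hu, hw, huv.mono (subset_univ _), hvw, h0⟩

theorem valueAtZero_ne_zero (h : IsPeakData l1 l2 ω Z α γ κ a) :
    valueAtZero (linearizedOp l1 l2 ω Z).domain deltaDomain_exists_value ≠ 0 := by
  obtain ⟨φ, v, w, -, -, -, -, h0⟩ := h.exists_profile_mem
  intro hz
  have h1 := (valueAtZero_spec _ deltaDomain_exists_value φ).unique h0
  have h2 : ((peak α γ κ a 0 : ℝ) : ℂ) = 0 := h1.symm.trans (LinearMap.congr_fun hz φ)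
  exact (peak_pos h.α_pos h.γ_pos h.κ_pos 0).ne' (by exact_mod_cast h2)

theorem add_two_mul_mul_sq_pos (h : IsPeakData l1 l2 ω Z α γ κ a)
    (hb : 0 < l2 ∨ (l2 < 0 ∧ -ω < -(3 * l1 ^ 2 / (16 * l2)) ∧
      -ω < -(1 / 6 * (l1 ^ 2 / l2)) + Z ^ 2 / 4)) {x : ℝ} (hx : 0 ≤ x) :
    0 < l1 + 2 * l2 * peak α γ κ a x ^ 2 := by
  have hα := h.α_pos
  have hκ := h.κ_pos
  have hl1 : 0 < l1 := by rw [h.l1_eq]; positivity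
  rcases hb with hl2 | ⟨hl2, h1, h2⟩
  · positivity
  have hle := peak_sq_le_peak_zero_sq hα h.γ_pos hκ h.a_pos hx
  have hlt := peak_sq_lt (a := a) hα h.γ_pos hκ 0
  have hint := sq_mul_peakSlope_sq (a := a) hα h.γ_pos hκ 0
  rw [h.slope_eq] at hint
  have hp := sq_nonneg (peak α γ κ a 0)
  generalize peak α γ κ a 0 ^ 2 = q at *
  have hδ : (γ ^ 2 - α ^ 2) / κ ^ 2 = l2 / 3 := by rw [h.l2_eq]; ring
  have hα' : α = l1 / 4 := by rw [h.l1_eq]; ring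
  have hκ' : κ ^ 2 = -ω := by rw [h.ω_eq]; ring
  have hZκ : κ ^ 2 * (Z / (2 * κ)) ^ 2 = Z ^ 2 / 4 := by
    field_simp
    norm_num
  rw [hZκ, hδ, hα', hκ'] at hint
  rw [hα', hκ', lt_div_iff₀ (by positivity)] at hlt
  obtain ⟨L, rfl⟩ : ∃ L, l2 = -L := ⟨-l2, by ring⟩
  have hL : 0 < L := by linarith
  have e1 : -(3 * l1 ^ 2 / (16 * -L)) = 3 * l1 ^ 2 / (16 * L) := by
    rw [mul_neg, div_neg, neg_neg]
  have e2 : -(1 / 6 * (l1 ^ 2 / -L)) = l1 ^ 2 / (6 * L) := by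
    rw [div_neg]; field_simp
  rw [e1, lt_div_iff₀ (by positivity)] at h1
  rw [e2, ← sub_lt_iff_lt_add, lt_div_iff₀ (by positivity)] at h2
  have h3 : L * q < 3 / 4 * l1 := by
    have : L * q * l1 < 3 / 4 * l1 * l1 := by nlinarith
    exact lt_of_mul_lt_mul_right this hl1.le
  have h4 : 0 < (l1 - 2 * L * q) * (l1 - L * q) := by
    have : -ω - Z ^ 2 / 4 = l1 / 2 * q - L / 3 * q ^ 2 := by linarith
    rw [this] at h2
    nlinarith
  have h5 : 0 < l1 - 2 * L * q := (mul_pos_iff_of_pos_right (by linarith)).1 h4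
  nlinarith

/-- The profile is a negative direction of the linearization. -/
theorem exists_re_inner_neg (h : IsPeakData l1 l2 ω Z α γ κ a)
    (hb : 0 < l2 ∨ (l2 < 0 ∧ -ω < -(3 * l1 ^ 2 / (16 * l2)) ∧
      -ω < -(1 / 6 * (l1 ^ 2 / l2)) + Z ^ 2 / 4)) :
    ∃ φ : (linearizedOp l1 l2 ω Z).domain,
      (((φ : L2) : ℝ → ℂ) =ᵐ[volume] fun x => (profile l1 l2 ω Z x : ℂ)) ∧
      (⟪linearizedOp l1 l2 ω Z φ, (φ : L2)⟫_ℂ).re < 0 := by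
  obtain ⟨φ, v, w, hφ, hw, h1, h2, -⟩ := h.exists_profile_mem
  refine ⟨φ, by simpa only [h.profile_eq] using hφ, ?_⟩
  set F : ℝ → ℝ := fun x =>
    2 * peak α γ κ a |x| ^ 4 * (l1 + 2 * l2 * peak α γ κ a |x| ^ 2) with hF
  have hF0 : ∀ x, 0 < F x := fun x => by
    have hp := peak_pos (a := a) h.α_pos h.γ_pos h.κ_pos |x|
    have := h.add_two_mul_mul_sq_pos hb (abs_nonneg x)
    positivity
  have he : (fun x => conj (linearizedOp l1 l2 ω Z φ x) * (φ : L2) x) =ᵐ[volume]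
      fun x => ((-F x : ℝ) : ℂ) := by
    filter_upwards [deltaOp_apply_ae φ h1 h2, hφ, hw] with x e1 e2 e3
    change conj (deltaOp Z (potential l1 l2 ω Z) φ x) * _ = _
    rw [e1, e2, e3, h.potential_eq, Complex.real_smul, hF]
    simp only [h.l1_eq, h.l2_eq, ← Complex.ofReal_mul, ← Complex.ofReal_neg, ← Complex.ofReal_add,
      Complex.conj_ofReal]
    congr 1
    ring
  have hi : Integrable F := by
    have := ((L2.integrable_conj_mul _ _).congr he).re.neg
    simpa using this
  have hpos : 0 < ∫ x, F x := by
    rw [integral_pos_iff_support_of_nonneg (fun x => (hF0 x).le) hi,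
      show Function.support F = univ from eq_univ_of_forall fun x => (hF0 x).ne']
    simp
  rw [L2.inner_eq, integral_congr_ae he, integral_complex_ofReal, Complex.ofReal_re, integral_neg]
  linarith

end IsPeakData

theorem rank_adjoint_eigenspace {l1 l2 ω Z α γ κ a : ℝ} (h : IsPeakData l1 l2 ω Z α γ κ a)
    (hl1 : 0 < l1) (hω : ω < 0) {z : ℂ} (hz : z.im ≠ 0) :
    Module.rank ℂ (eigenspace (minimalOp l1 l2 ω Z)† z) = 1 := by
  obtain ⟨hV, C, hC⟩ := potential_bounded (l2 := l2) (Z := Z) hl1 hω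
  obtain ⟨r, hr, hr'⟩ := exists_span_adjoint_eigenspace (deltaOp_isSelfAdjoint Z hV hC)
    (dense_minOp_domain hV hC) (minOp_le_deltaOp Z _) _ mem_minOp_domain_iff
    (norm_valueAtZero_sq_le Z hV hC) h.valueAtZero_ne_zero hz
  have : eigenspace (minimalOp l1 l2 ω Z)† z = Submodule.span ℂ {r} := Submodule.ext hr'
  rw [this, rank_submodule_eq_one_iff]
  refine ⟨r, Submodule.mem_span_singleton_self r, hr, le_rfl⟩

end NLSCQ

open NLSCQ in
theorem mainTheorem9 (l1 l2 ω Z : ℝ) (hl1 : 0 < l1) (hZ : 0 < Z)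
    (hadm : (0 < l2 ∧ Z ^ 2 / 4 < -ω) ∨
      (l2 < 0 ∧ Z ^ 2 / 4 < -ω ∧ -ω < -(3 * l1 ^ 2 / (16 * l2)))) :
    -- the minimal operator is densely defined, symmetric, nonnegative, with indices (1,1)
    Dense ((minimalOp l1 l2 ω Z).domain : Set L2) ∧
    (minimalOp l1 l2 ω Z).IsFormalAdjoint (minimalOp l1 l2 ω Z) ∧
    (∀ f : (minimalOp l1 l2 ω Z).domain,
      0 ≤ (⟪minimalOp l1 l2 ω Z f, (f : L2)⟫_ℂ).re) ∧
    deficiencyPlus (minimalOp l1 l2 ω Z) = 1 ∧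
    deficiencyMinus (minimalOp l1 l2 ω Z) = 1 ∧
    -- the linearized operator is a self-adjoint extension of it, with Morse index at most one
    IsSelfAdjoint (linearizedOp l1 l2 ω Z) ∧
    minimalOp l1 l2 ω Z ≤ linearizedOp l1 l2 ω Z ∧
    morseIndex (linearizedOp l1 l2 ω Z) ≤ 1 ∧
    -- the profile is a negative direction and the Morse index is one
    ((0 < l2 ∨ (l2 < 0 ∧ Z < √3 * l1 / (2 * √(-l2)) ∧
        -ω < min (-(3 * l1 ^ 2 / (16 * l2))) (-(1 / 6 * (l1 ^ 2 / l2)) + Z ^ 2 / 4))) →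
      (∃ φ : (linearizedOp l1 l2 ω Z).domain,
        ((φ : L2) : ℝ → ℂ) =ᵐ[volume] (fun x => (profile l1 l2 ω Z x : ℂ)) ∧
        (⟪linearizedOp l1 l2 ω Z φ, (φ : L2)⟫_ℂ).re < 0) ∧
      morseIndex (linearizedOp l1 l2 ω Z) = 1) := by
  have hω : Z ^ 2 / 4 < -ω := by
    rcases hadm with h | h
    exacts [h.2, h.2.1]
  have hω0 : ω < 0 := by nlinarith [sq_nonneg Z]
  have hγ : 0 < (l1 / 4) ^ 2 - l2 / 3 * ω := by
    rcases hadm with h | h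
    · nlinarith [sq_nonneg l1, mul_pos h.1 (neg_pos.2 hω0)]
    · have h1 := h.2.2
      rw [← div_neg, lt_div_iff₀ (by linarith [h.1])] at h1
      nlinarith
  obtain ⟨α, γ, κ, a, h⟩ := exists_isPeakData hl1 hZ hω hγ
  obtain ⟨hV, C, hC⟩ := potential_bounded (l2 := l2) (Z := Z) hl1 hω0
  have hle := minOp_le_deltaOp Z (potential l1 l2 ω Z)
  have hs := deltaOp_isFormalAdjoint Z (potential l1 l2 ω Z)
  have hval : ∀ f : (minimalOp l1 l2 ω Z).domain,
      minimalOp l1 l2 ω Z f = linearizedOp l1 l2 ω Z ⟨f, hle.1 f.2⟩ := fun f => hle.2 rfl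
  have hsa := deltaOp_isSelfAdjoint Z hV hC
  have hone := morseIndex_le_one hs _ h.re_inner_linearizedOp_nonneg
  refine ⟨dense_minOp_domain hV hC, fun f g => ?_, fun f => ?_,
    rank_adjoint_eigenspace h hl1 hω0 (by simp), rank_adjoint_eigenspace h hl1 hω0 (by simp),
    hsa, hle, hone, fun hb => ?_⟩
  · rw [hval, hval]
    exact hs ⟨f, hle.1 f.2⟩ ⟨g, hle.1 g.2⟩
  · rw [hval]
    exact h.re_inner_linearizedOp_nonneg ⟨f, hle.1 f.2⟩ ((mem_minOp_domain_iff _).1 f.2)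
  · obtain ⟨φ, hφ, hneg⟩ := h.exists_re_inner_neg
      (hb.imp id fun hb => ⟨hb.1, lt_min_iff.1 hb.2.2⟩)
    refine ⟨⟨φ, hφ, hneg⟩, le_antisymm hone ?_⟩
    obtain ⟨μ, hμ, f, hf0, hf⟩ := exists_negative_eigenvalue hsa _
      (norm_valueAtZero_sq_le Z hV hC) h.re_inner_linearizedOp_nonneg hneg
    exact one_le_morseIndex hμ f hf0 hf
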